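/- Let $r\ge 1$ and $d$ be integers. **Table.** Let $D\subset\mathbb R^d$ be a closed set (it need not be bounded, so lifts of tables in a torus are included) whose boundary is a finite union $\partial D=\Gamma_1\cup\dots\cup\Gamma_n$ of closed pieces, and let $\Gamma^*\subset\partial D$ be the closed corner set, such that $\Gamma_i\cap\Gamma_j\subset\Gamma^*$ for $i\ne j$, and near each point of $\Gamma_i\setminus\Gamma^*$ one has $D=\{F\ge 0\}$ for some $C^{r+1}$ function $F$ that vanishes at the point with non-zero gradient. A phase point $\rho=(q,p)$ is *inner* if $q\in\operatorname{int}D$. The billiard flow $b_t$ moves $q$ with constant momentum $p$ inside $D$; at a point $q\in\partial D\setminus\Gamma^*$ with inward unit normal $n$ it reflects by $p_{out}=p_{in}-2\langle p_{in},n\rangle n$ (tangencies count as collisions); $b_t\rho=\rho'$ for inner points $\rho,\rho'$ means that the trajectory from $\rho$ to $\rho'$ has finitely many collisions on $[0,t]$, none at a corner. A collision is a *regular reflection* if $\langle p_{in},n\rangle<0$, and a *non-degenerate tangency* if $\langle p_{in},n\rangle=0$ and $D^2F(q)(p_{in},p_{in})>0$ for a local $C^2$ defining function $F$ as above (the boundary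 is strictly concave in the direction of motion). **Potential.** For small $\epsilon>0$ let $V(\cdot;\epsilon):\mathbb R^d\to(-\infty,+\infty]$ be continuous, and $C^{r+1}$ where it is finite, and let $0<\mathcal E_i\le+\infty$, $i=1,\dots,n$. Assume: * (I) For every compact $K\subset\operatorname{int}D$, $\|V(\cdot;\epsilon)\|_{C^{r+1}(K)}\to0$ as $\epsilon\to+0$. Assume further that for every open $N\supset\Gamma^*$ there are $\epsilon_0>0$, $a>0$, pairwise disjoint open sets $\tilde N_i\supset\Gamma_i\setminus N$, constants $Q_i$, a pattern function $Q(q;\epsilon)$ on $\bigcup_i\tilde N_i$, $0\le\epsilon\le\epsilon_0$, which is $C^{r+1}$ in $q$, depends continuously on $\epsilon\in[0,\epsilon_0]$ in the $C^{r+1}$ topology (uniform convergence on compact sets) and satisfies $|Q-Q_i|<a$ on $\tilde N_i$, and barrier functions $W_i(x;\epsilon)\in(-\infty,+\infty]$, $|x|<a$, $0<\epsilon\le\epsilon_0$, continuous in $x$, $C^{r+1}$ in $x$ where finite, and continuous in $\epsilon$, such that for each $i$: * (IIa) $Q(\cdot;0)=Q_i$ on $\Gamma_i\cap\tilde N_i$,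 and a point $q\in\tilde N_i$ lies in $D$ if and only if $Q(q;0)\ge Q_i$; * (IIb) $V(q;\epsilon)=W_i(Q(q;\epsilon)-Q_i;\epsilon)$ for $q\in\tilde N_i$, $0<\epsilon\le\epsilon_0$; * (IIc) $\nabla Q(q;\epsilon)\neq0$ for $q\in\tilde N_i$, $0\le\epsilon\le\epsilon_0$, and $\partial_xW_i(x;\epsilon)\ne0$ wherever $W_i$ is finite; * (III) as $\epsilon\to+0$, $W_i(x;\epsilon)\to0$ for each $x\in(0,a)$ and $W_i(x;\epsilon)\to\mathcal E_i$ for each $x\in(-a,0)$; * (IV) for all $0<w_1<w_2<\mathcal E_i$: for small $\epsilon$ each $w\in[w_1,w_2]$ equals $W_i(x;\epsilon)$ for exactly one $x=\mathcal Q_i(w;\epsilon)\in(-a,a)$, and $\mathcal Q_i(\cdot;\epsilon)$ tends to zero uniformly on $[w_1,w_2]$, together with its derivatives up to order $r+1$, as $\epsilon\to+0$. Let $h^\epsilon_t$ be the flow of Hamilton's equations $\dot q=p$, $\dot p=-\nabla V(q;\epsilon)$ of $H=\tfrac{p^2}{2}+V(q;\epsilon)$. **Theorem.** Let $\rho_0=(q_0,p_0)$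 be an inner phase point of energy $H^*=\tfrac12|p_0|^2<\mathcal E:=\min_i\mathcal E_i$, let $T\ge0$, and suppose that $b_T\rho_0$ is an inner phase point and that on $[0,T]$ the billiard trajectory of $\rho_0$ has finitely many collisions, all of them regular reflections or non-degenerate tangencies. Then there is $\delta>0$ such that for all phase points $\rho$ with $|\rho-\rho_0|<\delta$ and all $t\ge0$ with $|t-T|<\delta$ the point $b_t\rho$ exists and is unique, $h^\epsilon_t\rho$ exists and is unique for all sufficiently small $\epsilon>0$ (uniformly in $\rho$ and $t$), and $h_t^\epsilon\rho\to b_t\rho$ as $\epsilon\to+0$, uniformly for these $\rho$ and $t$. In particular this holds for the points $\rho$ near $\rho_0$ on the energy surface $H=H^*$. -/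

import Mathlib

open Set Filter Topology

noncomputable section

namespace SteepBilliard

/-- Configuration space: `ℝ^d` with its Euclidean structure. -/
abbrev Space (d : ℕ) : Type := EuclideanSpace ℝ (Fin d)

/-- Phase points `ρ = (q, p)`. -/
abbrev Phase (d : ℕ) : Type := Space d × Space d

/-! ### Billiards -/

/-- `F` is a `C^n` function that defines `D` near its boundary point `x`: near `x` the set `D` is
`{F ≥ 0}`, and `F` vanishes at `x` with non-zero gradient. -/
structure IsDefiningFunction {d : ℕ} (n : ℕ) (D : Set (Space d)) (F : Space d → ℝ)
    (x : Space d) : Prop where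
  contDiffAt : ContDiffAt ℝ n F x
  zero : F x = 0
  gradient_ne : gradient F x ≠ 0
  mem_iff : ∀ᶠ y in 𝓝 x, (y ∈ D ↔ 0 ≤ F y)

/-- A billiard table in `ℝ^d` with piecewise `C^(r+1)` boundary. The boundary of the closed set `D`
is the union of finitely many pieces `Γ i`; away from the corner set (the union of the edges of the
pieces) the pieces are disjoint `C^(r+1)` hypersurfaces which have `D` on exactly one side.
`D` need not be bounded, so that the lift to `ℝ^d` of a table in a torus is included. -/
structure Table (d r : ℕ) (ι : Type) where
  D : Set (Space d)
  isClosed : IsClosed D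
  Γ : ι → Set (Space d)
  isClosed_Γ : ∀ i, IsClosed (Γ i)
  frontier_eq : frontier D = ⋃ i, Γ i
  corner : Set (Space d)
  isClosed_corner : IsClosed corner
  corner_subset : corner ⊆ frontier D
  inter_subset : ∀ i j, i ≠ j → Γ i ∩ Γ j ⊆ corner
  smooth : ∀ i, ∀ x ∈ Γ i \ corner, ∃ F, IsDefiningFunction (r + 1) D F x

/-- `n` is the inward unit normal to the boundary of `D` at `x`. -/
def IsInwardNormal {d : ℕ} (D : Set (Space d)) (x n : Space d) : Prop :=
  ∃ F, IsDefiningFunction 2 D F x ∧ n = ‖gradient F x‖⁻¹ • gradient F x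

/-- The elastic reflection law `p_out = p_in - 2 ⟨p_in, n⟩ n` at the boundary point `x`. -/
def ReflectionLaw {d : ℕ} (D : Set (Space d)) (x pin pout : Space d) : Prop :=
  ∃ n, IsInwardNormal D x n ∧ pout = pin - (2 * inner ℝ pin n) • n

/-- A collision at `x` with incoming momentum `v` is a regular reflection: `v` is transverse to the
boundary (and therefore points outwards). -/
def IsRegularReflection {d : ℕ} (D : Set (Space d)) (x v : Space d) : Prop :=
  ∃ n, IsInwardNormal D x n ∧ inner ℝ v n < 0

/-- A collision at `x` with incoming momentum `v` is a non-degenerate tangency: `v` is tangent to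
the boundary, and the normal curvature of the boundary in the direction `v` is non-zero, the table
being strictly concave in that direction. -/
def IsNondegenerateTangency {d : ℕ} (D : Set (Space d)) (x v : Space d) : Prop :=
  ∃ F, IsDefiningFunction 2 D F x ∧ inner ℝ v (gradient F x) = 0 ∧
    0 < fderiv ℝ (fderiv ℝ F) x v v

/-- `(q, p)` is, on the time interval `[0, S]`, a billiard trajectory between two inner phase
points, with finitely many collisions, none of them at a corner. Tangencies count as collisions.
The value of `p` at a collision time is immaterial. -/
structure IsBilliardTrajectory {d r : ℕ} {ι : Type} (B : Table d r ι) (S : ℝ)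
    (q p : ℝ → Space d) : Prop where
  nonneg : 0 ≤ S
  continuousOn : ContinuousOn q (Icc 0 S)
  mem : ∀ t ∈ Icc 0 S, q t ∈ B.D
  start_inner : q 0 ∈ interior B.D
  end_inner : q S ∈ interior B.D
  finite : {t ∈ Icc 0 S | q t ∈ frontier B.D}.Finite
  free : ∀ t ∈ Icc 0 S, q t ∈ interior B.D →
    HasDerivWithinAt q (p t) (Icc 0 S) t ∧ HasDerivWithinAt p 0 (Icc 0 S) t
  collision : ∀ t ∈ Icc 0 S, q t ∈ frontier B.D →
    q t ∉ B.corner ∧ ∃ pin pout, Tendsto p (𝓝[<] t) (𝓝 pin) ∧ Tendsto p (𝓝[>] t) (𝓝 pout) ∧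
      ReflectionLaw B.D (q t) pin pout

/-- `b_t ρ = σ`, for inner phase points `ρ` and `σ`. -/
def BilliardMapsTo {d r : ℕ} {ι : Type} (B : Table d r ι) (t : ℝ) (ρ σ : Phase d) : Prop :=
  ∃ q p : ℝ → Space d, IsBilliardTrajectory B t q p ∧ (q 0, p 0) = ρ ∧ (q t, p t) = σ

/-- The billiard flow `b_t` as a function, meaningful where `BilliardMapsTo` has a unique
solution. -/
def billiardFlow {d r : ℕ} {ι : Type} (B : Table d r ι) (t : ℝ) (ρ : Phase d) : Phase d :=
  Classical.epsilon (BilliardMapsTo B t ρ)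

/-! ### The Hamiltonian flow of `H = p²/2 + V(q)`

Potentials have values in `(-∞, +∞]`; the value `+∞` is allowed in order to include potentials
that are singular at the boundary, such as `ε / Q`. -/

/-- `(q, p)` solves Hamilton's equations `q' = p`, `p' = -∇V(q)` on `[0, S]`. -/
def IsHamiltonianTrajectory {d : ℕ} (V : Space d → EReal) (S : ℝ) (q p : ℝ → Space d) : Prop :=
  0 ≤ S ∧ ∀ t ∈ Icc 0 S, V (q t) ≠ ⊤ ∧ HasDerivWithinAt q (p t) (Icc 0 S) t ∧
    HasDerivWithinAt p (-gradient (fun x => (V x).toReal) (q t)) (Icc 0 S) t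

/-- `h_t ρ = σ`. -/
def HamiltonianMapsTo {d : ℕ} (V : Space d → EReal) (t : ℝ) (ρ σ : Phase d) : Prop :=
  ∃ q p : ℝ → Space d, IsHamiltonianTrajectory V t q p ∧ (q 0, p 0) = ρ ∧ (q t, p t) = σ

/-- The Hamiltonian flow `h_t` as a function, meaningful where `HamiltonianMapsTo` has a unique
solution. -/
def hamiltonianFlow {d : ℕ} (V : Space d → EReal) (t : ℝ) (ρ : Phase d) : Phase d :=
  Classical.epsilon (HamiltonianMapsTo V t ρ)

/-! ### Conditions on the family of potentials `V ε`, `ε → 0+` -/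

/-- For small `ε > 0` the function `V ε : ℝ^d → (-∞, +∞]` is continuous, and `C^(r+1)` where it is
finite. -/
def IsSmoothPotential {d : ℕ} (r : ℕ) (V : ℝ → Space d → EReal) : Prop :=
  ∀ᶠ ε in 𝓝[>] (0 : ℝ), Continuous (V ε) ∧ (∀ q, V ε q ≠ ⊥) ∧
    ContDiffOn ℝ (r + 1 : ℕ) (fun q => (V ε q).toReal) {q | V ε q ≠ ⊤}

/-- Condition I: on each fixed compact subset of the interior of the table, `V ε` tends to zero
uniformly together with its derivatives up to order `r + 1`. -/
def ConditionI {d r : ℕ} {ι : Type} (B : Table d r ι) (V : ℝ → Space d → EReal) : Prop :=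
  ∀ K : Set (Space d), IsCompact K → K ⊆ interior B.D →
    (∀ᶠ ε in 𝓝[>] (0 : ℝ), ∀ q ∈ K, V ε q ≠ ⊤) ∧
    ∀ k ≤ r + 1, TendstoUniformlyOn
      (fun ε q => iteratedFDeriv ℝ k (fun x => (V ε x).toReal) q) 0 (𝓝[>] (0 : ℝ)) K

/-- Pattern function `Q` and barrier functions `W i` near the boundary, outside a neighbourhood `N`
of the corner set. `nbhd i` is the neighbourhood of `Γ i \ N` where the pattern function is
considered, `level i` is the constant `Q_i`; the argument of `W i ε` is `x = Q - Q_i`, which ranges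
over `(-width, width)`. -/
structure BoundaryLayer {d r : ℕ} {ι : Type} (B : Table d r ι) (N : Set (Space d)) where
  ε₀ : ℝ
  ε₀_pos : 0 < ε₀
  nbhd : ι → Set (Space d)
  isOpen_nbhd : ∀ i, IsOpen (nbhd i)
  subset_nbhd : ∀ i, B.Γ i \ N ⊆ nbhd i
  disjoint_nbhd : ∀ i j, i ≠ j → Disjoint (nbhd i) (nbhd j)
  Q : ℝ → Space d → ℝ
  contDiffOn_Q : ∀ i, ∀ ε ∈ Icc 0 ε₀, ContDiffOn ℝ (r + 1 : ℕ) (Q ε) (nbhd i)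
  /-- `Q ε` depends continuously on `ε ∈ [0, ε₀]` in the `C^(r+1)` topology. -/
  continuousOn_Q : ∀ i, ∀ k ≤ r + 1, ContinuousOn
    (fun z : ℝ × Space d => iteratedFDeriv ℝ k (Q z.1) z.2) (Icc 0 ε₀ ×ˢ nbhd i)
  level : ι → ℝ
  width : ℝ
  width_pos : 0 < width
  abs_sub_lt : ∀ i, ∀ ε ∈ Icc 0 ε₀, ∀ q ∈ nbhd i, |Q ε q - level i| < width
  W : ι → ℝ → ℝ → EReal
  W_ne_bot : ∀ i, ∀ ε ∈ Ioc 0 ε₀, ∀ x ∈ Ioo (-width) width, W i ε x ≠ ⊥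
  continuousOn_W : ∀ i, ∀ ε ∈ Ioc 0 ε₀, ContinuousOn (W i ε) (Ioo (-width) width)
  contDiffOn_W : ∀ i, ∀ ε ∈ Ioc 0 ε₀, ContDiffOn ℝ (r + 1 : ℕ) (fun x => (W i ε x).toReal)
    {x ∈ Ioo (-width) width | W i ε x ≠ ⊤}
  continuousOn_W_param : ∀ i, ∀ x ∈ Ioo (-width) width,
    ContinuousOn (fun ε => W i ε x) (Ioc 0 ε₀)

/-- Condition IIa: each boundary piece lies in the level set `Q = Q_i` of the limit pattern
function, with `Q ≥ Q_i` on the side of the table and `Q < Q_i` outside. -/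
def ConditionIIa {d r : ℕ} {ι : Type} {B : Table d r ι} {N : Set (Space d)}
    (L : BoundaryLayer B N) : Prop :=
  ∀ i, (∀ q ∈ B.Γ i ∩ L.nbhd i, L.Q 0 q = L.level i) ∧
    ∀ q ∈ L.nbhd i, (q ∈ B.D ↔ L.level i ≤ L.Q 0 q)

/-- Condition IIb: near the boundary the potential is a function of the pattern function. -/
def ConditionIIb {d r : ℕ} {ι : Type} {B : Table d r ι} {N : Set (Space d)}
    (L : BoundaryLayer B N) (V : ℝ → Space d → EReal) : Prop :=
  ∀ i, ∀ ε ∈ Ioc 0 L.ε₀, ∀ q ∈ L.nbhd i, V ε q = L.W i ε (L.Q ε q - L.level i)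

/-- Condition IIc: neither `∇Q` nor `W'` vanishes near the boundary. -/
def ConditionIIc {d r : ℕ} {ι : Type} {B : Table d r ι} {N : Set (Space d)}
    (L : BoundaryLayer B N) : Prop :=
  ∀ i, (∀ ε ∈ Icc 0 L.ε₀, ∀ q ∈ L.nbhd i, gradient (L.Q ε) q ≠ 0) ∧
    ∀ ε ∈ Ioc 0 L.ε₀, ∀ x ∈ Ioo (-L.width) L.width, L.W i ε x ≠ ⊤ →
      deriv (fun y => (L.W i ε y).toReal) x ≠ 0

/-- Condition III: across the boundary piece `Γ i` the limit of the barrier function increases from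
`0` to `E i`, where `0 < E i ≤ +∞`. -/
def ConditionIII {d r : ℕ} {ι : Type} {B : Table d r ι} {N : Set (Space d)}
    (L : BoundaryLayer B N) (E : ι → EReal) : Prop :=
  ∀ i, 0 < E i ∧
    (∀ x ∈ Ioo 0 L.width, Tendsto (fun ε => L.W i ε x) (𝓝[>] 0) (𝓝 0)) ∧
    (∀ x ∈ Ioo (-L.width) 0, Tendsto (fun ε => L.W i ε x) (𝓝[>] 0) (𝓝 (E i)))

/-- Condition IV: the inverse `invW` of the barrier function tends to zero, together with its
derivatives up to order `r + 1`, uniformly on each `[w₁, w₂] ⊆ (0, E i)`. -/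
def ConditionIV {d r : ℕ} {ι : Type} {B : Table d r ι} {N : Set (Space d)}
    (L : BoundaryLayer B N) (E : ι → EReal) : Prop :=
  ∀ i, ∃ invW : ℝ → ℝ → ℝ, ∀ w₁ w₂ : ℝ, 0 < w₁ → w₁ < w₂ → (w₂ : EReal) < E i →
    (∀ᶠ ε in 𝓝[>] (0 : ℝ), ∀ w ∈ Icc w₁ w₂, invW ε w ∈ Ioo (-L.width) L.width ∧
      ∀ x ∈ Ioo (-L.width) L.width, (L.W i ε x = (w : EReal) ↔ x = invW ε w)) ∧
    ∀ k ≤ r + 1, TendstoUniformlyOn (fun ε w => iteratedDeriv k (invW ε) w) 0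
      (𝓝[>] (0 : ℝ)) (Icc w₁ w₂)

/-- Conditions I-IV. The conditions on the behaviour near the boundary are imposed outside every
fixed (that is, independent of `ε`) neighbourhood `N` of the corner set. -/
def ConditionsItoIV {d r : ℕ} {ι : Type} (B : Table d r ι) (V : ℝ → Space d → EReal)
    (E : ι → EReal) : Prop :=
  ConditionI B V ∧ ∀ N : Set (Space d), IsOpen N → B.corner ⊆ N →
    ∃ L : BoundaryLayer B N, ConditionIIa L ∧ ConditionIIb L V ∧ ConditionIIc L ∧
      ConditionIII L E ∧ ConditionIV L E

end SteepBilliard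

end

/-!
# Billiards as limits of Hamiltonian flows with steep potentials

Away from the boundary the force of `V ε` tends to zero, so Hamiltonian trajectories tend to free
flights. Everything depends on the passage through a single collision, at a point `x` of the
boundary that is not a corner, with incoming momentum `v`.

*Boundary charts* (`IsBoundaryChart`, `exists_isBoundaryChart`). In a ball around `x` conditions
II-IV are used in the following form only. There are functions `F ε`, convergent in `C²`, whose limit
`F 0` defines the table. Since `W' ≠ 0` and the barrier rises to at least `e` on the outer side, `W` is
decreasing wherever it is below a level `w < e`; so at such points `-∇V ε` is a non-negative
multiple of `∇F ε`, and the points lie almost in the table. Since the inverse of `W` has a small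
derivative, the multiple is large where the potential is in a compact part of `(0, e)`.

*The Hamiltonian flow at a collision* (`CollisionFamily`). It is enough to consider limits of
Hamiltonian trajectories along ultrafilters; the positions are equi-Lipschitz, hence converge
uniformly. As the force is nearly normal to the boundary and points inwards, the normal momentum
is increasing, and the tangential momentum is preserved in the limit
(`CollisionFamily.window_tangential`). It remains to see that the limit path enters the interior
immediately after the collision:

* at a non-degenerate tangency, conservation of energy shows that the momentum stays close to `v`.
  Along the trajectories the second derivative of `F ε` is then at least `D²F(v, v)`, up to a small
  error, because the force only adds a non-negative term. So `F 0` grows quadratically along the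
  limit path (`CollisionFamily.exists_pos_of_tangent`);
* at a regular reflection the limit path would leave the table if the normal momentum remained
  definitely negative. While it is small compared with its initial value, energy conservation forces
  the potential into a compact part of `(0, e)`, where the force is arbitrarily large
  (`CollisionFamily.window_steep`). So it becomes definitely positive at once
  (`CollisionFamily.exists_pos_of_regular`).

Once the limit path is back in the interior, conservation of energy and of the tangential momentum
leave the outgoing momentum of the reflection law as the only possibility
(`CollisionFamily.exists_reflected`).

*The billiard flow at a collision* (`IsBoundaryChart.flowLimit_admissible`). Trajectories near an
admissible collision have at most one collision there, which again is a regular reflection or a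
non-degenerate tangency, and they depend continuously on the initial point.

Both statements are instances of `FlowLimit`, a convergence of relations locally uniform in the
initial point, which is stable under composition. Induction along the trajectory
(`IsAdmissibleTrajectory.induction`) yields the convergence at the final time, and compactness
(`eventually_dist_lt`) makes it uniform on a neighbourhood.
-/

namespace SteepBilliard

open scoped NNReal Manifold ContDiff

/-! ### Continuous induction and ordinary differential equations -/

/-- Continuous induction on `[0, S]`. -/
theorem real_induction {S : ℝ} {P : ℝ → Prop} (h0 : P 0)
    (hclosed : ∀ t ∈ Ioc 0 S, (∀ u ∈ Ico 0 t, P u) → P t)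
    (hext : ∀ t ∈ Ico 0 S, (∀ u ∈ Icc 0 t, P u) → ∃ s > t, ∀ u ∈ Ioc t s, u ≤ S → P u) :
    ∀ t ∈ Icc 0 S, P t := by
  intro t ht
  by_contra hPt
  set A : Set ℝ := {u | u ∈ Icc 0 S ∧ ¬ P u}
  have hA : A.Nonempty := ⟨t, ht, hPt⟩
  have hbdd : BddBelow A := ⟨0, fun u hu => hu.1.1⟩
  set c := sInf A
  have hc0 : 0 ≤ c := le_csInf hA fun u hu => hu.1.1
  have hcS : c ≤ S := (csInf_le hbdd ⟨ht, hPt⟩).trans ht.2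
  have hbelow : ∀ u ∈ Ico 0 c, P u := by
    intro u hu
    by_contra h
    exact absurd (csInf_le hbdd ⟨⟨hu.1, hu.2.le.trans hcS⟩, h⟩) (not_le.2 hu.2)
  have hPc : P c := by
    rcases hc0.eq_or_lt with h | h
    · rwa [← h]
    · exact hclosed c ⟨h, hcS⟩ hbelow
  have hall : ∀ u ∈ Icc 0 c, P u := fun u hu =>
    hu.2.eq_or_lt.elim (fun h => h ▸ hPc) fun h => hbelow u ⟨hu.1, h⟩
  rcases hcS.eq_or_lt with h | h
  · exact hPt (hall t ⟨ht.1, h ▸ ht.2⟩)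
  · obtain ⟨s, hs, hP⟩ := hext c ⟨hc0, h⟩ hall
    obtain ⟨u, hu, hus⟩ := exists_lt_of_csInf_lt hA hs
    rcases le_or_gt u c with huc | huc
    · exact hu.2 (hall u ⟨hu.1.1, huc⟩)
    · exact hu.2 (hP u ⟨huc, hus.le⟩ hu.1.2)

section ODE

variable {E : Type*} [NormedAddCommGroup E] [NormedSpace ℝ E]

/-- A `C^1` vector field on an open set agrees near a compact subset with a bounded and globally
Lipschitz vector field. -/
theorem exists_lipschitz_cutoff [FiniteDimensional ℝ E] {X : E → E} {Ω : Set E} (hΩ : IsOpen Ω)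
    (hX : ContDiffOn ℝ 1 X Ω) {K : Set E} (hK : IsCompact K) (hKΩ : K ⊆ Ω) :
    ∃ Y : E → E, (∃ C, LipschitzWith C Y) ∧ (∃ L : ℝ≥0, ∀ x, ‖Y x‖ ≤ L) ∧
      ∀ᶠ x in 𝓝ˢ K, Y x = X x := by
  obtain ⟨K', hK', hKK', hK'Ω⟩ := exists_compact_between hK hΩ hKΩ
  obtain ⟨f, hf1, hf0, -⟩ := exists_contMDiffMap_one_nhds_of_subset_interior (n := 1)
    𝓘(ℝ, E) hK.isClosed hKK'
  have hfs : ContDiff ℝ 1 f := by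
    have := f.contMDiff
    exact this.contDiff
  set Y : E → E := fun x => f x • X x
  have hsupp : HasCompactSupport Y := by
    refine HasCompactSupport.intro hK' fun x hx => ?_
    simp [Y, hf0 x hx]
  have hY : ContDiff ℝ 1 Y := by
    rw [contDiff_iff_contDiffAt]
    intro x
    by_cases hx : x ∈ Ω
    · exact hfs.contDiffAt.smul (hX.contDiffAt (hΩ.mem_nhds hx))
    · have : Y =ᶠ[𝓝 x] fun _ => 0 := by
        filter_upwards [hK'.isClosed.isOpen_compl.mem_nhds fun h => hx (hK'Ω h)] with y hy
        simp [Y, hf0 y hy]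
      exact contDiffAt_const.congr_of_eventuallyEq this
  obtain ⟨C, hC⟩ := hY.lipschitzWith_of_hasCompactSupport hsupp one_ne_zero
  obtain ⟨L, hL⟩ := hsupp.exists_bound_of_continuous hY.continuous
  refine ⟨Y, ⟨C, hC⟩, ⟨⟨max L 0, le_max_right _ _⟩, fun x => (hL x).trans (le_max_left _ _)⟩, ?_⟩
  filter_upwards [hf1] with x hx
  simp [Y, hx]

theorem exists_solution_of_lipschitzWith [CompleteSpace E] {Y : E → E} {C L : ℝ≥0}
    (hY : LipschitzWith C Y) (hL : ∀ x, ‖Y x‖ ≤ L) {S : ℝ} (hS : 0 ≤ S) (x₀ : E) :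
    ∃ α : ℝ → E, α 0 = x₀ ∧ ∀ t ∈ Icc 0 S, HasDerivWithinAt α (Y (α t)) (Icc 0 S) t := by
  have hPL : IsPicardLindelof (fun _ => Y) (⟨0, le_rfl, hS⟩ : Icc (0 : ℝ) S) x₀
      (L * ⟨S, hS⟩) 0 L C :=
    { lipschitzOnWith := fun t _ => hY.lipschitzOnWith
      continuousOn := fun x _ => continuousOn_const
      norm_le := fun t _ x _ => hL x
      mul_max_le := by simp [hS]; exact le_rfl }
  exact hPL.exists_eq_forall_mem_Icc_hasDerivWithinAt₀

/-- If the solutions of `x' = X x` with given initial point cannot leave a compact part `K` of the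
domain before the time `S`, then a solution exists on `[0, S]`. -/
theorem exists_solution_of_apriori [FiniteDimensional ℝ E] {X : E → E} {Ω : Set E}
    (hΩ : IsOpen Ω) (hX : ContDiffOn ℝ 1 X Ω) {K : Set E} (hK : IsCompact K) (hKΩ : K ⊆ Ω)
    {S : ℝ} (hS : 0 ≤ S) {x₀ : E} (hx₀ : x₀ ∈ K)
    (hap : ∀ s ∈ Icc 0 S, ∀ α : ℝ → E, α 0 = x₀ →
      (∀ t ∈ Icc 0 s, α t ∈ Ω ∧ HasDerivWithinAt α (X (α t)) (Icc 0 s) t) →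
      ∀ t ∈ Icc 0 s, α t ∈ K) :
    ∃ α : ℝ → E, α 0 = x₀ ∧
      ∀ t ∈ Icc 0 S, α t ∈ K ∧ HasDerivWithinAt α (X (α t)) (Icc 0 S) t := by
  have : CompleteSpace E := FiniteDimensional.complete ℝ E
  obtain ⟨Y, ⟨C, hC⟩, ⟨L, hL⟩, hYX⟩ := exists_lipschitz_cutoff hΩ hX hK hKΩ
  obtain ⟨U, hUo, hKU, hU⟩ :=
    eventually_nhdsSet_iff_exists.1 (hYX.and (hΩ.mem_nhdsSet.2 hKΩ))
  obtain ⟨α, hα0, hα⟩ := exists_solution_of_lipschitzWith hC hL hS x₀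
  have hcont : ContinuousOn α (Icc 0 S) := fun t ht => (hα t ht).continuousWithinAt
  have hmem : ∀ t ∈ Icc 0 S, α t ∈ K := by
    refine real_induction (hα0 ▸ hx₀) ?_ ?_
    · intro t ht hu
      have h1 : Tendsto α (𝓝[<] t) (𝓝 (α t)) := by
        refine (hcont t ⟨ht.1.le, ht.2⟩).mono_left ?_
        rw [← nhdsWithin_Ioo_eq_nhdsLT ht.1]
        exact nhdsWithin_mono _ fun u hu => ⟨hu.1.le, hu.2.le.trans ht.2⟩
      refine hK.isClosed.mem_of_tendsto h1 ?_
      filter_upwards [Ioo_mem_nhdsLT ht.1] with u hu'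
      exact hu u ⟨hu'.1.le, hu'.2⟩
    · intro t ht hu
      have h1 : Tendsto α (𝓝[>] t) (𝓝 (α t)) := by
        refine (hcont t ⟨ht.1, ht.2.le⟩).mono_left ?_
        rw [← nhdsWithin_Ioo_eq_nhdsGT ht.2]
        exact nhdsWithin_mono _ fun u hu => ⟨ht.1.trans hu.1.le, hu.2.le⟩
      have h2 : ∀ᶠ u in 𝓝[>] t, α u ∈ U :=
        h1.eventually (hUo.mem_nhds (hKU (hu t ⟨ht.1, le_rfl⟩)))
      obtain ⟨s, hs, hsU⟩ := mem_nhdsGT_iff_exists_Ioc_subset.1 h2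
      refine ⟨s, hs, fun v hv hvS => ?_⟩
      have hUv : ∀ w ∈ Icc 0 v, α w ∈ U := by
        intro w hw
        rcases le_or_gt w t with h | h
        · exact hKU (hu w ⟨hw.1, h⟩)
        · exact hsU ⟨h, hw.2.trans hv.2⟩
      have hv0 : 0 ≤ v := ht.1.trans hv.1.le
      refine hap v ⟨hv0, hvS⟩ α hα0 (fun w hw => ⟨(hU _ (hUv w hw)).2, ?_⟩) v ⟨hv0, le_rfl⟩
      rw [← (hU _ (hUv w hw)).1]
      exact (hα w ⟨hw.1, hw.2.trans hvS⟩).mono (Icc_subset_Icc_right hvS)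
  refine ⟨α, hα0, fun t ht => ⟨hmem t ht, ?_⟩⟩
  rw [← (hU _ (hKU (hmem t ht))).1]
  exact hα t ht

theorem solution_unique [FiniteDimensional ℝ E] {X : E → E} {Ω : Set E}
    (hΩ : IsOpen Ω) (hX : ContDiffOn ℝ 1 X Ω) {S : ℝ} {α β : ℝ → E} (h0 : α 0 = β 0)
    (hα : ∀ t ∈ Icc 0 S, α t ∈ Ω ∧ HasDerivWithinAt α (X (α t)) (Icc 0 S) t)
    (hβ : ∀ t ∈ Icc 0 S, β t ∈ Ω ∧ HasDerivWithinAt β (X (β t)) (Icc 0 S) t) :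
    EqOn α β (Icc 0 S) := by
  have hcα : ContinuousOn α (Icc 0 S) := fun t ht => (hα t ht).2.continuousWithinAt
  have hcβ : ContinuousOn β (Icc 0 S) := fun t ht => (hβ t ht).2.continuousWithinAt
  have hK : IsCompact (α '' Icc 0 S ∪ β '' Icc 0 S) :=
    (isCompact_Icc.image_of_continuousOn hcα).union (isCompact_Icc.image_of_continuousOn hcβ)
  have hKΩ : α '' Icc 0 S ∪ β '' Icc 0 S ⊆ Ω := by
    rintro _ (⟨t, ht, rfl⟩ | ⟨t, ht, rfl⟩)
    exacts [(hα t ht).1, (hβ t ht).1]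
  obtain ⟨Y, ⟨C, hC⟩, -, hYX⟩ := exists_lipschitz_cutoff hΩ hX hK hKΩ
  have hYX' := hYX.self_of_nhdsSet
  have key : ∀ γ : ℝ → E, (∀ t ∈ Icc 0 S, γ t ∈ Ω ∧ HasDerivWithinAt γ (X (γ t)) (Icc 0 S) t) →
      γ '' Icc 0 S ⊆ α '' Icc 0 S ∪ β '' Icc 0 S →
      ∀ t ∈ Ico 0 S, HasDerivWithinAt γ (Y (γ t)) (Ici t) t := by
    intro γ hγ hsub t ht
    rw [hYX' _ (hsub (mem_image_of_mem _ ⟨ht.1, ht.2.le⟩))]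
    refine ((hγ t ⟨ht.1, ht.2.le⟩).2.mono (Icc_subset_Icc_left ht.1)).mono_of_mem_nhdsWithin ?_
    exact Icc_mem_nhdsGE ht.2
  exact ODE_solution_unique_of_mem_Icc_right (v := fun _ => Y) (s := fun _ => univ)
    (fun t _ => hC.lipschitzOnWith) hcα (key α hα subset_union_left) (fun _ _ => mem_univ _)
    hcβ (key β hβ subset_union_right) (fun _ _ => mem_univ _) h0

end ODE

end SteepBilliard

namespace SteepBilliard

/-! ### Concatenation of paths -/

section Concat

variable {E : Type*}

/-- The path which follows `f` up to the time `s`, and then `g`, started at time `0`. -/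
noncomputable def concat (s : ℝ) (f g : ℝ → E) (u : ℝ) : E := if u ≤ s then f u else g (u - s)

theorem concat_of_le {s u : ℝ} {f g : ℝ → E} (h : u ≤ s) : concat s f g u = f u := if_pos h

theorem concat_of_lt {s u : ℝ} {f g : ℝ → E} (h : s < u) : concat s f g u = g (u - s) :=
  if_neg (not_le.2 h)

theorem concat_of_ge {s u : ℝ} {f g : ℝ → E} (hfg : f s = g 0) (h : s ≤ u) :
    concat s f g u = g (u - s) := by
  rcases h.eq_or_lt with rfl | h
  · rw [concat_of_le le_rfl, sub_self, hfg]
  · exact concat_of_lt h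

variable [NormedAddCommGroup E] [NormedSpace ℝ E]

theorem hasDerivWithinAt_concat {f g : ℝ → E} {s t u : ℝ} {v : E} (hs : 0 ≤ s) (ht : 0 ≤ t)
    (hfg : f s = g 0)
    (hl : u ≤ s → HasDerivWithinAt f v (Icc 0 s) u)
    (hr : s ≤ u → HasDerivWithinAt g v (Icc 0 t) (u - s)) :
    HasDerivWithinAt (concat s f g) v (Icc 0 (s + t)) u := by
  have hunion : Icc 0 (s + t) = Icc 0 s ∪ Icc s (s + t) :=
    (Icc_union_Icc_eq_Icc hs (by linarith)).symm
  rw [hunion]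
  refine HasDerivWithinAt.union ?_ ?_
  · rcases le_or_gt u s with h | h
    · exact (hl h).congr (fun x hx => concat_of_le hx.2) (concat_of_le h)
    · refine HasFDerivWithinAt.of_notMem_closure fun hc => ?_
      rw [closure_Icc] at hc
      exact absurd hc.2 (not_le.2 h)
  · rcases le_or_gt s u with h | h
    · have h1 : HasDerivWithinAt (fun x => g (x - s)) v (Icc s (s + t)) u := by
        have h2 : HasDerivWithinAt (fun x : ℝ => x - s) 1 (Icc s (s + t)) u :=
          (hasDerivWithinAt_id u _).sub_const s
        have h3 : MapsTo (fun x => x - s) (Icc s (s + t)) (Icc 0 t) :=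
          fun x hx => ⟨by linarith [hx.1], by linarith [hx.2]⟩
        exact ((hr h).scomp u h2 h3).congr_deriv (one_smul _ _)
      exact h1.congr (fun x hx => concat_of_ge hfg hx.1) (concat_of_ge hfg h)
    · refine HasFDerivWithinAt.of_notMem_closure fun hc => ?_
      rw [closure_Icc] at hc
      exact absurd hc.1 (not_le.2 h)

end Concat

/-! ### Hamilton's equations for a fixed potential -/

variable {d : ℕ}

/-- A single potential of the admissible kind: continuous with values in `(-∞, +∞]`, and `C^2`
where it is finite. -/
structure IsC2Potential (V : Space d → EReal) : Prop where
  continuous : Continuous V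
  ne_bot : ∀ q, V q ≠ ⊥
  contDiffOn : ContDiffOn ℝ 2 (fun q => (V q).toReal) {q | V q ≠ ⊤}

theorem IsSmoothPotential.eventually_isC2Potential {r : ℕ} (hr : 1 ≤ r)
    {V : ℝ → Space d → EReal} (hV : IsSmoothPotential r V) :
    ∀ᶠ ε in 𝓝[>] (0 : ℝ), IsC2Potential (V ε) := by
  filter_upwards [hV] with ε h
  refine ⟨h.1, h.2.1, h.2.2.of_le ?_⟩
  exact_mod_cast (by omega : 2 ≤ r + 1)

theorem contDiffOn_gradient {f : Space d → ℝ} {s : Set (Space d)} (hs : IsOpen s)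
    (hf : ContDiffOn ℝ 2 f s) : ContDiffOn ℝ 1 (gradient f) s := by
  have h1 : ContDiffOn ℝ 1 (fderiv ℝ f) s := hf.fderiv_of_isOpen hs (by norm_num)
  have h2 : ContDiff ℝ 1 ((InnerProductSpace.toDual ℝ (Space d)).symm) :=
    IsBoundedLinearMap.contDiff (𝕜 := ℝ)
      ⟨⟨fun x y => map_add _ x y, fun c x => by simp⟩, 1, one_pos, fun x => by simp⟩
  exact h2.comp_contDiffOn h1

theorem inner_gradient {f : Space d → ℝ} (x v : Space d) :
    inner ℝ (gradient f x) v = fderiv ℝ f x v := by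
  simp [gradient]

theorem norm_gradient (f : Space d → ℝ) (x : Space d) : ‖gradient f x‖ = ‖fderiv ℝ f x‖ := by
  simp [gradient]

theorem isOpen_ne_top {V : Space d → EReal} (hV : Continuous V) : IsOpen {q | V q ≠ ⊤} :=
  isOpen_ne_fun hV continuous_const

/-- Hamilton's vector field `(q, p) ↦ (p, -∇V(q))`. -/
noncomputable def hamiltonianField (V : Space d → EReal) (z : Phase d) : Phase d :=
  (z.2, -gradient (fun x => (V x).toReal) z.1)

theorem IsC2Potential.contDiffOn_hamiltonianField {V : Space d → EReal} (hV : IsC2Potential V) :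
    ContDiffOn ℝ 1 (hamiltonianField V) {z | V z.1 ≠ ⊤} := by
  have h := contDiffOn_gradient (isOpen_ne_top hV.continuous) hV.contDiffOn
  exact contDiff_snd.contDiffOn.prodMk (h.comp contDiff_fst.contDiffOn fun z hz => hz).neg

theorem isHamiltonianTrajectory_iff {V : Space d → EReal} {S : ℝ} {q p : ℝ → Space d} :
    IsHamiltonianTrajectory V S q p ↔ 0 ≤ S ∧ ∀ t ∈ Icc 0 S, (q t, p t) ∈ {z : Phase d | V z.1 ≠ ⊤} ∧
      HasDerivWithinAt (fun t => (q t, p t)) (hamiltonianField V (q t, p t)) (Icc 0 S) t := by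
  refine and_congr_right fun _ => forall₂_congr fun t _ => and_congr_right fun _ => ?_
  refine ⟨fun h => h.1.prodMk h.2, fun h => ⟨?_, ?_⟩⟩
  · exact (ContinuousLinearMap.fst ℝ (Space d) (Space d)).hasFDerivAt.comp_hasDerivWithinAt t h
  · exact (ContinuousLinearMap.snd ℝ (Space d) (Space d)).hasFDerivAt.comp_hasDerivWithinAt t h

theorem IsHamiltonianTrajectory.mono {V : Space d → EReal} {S s : ℝ} {q p : ℝ → Space d}
    (h : IsHamiltonianTrajectory V S q p) (hs : 0 ≤ s) (hsS : s ≤ S) :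
    IsHamiltonianTrajectory V s q p := by
  refine ⟨hs, fun t ht => ?_⟩
  obtain ⟨h1, h2, h3⟩ := h.2 t ⟨ht.1, ht.2.trans hsS⟩
  exact ⟨h1, h2.mono (Icc_subset_Icc_right hsS), h3.mono (Icc_subset_Icc_right hsS)⟩

theorem IsHamiltonianTrajectory.continuousOn_q {V : Space d → EReal} {S : ℝ} {q p : ℝ → Space d}
    (h : IsHamiltonianTrajectory V S q p) : ContinuousOn q (Icc 0 S) :=
  fun t ht => (h.2 t ht).2.1.continuousWithinAt

theorem IsHamiltonianTrajectory.continuousOn_p {V : Space d → EReal} {S : ℝ} {q p : ℝ → Space d}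
    (h : IsHamiltonianTrajectory V S q p) : ContinuousOn p (Icc 0 S) :=
  fun t ht => (h.2 t ht).2.2.continuousWithinAt

theorem HamiltonianMapsTo.unique {V : Space d → EReal} (hV : IsC2Potential V) {t : ℝ}
    {ρ σ σ' : Phase d} (h : HamiltonianMapsTo V t ρ σ) (h' : HamiltonianMapsTo V t ρ σ') :
    σ = σ' := by
  obtain ⟨q, p, hqp, h0, h1⟩ := h
  obtain ⟨q', p', hqp', h0', h1'⟩ := h'
  have ho : IsOpen {z : Phase d | V z.1 ≠ ⊤} := (isOpen_ne_top hV.continuous).preimage continuous_fst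
  have := solution_unique ho hV.contDiffOn_hamiltonianField
    (α := fun t => (q t, p t)) (β := fun t => (q' t, p' t)) (h0.trans h0'.symm)
    (isHamiltonianTrajectory_iff.1 hqp).2 (isHamiltonianTrajectory_iff.1 hqp').2
  rw [← h1, ← h1']
  exact this ⟨hqp.1, le_rfl⟩

theorem HamiltonianMapsTo.trans {V : Space d → EReal} {s t : ℝ} {ρ σ τ : Phase d}
    (h : HamiltonianMapsTo V s ρ σ) (h' : HamiltonianMapsTo V t σ τ) :
    HamiltonianMapsTo V (s + t) ρ τ := by
  obtain ⟨q, p, hqp, h0, h1⟩ := h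
  obtain ⟨q', p', hqp', h0', h1'⟩ := h'
  have hs := hqp.1
  have ht := hqp'.1
  have hq : q s = q' 0 := congrArg Prod.fst (h1.trans h0'.symm)
  have hp : p s = p' 0 := congrArg Prod.snd (h1.trans h0'.symm)
  refine ⟨concat s q q', concat s p p', ⟨add_nonneg hs ht, fun u hu => ?_⟩, ?_, ?_⟩
  · refine ⟨?_, ?_, ?_⟩
    · rcases le_or_gt u s with h | h
      · rw [concat_of_le h]; exact (hqp.2 u ⟨hu.1, h⟩).1
      · rw [concat_of_lt h]; exact (hqp'.2 _ ⟨by linarith, by linarith [hu.2]⟩).1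
    · refine hasDerivWithinAt_concat hs ht hq (fun h => ?_) fun h => ?_
      · rw [concat_of_le h]; exact (hqp.2 u ⟨hu.1, h⟩).2.1
      · rw [concat_of_ge hp h]; exact (hqp'.2 _ ⟨by linarith, by linarith [hu.2]⟩).2.1
    · refine hasDerivWithinAt_concat hs ht hp (fun h => ?_) fun h => ?_
      · rw [concat_of_le h]; exact (hqp.2 u ⟨hu.1, h⟩).2.2
      · rw [concat_of_ge hq h]; exact (hqp'.2 _ ⟨by linarith, by linarith [hu.2]⟩).2.2
  · rw [concat_of_le hs, concat_of_le hs, h0]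
  · rw [concat_of_ge hq (by linarith), concat_of_ge hp (by linarith), add_sub_cancel_left, h1']

/-- Conservation of energy. -/
theorem IsHamiltonianTrajectory.energy {V : Space d → EReal} (hV : IsC2Potential V) {S : ℝ}
    {q p : ℝ → Space d} (h : IsHamiltonianTrajectory V S q p) :
    ∀ t ∈ Icc 0 S, ‖p t‖ ^ 2 / 2 + (V (q t)).toReal = ‖p 0‖ ^ 2 / 2 + (V (q 0)).toReal := by
  have hd : ∀ t ∈ Icc 0 S,
      HasDerivWithinAt (fun t => ‖p t‖ ^ 2 / 2 + (V (q t)).toReal) 0 (Icc 0 S) t := by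
    intro t ht
    obtain ⟨h1, h2, h3⟩ := h.2 t ht
    have hU : DifferentiableAt ℝ (fun q => (V q).toReal) (q t) :=
      (hV.contDiffOn.contDiffAt ((isOpen_ne_top hV.continuous).mem_nhds h1)).differentiableAt
        (by norm_num)
    have h4 := hU.hasFDerivAt.comp_hasDerivWithinAt t h2
    have h5 := h3.norm_sq.div_const 2
    refine (h5.add h4).congr_deriv ?_
    rw [← inner_gradient, inner_neg_right, real_inner_comm]
    ring
  intro t ht
  refine constant_of_has_deriv_right_zero (fun t ht => (hd t ht).continuousWithinAt)
    (fun u hu => ?_) t ht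
  exact ((hd u ⟨hu.1, hu.2.le⟩).mono (Icc_subset_Icc_left hu.1)).mono_of_mem_nhdsWithin
    (Icc_mem_nhdsGE hu.2)

/-- If the solutions with initial point `ρ` cannot leave a compact part `K` of the phase space
before the time `S`, then a solution exists on `[0, S]`. -/
theorem exists_trajectory_of_apriori {V : Space d → EReal} (hV : IsC2Potential V)
    {K : Set (Phase d)} (hK : IsCompact K) (hKV : ∀ z ∈ K, V z.1 ≠ ⊤) {S : ℝ} (hS : 0 ≤ S)
    {ρ : Phase d} (hρ : ρ ∈ K)
    (hap : ∀ s ∈ Icc 0 S, ∀ q p : ℝ → Space d, (q 0, p 0) = ρ → IsHamiltonianTrajectory V s q p →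
      ∀ t ∈ Icc 0 s, (q t, p t) ∈ K) :
    ∃ q p : ℝ → Space d, (q 0, p 0) = ρ ∧ IsHamiltonianTrajectory V S q p := by
  have ho : IsOpen {z : Phase d | V z.1 ≠ ⊤} := (isOpen_ne_top hV.continuous).preimage continuous_fst
  obtain ⟨α, hα0, hα⟩ := exists_solution_of_apriori ho hV.contDiffOn_hamiltonianField hK hKV hS hρ
    fun s hs α hα0 hα => hap s hs (fun t => (α t).1) (fun t => (α t).2) hα0
      (isHamiltonianTrajectory_iff.2 ⟨hs.1, hα⟩)
  exact ⟨fun t => (α t).1, fun t => (α t).2, hα0,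
    isHamiltonianTrajectory_iff.2 ⟨hS, fun t ht => ⟨hKV _ (hα t ht).1, (hα t ht).2⟩⟩⟩

end SteepBilliard

namespace SteepBilliard

/-! ### Limits of families of flows, and free flight of the Hamiltonian flow -/

variable {d : ℕ}

/-- Continuous convergence of a family of flows, given as relations `R a t ρ σ` ("`ρ` is mapped to
`σ` in time `t`"), to `ρ ↦ σ`: as `a` runs along `l` and `ρ' → ρ`, some image of `ρ'` at time `t`
tends to `σ`. With a constant family this is the stability of a flow under perturbations of the
initial point. -/
def FlowLimit {α : Type*} (l : Filter α) (R : α → ℝ → Phase d → Phase d → Prop) (t : ℝ)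
    (ρ σ : Phase d) : Prop :=
  ∀ N ∈ 𝓝 σ, ∀ᶠ z in l ×ˢ 𝓝 ρ, ∃ σ' ∈ N, R z.1 t z.2 σ'

/-- The same as `FlowLimit`, where also the time varies, through non-negative values. -/
def FlowTimeLimit {α : Type*} (l : Filter α) (R : α → ℝ → Phase d → Phase d → Prop) (t : ℝ)
    (ρ σ : Phase d) : Prop :=
  ∀ N ∈ 𝓝 σ, ∀ᶠ z in l ×ˢ (𝓝 ρ ×ˢ 𝓝[Ici 0] t), ∃ σ' ∈ N, R z.1 z.2.2 z.2.1 σ'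

section

variable {α : Type*} {l : Filter α} {R : α → ℝ → Phase d → Phase d → Prop}

theorem FlowTimeLimit.flowLimit {t : ℝ} {ρ σ : Phase d} (ht : 0 ≤ t)
    (h : FlowTimeLimit l R t ρ σ) : FlowLimit l R t ρ σ := by
  intro N hN
  have h1 : Tendsto (fun z : α × Phase d => (z.1, (z.2, t))) (l ×ˢ 𝓝 ρ)
      (l ×ˢ (𝓝 ρ ×ˢ 𝓝[Ici 0] t)) := by
    refine tendsto_fst.prodMk (tendsto_snd.prodMk ?_)
    exact tendsto_const_pure.mono_right (pure_le_nhdsWithin ht)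
  exact h1.eventually (h N hN)

theorem FlowLimit.trans (hR : ∀ a s t ρ σ τ, R a s ρ σ → R a t σ τ → R a (s + t) ρ τ)
    {s t : ℝ} {ρ σ τ : Phase d} (h1 : FlowLimit l R s ρ σ) (h2 : FlowLimit l R t σ τ) :
    FlowLimit l R (s + t) ρ τ := by
  intro N hN
  obtain ⟨P, hP, Q, hQ, hPQ⟩ := eventually_prod_iff.1 (h2 N hN)
  filter_upwards [h1 _ hQ, tendsto_fst.eventually hP] with z ⟨σ', hσ', hz⟩ hz1
  obtain ⟨τ', hτ', hR'⟩ := hPQ hz1 hσ'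
  exact ⟨τ', hτ', hR _ _ _ _ _ _ hz hR'⟩

theorem FlowLimit.trans_time (hR : ∀ a s t ρ σ τ, R a s ρ σ → R a t σ τ → R a (s + t) ρ τ)
    {s t : ℝ} {ρ σ τ : Phase d} (ht : 0 < t) (h1 : FlowLimit l R s ρ σ)
    (h2 : FlowTimeLimit l R t σ τ) : FlowTimeLimit l R (s + t) ρ τ := by
  intro N hN
  obtain ⟨P, hP, Q, hQ, hPQ⟩ := eventually_prod_iff.1 (h2 N hN)
  obtain ⟨Q₁, hQ₁, Q₂, hQ₂, hQQ⟩ := eventually_prod_iff.1 hQ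
  have h3 : Tendsto (fun z : α × (Phase d × ℝ) => (z.1, z.2.1))
      (l ×ˢ (𝓝 ρ ×ˢ 𝓝[Ici 0] (s + t))) (l ×ˢ 𝓝 ρ) :=
    tendsto_fst.prodMk (tendsto_fst.comp tendsto_snd)
  have h4 : Tendsto (fun z : α × (Phase d × ℝ) => z.2.2 - s)
      (l ×ˢ (𝓝 ρ ×ˢ 𝓝[Ici 0] (s + t))) (𝓝[Ici 0] t) := by
    have h5 : Tendsto (fun u : ℝ => u - s) (𝓝[Ici 0] (s + t)) (𝓝[Ici 0] t) := by
      have h6 : Tendsto (fun u : ℝ => u - s) (𝓝 (s + t)) (𝓝 t) := by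
        have : ContinuousAt (fun u : ℝ => u - s) (s + t) := by fun_prop
        simpa [ContinuousAt] using this
      refine tendsto_nhdsWithin_iff.2 ⟨h6.mono_left nhdsWithin_le_nhds, ?_⟩
      exact ((h6.mono_left nhdsWithin_le_nhds).eventually (lt_mem_nhds ht)).mono
        fun u hu => le_of_lt hu
    exact h5.comp (tendsto_snd.comp tendsto_snd)
  filter_upwards [h3.eventually (h1 _ hQ₁), tendsto_fst.eventually hP, h4.eventually hQ₂]
    with z ⟨σ', hσ', hz⟩ hz1 hz2
  obtain ⟨τ', hτ', hR'⟩ := hPQ hz1 (hQQ hσ' hz2)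
  refine ⟨τ', hτ', ?_⟩
  have := hR _ _ _ _ _ _ hz hR'
  rwa [add_sub_cancel] at this

end

/-- The family of Hamiltonian flows, as relations. -/
def hamiltonianRel (V : ℝ → Space d → EReal) (ε t : ℝ) (ρ σ : Phase d) : Prop :=
  HamiltonianMapsTo (V ε) t ρ σ

theorem ConditionI.eventually_small {r : ℕ} {ι : Type} {B : Table d r ι}
    {V : ℝ → Space d → EReal} (h : ConditionI B V) {K : Set (Space d)} (hK : IsCompact K)
    (hKD : K ⊆ interior B.D) {η : ℝ} (hη : 0 < η) :
    ∀ᶠ ε in 𝓝[>] (0 : ℝ), ∀ q ∈ K, V ε q ≠ ⊤ ∧ |(V ε q).toReal| < η ∧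
      ‖gradient (fun x => (V ε x).toReal) q‖ < η := by
  obtain ⟨h1, h2⟩ := h K hK hKD
  filter_upwards [h1, Metric.tendstoUniformlyOn_iff.1 (h2 0 (by omega)) η hη,
    Metric.tendstoUniformlyOn_iff.1 (h2 1 (by omega)) η hη] with ε h1 h2 h3 q hq
  refine ⟨h1 q hq, ?_, ?_⟩
  · have := h2 q hq
    rw [Pi.zero_apply, dist_zero_left, norm_iteratedFDeriv_zero] at this
    exact this
  · have := h3 q hq
    rw [Pi.zero_apply, dist_zero_left, norm_iteratedFDeriv_one] at this
    rwa [norm_gradient]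

/-- As long as the force is small near the segment `y + u v`, a solution which starts near `(y, v)`
stays near free flight. -/
theorem IsHamiltonianTrajectory.norm_sub_free_le {V : Space d → EReal} {S δ η β : ℝ}
    {y v : Space d} {q p : ℝ → Space d} (h : IsHamiltonianTrajectory V S q p)
    (hforce : ∀ x, ∀ u ∈ Icc 0 S, dist x (y + u • v) ≤ δ →
      ‖gradient (fun x => (V x).toReal) x‖ ≤ η)
    (hβ : 0 < β) (hηβ : η ≤ β) (hβδ : β * Real.exp (2 * S) ≤ δ) (h0 : ‖(q 0, p 0) - (y, v)‖ ≤ β) :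
    ∀ t ∈ Icc 0 S, ‖(q t, p t) - (y + t • v, v)‖ ≤ β * Real.exp (2 * t) := by
  set f : ℝ → Phase d := fun t => (q t, p t) - (y + t • v, v)
  set f' : ℝ → Phase d := fun t => (p t - v, -gradient (fun x => (V x).toReal) (q t))
  have hf : ∀ t ∈ Icc 0 S, HasDerivWithinAt f (f' t) (Icc 0 S) t := by
    intro t ht
    obtain ⟨-, h2, h3⟩ := h.2 t ht
    have h4 : HasDerivWithinAt (fun t : ℝ => y + t • v) v (Icc 0 S) t := by
      simpa using ((hasDerivWithinAt_id t (Icc 0 S)).smul_const v).const_add y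
    exact (h2.sub h4).prodMk (h3.sub_const v)
  have hB : ∀ t, HasDerivAt (fun t => β * Real.exp (2 * t)) (2 * (β * Real.exp (2 * t))) t := by
    intro t
    have := (((hasDerivAt_id t).const_mul 2).exp).const_mul β
    refine this.congr_deriv ?_
    simp; ring
  refine image_norm_le_of_norm_deriv_right_lt_deriv_boundary
    (fun t ht => (hf t ht).continuousWithinAt)
    (fun t ht => ((hf t ⟨ht.1, ht.2.le⟩).mono (Icc_subset_Icc_left ht.1)).mono_of_mem_nhdsWithin
      (Icc_mem_nhdsGE ht.2)) (by simpa [f] using h0) hB ?_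
  intro t ht hft
  have hpos : 0 < β * Real.exp (2 * t) := by positivity
  have hβt : β ≤ β * Real.exp (2 * t) :=
    le_mul_of_one_le_right hβ.le (Real.one_le_exp (by linarith [ht.1]))
  have hBδ : β * Real.exp (2 * t) ≤ δ := by
    refine le_trans ?_ hβδ
    gcongr
    exact ht.2.le
  have h1 : ‖q t - (y + t • v)‖ ≤ β * Real.exp (2 * t) := (norm_fst_le (f t)).trans hft.le
  have h2 : ‖p t - v‖ ≤ β * Real.exp (2 * t) := (norm_snd_le (f t)).trans hft.le
  have h3 := hforce (q t) t ⟨ht.1, ht.2.le⟩ (by rw [dist_eq_norm]; exact h1.trans hBδ)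
  have : ‖f' t‖ ≤ β * Real.exp (2 * t) := by
    refine max_le h2 ?_
    rw [norm_neg]
    exact h3.trans (hηβ.trans hβt)
  linarith

theorem exists_free_extension {D : Set (Space d)} (hD : IsOpen D) {y v : Space d} {τ : ℝ}
    (hτ : 0 ≤ τ) (hfree : ∀ u ∈ Icc 0 τ, y + u • v ∈ D) :
    ∃ τ' > τ, ∀ u ∈ Icc 0 τ', y + u • v ∈ D := by
  have hc : Continuous fun u : ℝ => y + u • v := by fun_prop
  have h1 : ∀ᶠ u in 𝓝[>] τ, y + u • v ∈ D :=
    nhdsWithin_le_nhds (hc.continuousAt.eventually (hD.mem_nhds (hfree τ ⟨hτ, le_rfl⟩)))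
  obtain ⟨τ', hτ', hsub⟩ := mem_nhdsGT_iff_exists_Ioc_subset.1 h1
  refine ⟨τ', hτ', fun u hu => ?_⟩
  rcases le_or_gt u τ with h | h
  · exact hfree u ⟨hu.1, h⟩
  · exact hsub ⟨h, hu.2⟩

/-- Free flight: as long as the segment `y + u v` stays in the interior of the table, the
Hamiltonian flow tends to the free flow. -/
theorem flowTimeLimit_free {r : ℕ} {ι : Type} {B : Table d r ι} {V : ℝ → Space d → EReal}
    (hV : ∀ᶠ ε in 𝓝[>] (0 : ℝ), IsC2Potential (V ε)) (hI : ConditionI B V) {y v : Space d} {τ : ℝ}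
    (hτ : 0 ≤ τ) (hfree : ∀ u ∈ Icc 0 τ, y + u • v ∈ interior B.D) :
    FlowTimeLimit (𝓝[>] (0 : ℝ)) (hamiltonianRel V) τ (y, v) (y + τ • v, v) := by
  intro N hN
  obtain ⟨τ', hττ', hfree'⟩ := exists_free_extension isOpen_interior hτ hfree
  have hτ'0 : 0 ≤ τ' := hτ.trans hττ'.le
  have hc : Continuous fun u : ℝ => y + u • v := by fun_prop
  have hK0 : IsCompact ((fun u : ℝ => y + u • v) '' Icc 0 τ') := isCompact_Icc.image hc
  obtain ⟨δ, hδ, hδD⟩ := hK0.exists_cthickening_subset_open isOpen_interior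
    (by rintro _ ⟨u, hu, rfl⟩; exact hfree' u hu)
  set K := Metric.cthickening δ ((fun u : ℝ => y + u • v) '' Icc 0 τ')
  have hK : IsCompact K := hK0.cthickening
  have hKmem : ∀ x, ∀ u ∈ Icc 0 τ', dist x (y + u • v) ≤ δ → x ∈ K := fun x u hu hx =>
    Metric.mem_cthickening_of_dist_le _ _ _ _ (mem_image_of_mem _ hu) hx
  obtain ⟨θ, hθ, hθN⟩ := Metric.mem_nhds_iff.1 hN
  set β := min δ (θ / 2) / Real.exp (2 * τ')
  have hexp := Real.exp_pos (2 * τ')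
  have hβ : 0 < β := by positivity
  have hβexp : β * Real.exp (2 * τ') = min δ (θ / 2) := div_mul_cancel₀ _ hexp.ne'
  have hmono : ∀ t ∈ Icc 0 τ', β * Real.exp (2 * t) ≤ β * Real.exp (2 * τ') := by
    intro t ht
    gcongr
    exact ht.2
  have h1 : ∀ᶠ ε in 𝓝[>] (0 : ℝ), IsC2Potential (V ε) ∧ _ :=
    hV.and (hI.eventually_small hK hδD hβ)
  have h2 : ∀ᶠ z in 𝓝 (y, v) ×ˢ 𝓝[Ici 0] τ, ‖z.1 - (y, v)‖ ≤ β ∧ 0 ≤ z.2 ∧ z.2 ≤ τ' ∧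
      ‖(z.2 - τ) • v‖ < θ / 2 := by
    have h3 : ∀ᶠ ρ in 𝓝 (y, v), ‖ρ - (y, v)‖ ≤ β := by
      filter_upwards [Metric.closedBall_mem_nhds (y, v) hβ] with ρ hρ
      rwa [← dist_eq_norm]
    have h4 : ∀ᶠ t in 𝓝[Ici 0] τ, 0 ≤ t ∧ t ≤ τ' ∧ ‖(t - τ) • v‖ < θ / 2 := by
      have h5 : ContinuousAt (fun t : ℝ => ‖(t - τ) • v‖) τ := by fun_prop
      have h6 : ∀ᶠ t in 𝓝 τ, ‖(t - τ) • v‖ < θ / 2 :=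
        h5.eventually (gt_mem_nhds (by simpa using hθ))
      filter_upwards [self_mem_nhdsWithin, nhdsWithin_le_nhds h6,
        nhdsWithin_le_nhds (Iic_mem_nhds hττ')] with t a b c
      exact ⟨a, c, b⟩
    exact (tendsto_fst.eventually h3).and (tendsto_snd.eventually h4)
  filter_upwards [tendsto_fst.eventually h1, tendsto_snd.eventually h2]
    with ⟨ε, ρ, t⟩ ⟨hVε, hsmall⟩ ⟨hρ, ht0, htτ', htθ⟩
  have key : ∀ s ∈ Icc 0 τ', ∀ q p : ℝ → Space d, (q 0, p 0) = ρ →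
      IsHamiltonianTrajectory (V ε) s q p →
      ∀ t ∈ Icc 0 s, ‖(q t, p t) - (y + t • v, v)‖ ≤ min δ (θ / 2) := by
    intro s hs q p h0 hqp t ht
    have hexps : β * Real.exp (2 * s) ≤ δ := by
      exact (hmono s hs).trans (hβexp ▸ min_le_left _ _)
    refine (hqp.norm_sub_free_le (δ := δ) (η := β) (fun x u hu hx => ?_) hβ le_rfl hexps
      (by rw [h0]; exact hρ) t ht).trans (hβexp ▸ hmono t ⟨ht.1, ht.2.trans hs.2⟩)
    exact (hsmall x (hKmem x u ⟨hu.1, hu.2.trans hs.2⟩ hx)).2.2.le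
  have hmemK : ∀ s ∈ Icc 0 τ', ∀ z : Phase d, ‖z - (y + s • v, v)‖ ≤ min δ (θ / 2) →
      z ∈ K ×ˢ Metric.closedBall v δ := by
    intro s hs z hz
    refine ⟨hKmem _ s hs ?_, ?_⟩
    · rw [dist_eq_norm]
      exact (norm_fst_le (z - (y + s • v, v))).trans (hz.trans (min_le_left _ _))
    · rw [mem_closedBall_iff_norm]
      exact (norm_snd_le (z - (y + s • v, v))).trans (hz.trans (min_le_left _ _))
  have hβmin : β ≤ min δ (θ / 2) := by
    rw [← hβexp]
    exact le_mul_of_one_le_right hβ.le (Real.one_le_exp (by linarith))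
  obtain ⟨q, p, hqp0, hqp⟩ := exists_trajectory_of_apriori hVε
    (hK.prod (isCompact_closedBall v δ)) (fun z hz => (hsmall _ hz.1).1) hτ'0
    (hmemK 0 ⟨le_rfl, hτ'0⟩ ρ (by simpa using hρ.trans hβmin))
    fun s hs q p h0 hqp u hu => hmemK u ⟨hu.1, hu.2.trans hs.2⟩ _ (key s hs q p h0 hqp u hu)
  refine ⟨(q t, p t), hθN ?_, q, p, hqp.mono ht0 htτ', hqp0, rfl⟩
  have h3 := key τ' ⟨hτ'0, le_rfl⟩ q p hqp0 hqp t ⟨ht0, htτ'⟩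
  rw [mem_ball_iff_norm]
  have h4 : (q t, p t) - (y + τ • v, v) =
      ((q t, p t) - (y + t • v, v)) + ((t - τ) • v, 0) := by
    ext1
    · simp only [Prod.fst_sub, Prod.fst_add, sub_smul]
      abel
    · simp
  rw [h4]
  refine (norm_add_le _ _).trans_lt ?_
  have h5 : ‖(((t - τ) • v, 0) : Phase d)‖ < θ / 2 := by
    rw [Prod.norm_mk, norm_zero, max_eq_left (norm_nonneg _)]
    exact htθ
  have := h3.trans (min_le_right _ _)
  linarith

end SteepBilliard

namespace SteepBilliard

/-! ### Normals and curvature of the boundary -/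

variable {d : ℕ}

theorem IsDefiningFunction.hasDerivAt_line {n : ℕ} (hn : 1 ≤ n) {D : Set (Space d)}
    {F : Space d → ℝ} {x : Space d} (h : IsDefiningFunction n D F x) (w : Space d) :
    HasDerivAt (fun s : ℝ => F (x + s • w)) (inner ℝ (gradient F x) w) 0 := by
  have h1 : HasFDerivAt F (fderiv ℝ F x) (x + (0 : ℝ) • w) := by
    rw [zero_smul, add_zero]
    exact (h.contDiffAt.differentiableAt (by exact_mod_cast (by omega : n ≠ 0))).hasFDerivAt
  have h2 : HasDerivAt (fun s : ℝ => x + s • w) w 0 := by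
    simpa using ((hasDerivAt_id (0 : ℝ)).smul_const w).const_add x
  rw [inner_gradient]
  exact h1.comp_hasDerivAt 0 h2

theorem eventually_pos_of_hasDerivAt {f : ℝ → ℝ} {f' : ℝ} (h : HasDerivAt f f' 0) (h0 : f 0 = 0)
    (hf' : 0 < f') : ∀ᶠ s in 𝓝[>] (0 : ℝ), 0 < f s := by
  have h1 := (hasDerivAt_iff_tendsto_slope_zero.1 h).mono_left
    (nhdsWithin_mono _ fun s hs => (ne_of_gt hs : s ≠ 0) : 𝓝[>] (0 : ℝ) ≤ _)
  filter_upwards [h1.eventually (lt_mem_nhds hf'), self_mem_nhdsWithin] with s hs hs0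
  simp only [zero_add, h0, sub_zero, smul_eq_mul] at hs
  exact (pos_iff_pos_of_mul_pos hs).1 (inv_pos.2 hs0)

/-- Directions along the inward side of the tangent hyperplane enter the table. -/
theorem IsDefiningFunction.eventually_mem {n : ℕ} (hn : 1 ≤ n) {D : Set (Space d)}
    {F : Space d → ℝ} {x : Space d} (h : IsDefiningFunction n D F x) {w : Space d}
    (hw : 0 < inner ℝ (gradient F x) w) : ∀ᶠ s in 𝓝[>] (0 : ℝ), x + s • w ∈ D := by
  have h1 := eventually_pos_of_hasDerivAt (h.hasDerivAt_line hn w) (by simp [h.zero]) hw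
  have hc : ContinuousAt (fun s : ℝ => x + s • w) 0 := by fun_prop
  have h2 : Tendsto (fun s : ℝ => x + s • w) (𝓝[>] 0) (𝓝 x) := by
    simpa [ContinuousAt] using hc.mono_left (nhdsWithin_le_nhds (s := Ioi (0 : ℝ)))
  filter_upwards [h1, h2.eventually h.mem_iff] with s hs hs'
  exact hs'.2 hs.le

theorem IsDefiningFunction.inner_nonneg {n : ℕ} (hn : 1 ≤ n) {D : Set (Space d)}
    {F : Space d → ℝ} {x : Space d} (h : IsDefiningFunction n D F x) {w : Space d}
    (hw : ∀ᶠ s in 𝓝[>] (0 : ℝ), x + s • w ∈ D) : 0 ≤ inner ℝ (gradient F x) w := by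
  by_contra! hneg
  have h1 := eventually_pos_of_hasDerivAt (h.hasDerivAt_line hn w).neg (by simp [h.zero])
    (neg_pos.2 hneg)
  have hc : ContinuousAt (fun s : ℝ => x + s • w) 0 := by fun_prop
  have h2 : Tendsto (fun s : ℝ => x + s • w) (𝓝[>] 0) (𝓝 x) := by
    simpa [ContinuousAt] using hc.mono_left (nhdsWithin_le_nhds (s := Ioi (0 : ℝ)))
  obtain ⟨s, hs, hs', hs''⟩ := (h1.and ((h2.eventually h.mem_iff).and hw)).exists
  have := hs'.1 hs''
  simp only [Pi.neg_apply] at hs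
  linarith

theorem IsInwardNormal.norm_eq_one {D : Set (Space d)} {x n : Space d}
    (h : IsInwardNormal D x n) : ‖n‖ = 1 := by
  obtain ⟨F, hF, rfl⟩ := h
  rw [norm_smul, norm_inv, norm_norm, inv_mul_cancel₀ (norm_ne_zero_iff.2 hF.gradient_ne)]

/-- The inward normal is determined by the table: otherwise some direction would point inwards for
one defining function, and outwards for another. -/
theorem IsInwardNormal.unique {D : Set (Space d)} {x n n' : Space d}
    (h : IsInwardNormal D x n) (h' : IsInwardNormal D x n') : n = n' := by
  have hn := h.norm_eq_one
  have hn' := h'.norm_eq_one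
  obtain ⟨F, hF, hFn⟩ := h
  obtain ⟨G, hG, hGn⟩ := h'
  have key : ∀ w, 0 < inner ℝ n w → 0 ≤ inner ℝ n' w := by
    intro w hw
    rw [hFn, inner_smul_left] at hw
    rw [hGn, inner_smul_left]
    have hpos : 0 < ‖gradient F x‖⁻¹ := inv_pos.2 (norm_pos_iff.2 hF.gradient_ne)
    have := hG.inner_nonneg (by norm_num) (hF.eventually_mem (by norm_num)
      ((pos_iff_pos_of_mul_pos hw).1 hpos))
    exact mul_nonneg (inv_nonneg.2 (norm_nonneg _)) this
  by_contra hne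
  have hlt : inner ℝ n n' < 1 := (inner_lt_one_iff_real_of_norm_eq_one hn hn').2 hne
  have h1 := key (n - n') (by rw [inner_sub_right, real_inner_self_eq_norm_sq, hn]; linarith)
  rw [inner_sub_right, real_inner_self_eq_norm_sq, hn', real_inner_comm] at h1
  linarith

theorem ReflectionLaw.eq_of_normal {D : Set (Space d)} {x pin pout n : Space d}
    (h : ReflectionLaw D x pin pout) (hn : IsInwardNormal D x n) :
    pout = pin - (2 * inner ℝ pin n) • n := by
  obtain ⟨n', hn', h⟩ := h
  rwa [hn'.unique hn] at h

theorem ReflectionLaw.unique {D : Set (Space d)} {x pin pout pout' : Space d}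
    (h : ReflectionLaw D x pin pout) (h' : ReflectionLaw D x pin pout') : pout = pout' := by
  obtain ⟨n, hn, rfl⟩ := h'
  exact h.eq_of_normal hn

theorem norm_sub_two_inner_smul {v n : Space d} (hn : ‖n‖ = 1) :
    ‖v - (2 * inner ℝ v n) • n‖ = ‖v‖ := by
  have : ‖v - (2 * inner ℝ v n) • n‖ ^ 2 = ‖v‖ ^ 2 := by
    rw [norm_sub_sq_real, inner_smul_right, norm_smul, hn, mul_one, Real.norm_eq_abs, sq_abs]
    ring
  exact (pow_left_inj₀ (norm_nonneg _) (norm_nonneg _) two_ne_zero).1 this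

theorem ReflectionLaw.norm_eq {D : Set (Space d)} {x pin pout : Space d}
    (h : ReflectionLaw D x pin pout) : ‖pout‖ = ‖pin‖ := by
  obtain ⟨n, hn, rfl⟩ := h
  exact norm_sub_two_inner_smul hn.norm_eq_one

/-- First and second derivative of a `C^2` function along the parabola `x + s v + s² w`. -/
theorem deriv_deriv_parabola {F : Space d → ℝ} {x : Space d} (hF : ContDiffAt ℝ 2 F x)
    (v w : Space d) :
    deriv (fun s : ℝ => F (x + s • v + s ^ 2 • w)) 0 = fderiv ℝ F x v ∧
    deriv (deriv fun s : ℝ => F (x + s • v + s ^ 2 • w)) 0 =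
      fderiv ℝ (fderiv ℝ F) x v v + 2 * fderiv ℝ F x w ∧
    ContinuousAt (fun s : ℝ => F (x + s • v + s ^ 2 • w)) 0 := by
  set γ : ℝ → Space d := fun s => x + s • v + s ^ 2 • w
  have hγ0 : γ 0 = x := by simp [γ]
  have hγ : ∀ s, HasDerivAt γ (v + (2 * s) • w) s := by
    intro s
    have h1 := (((hasDerivAt_id s).smul_const v).const_add x).add
      ((hasDerivAt_pow 2 s).smul_const w)
    exact h1.congr_deriv (by simp)
  have hγc : Tendsto γ (𝓝 0) (𝓝 x) := by
    have := (hγ 0).continuousAt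
    rwa [ContinuousAt, hγ0] at this
  have hd : ∀ᶠ s in 𝓝 (0 : ℝ), HasDerivAt (fun s => F (γ s))
      (fderiv ℝ F (γ s) (v + (2 * s) • w)) s := by
    have h1 : ∀ᶠ y in 𝓝 x, DifferentiableAt ℝ F y :=
      (hF.eventually (by simp)).mono fun y hy => hy.differentiableAt (by norm_num)
    filter_upwards [hγc.eventually h1] with s hs
    exact hs.hasFDerivAt.comp_hasDerivAt s (hγ s)
  have hderiv : deriv (fun s => F (γ s)) =ᶠ[𝓝 0] fun s => fderiv ℝ F (γ s) (v + (2 * s) • w) :=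
    hd.mono fun s hs => hs.deriv
  refine ⟨?_, ?_, ?_⟩
  · rw [hderiv.eq_of_nhds, hγ0]; simp
  · rw [hderiv.deriv_eq]
    have h2 : HasFDerivAt (fderiv ℝ F) (fderiv ℝ (fderiv ℝ F) x) (γ 0) := by
      rw [hγ0]
      exact ((hF.fderiv_right (m := 1) (by norm_num)).differentiableAt (by norm_num)).hasFDerivAt
    have h3 := h2.comp_hasDerivAt 0 (hγ 0)
    have h4 : HasDerivAt (fun s : ℝ => v + (2 * s) • w) ((2 : ℝ) • w) 0 := by
      simpa using (((hasDerivAt_id (0 : ℝ)).const_mul 2).smul_const w).const_add v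
    have h5 := h3.clm_apply h4
    refine h5.deriv.trans ?_
    simp [hγ0]
  · exact hd.self_of_nhds.continuousAt

/-- Non-degenerate tangency does not depend on the choice of the defining function. For a small
multiple `w` of the outward normal the parabola `x + s v + s² w` stays in the table, by the
curvature of the given defining function `F`; hence the second derivative along it of another
defining function `G` is non-negative too. -/
theorem IsNondegenerateTangency.of_defining {D : Set (Space d)} {x v : Space d}
    (h : IsNondegenerateTangency D x v) {G : Space d → ℝ} (hG : IsDefiningFunction 2 D G x) :
    inner ℝ v (gradient G x) = 0 ∧ 0 < fderiv ℝ (fderiv ℝ G) x v v := by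
  obtain ⟨F, hF, hFv, hFvv⟩ := h
  have hn : ‖gradient F x‖⁻¹ • gradient F x = ‖gradient G x‖⁻¹ • gradient G x :=
    IsInwardNormal.unique ⟨F, hF, rfl⟩ ⟨G, hG, rfl⟩
  have hG0 : 0 < ‖gradient G x‖ := norm_pos_iff.2 hG.gradient_ne
  have hF0 : 0 < ‖gradient F x‖ := norm_pos_iff.2 hF.gradient_ne
  have hGv : inner ℝ v (gradient G x) = 0 := by
    have := congrArg (fun n => inner ℝ v n) hn
    simp only [inner_smul_right, hFv, mul_zero] at this
    exact (mul_eq_zero.1 this.symm).resolve_left (inv_ne_zero hG0.ne')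
  refine ⟨hGv, ?_⟩
  set c := fderiv ℝ (fderiv ℝ F) x v v
  set b := c / (4 * ‖gradient F x‖)
  have hb : 0 < b := by positivity
  set w := -(b • (‖gradient F x‖⁻¹ • gradient F x))
  have hFw : fderiv ℝ F x w = -(b * ‖gradient F x‖) := by
    rw [← inner_gradient, inner_neg_right, inner_smul_right, inner_smul_right,
      real_inner_self_eq_norm_sq]
    field_simp
  have hGw : fderiv ℝ G x w = -(b * ‖gradient G x‖) := by
    simp only [w]
    rw [hn, ← inner_gradient, inner_neg_right, inner_smul_right, inner_smul_right,
      real_inner_self_eq_norm_sq]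
    field_simp
  obtain ⟨f1, f2, f3⟩ := deriv_deriv_parabola hF.contDiffAt v w
  obtain ⟨g1, g2, g3⟩ := deriv_deriv_parabola hG.contDiffAt v w
  set γ : ℝ → Space d := fun s => x + s • v + s ^ 2 • w
  have hγ0 : γ 0 = x := by simp [γ]
  have hγc : Tendsto γ (𝓝 0) (𝓝 x) := by
    have : ContinuousAt γ 0 := by fun_prop
    rwa [ContinuousAt, hγ0] at this
  have hFmin : IsLocalMin (fun s => F (γ s)) 0 := by
    refine isLocalMin_of_deriv_deriv_pos ?_ ?_ f3
    · rw [f2, hFw]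
      have : b * ‖gradient F x‖ = c / 4 := by simp only [b]; field_simp
      rw [this]
      show 0 < c + 2 * -(c / 4)
      linarith
    · rw [f1, ← inner_gradient, real_inner_comm, hFv]
  have hGmin : IsLocalMin (fun s => G (γ s)) 0 := by
    filter_upwards [hFmin, hγc.eventually hF.mem_iff, hγc.eventually hG.mem_iff] with s h1 h2 h3
    rw [hγ0, hG.zero]
    rw [hγ0, hF.zero] at h1
    exact h3.1 (h2.2 h1)
  have hnonneg : 0 ≤ deriv (deriv fun s => G (γ s)) 0 := by
    by_contra! hneg
    have hmax := isLocalMax_of_deriv_deriv_neg hneg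
      (by rw [g1, ← inner_gradient, real_inner_comm, hGv]) g3
    have heq : (fun s => G (γ s)) =ᶠ[𝓝 0] fun _ => G (γ 0) := by
      filter_upwards [hGmin, hmax] with s h1 h2
      exact le_antisymm h2 h1
    rw [heq.deriv.deriv_eq] at hneg
    simp at hneg
  rw [g2, hGw] at hnonneg
  have : 0 < b * ‖gradient G x‖ := by positivity
  linarith

end SteepBilliard

namespace SteepBilliard

/-! ### The structure of billiard trajectories -/

variable {d r : ℕ} {ι : Type} {B : Table d r ι} {S : ℝ} {q p : ℝ → Space d}

theorem IsBilliardTrajectory.mem_interior_or_frontier (h : IsBilliardTrajectory B S q p) {t : ℝ}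
    (ht : t ∈ Icc 0 S) : q t ∈ interior B.D ∨ q t ∈ frontier B.D := by
  by_cases hi : q t ∈ interior B.D
  · exact Or.inl hi
  · exact Or.inr ⟨subset_closure (h.mem t ht), hi⟩

/-- Without collisions the motion is free. -/
theorem IsBilliardTrajectory.free_on_Icc (h : IsBilliardTrajectory B S q p) {a b : ℝ}
    (ha : 0 ≤ a) (hb : b ≤ S) (hin : ∀ u ∈ Icc a b, q u ∈ interior B.D) :
    ∀ u ∈ Icc a b, p u = p a ∧ q u = q a + (u - a) • p a := by
  have hsub : Icc a b ⊆ Icc 0 S := Icc_subset_Icc ha hb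
  have hright : ∀ u ∈ Ico a b, ∀ (f : ℝ → Space d) f', HasDerivWithinAt f f' (Icc 0 S) u →
      HasDerivWithinAt f f' (Ici u) u := by
    intro u hu f f' hf
    exact (hf.mono (Icc_subset_Icc (ha.trans hu.1) hb)).mono_of_mem_nhdsWithin
      (Icc_mem_nhdsGE hu.2)
  have hp : ∀ u ∈ Icc a b, p u = p a := constant_of_has_deriv_right_zero
    (fun u hu => ((h.free u (hsub hu) (hin u hu)).2.continuousWithinAt).mono hsub)
    fun u hu => hright u hu _ _ (h.free u (hsub ⟨hu.1, hu.2.le⟩) (hin u ⟨hu.1, hu.2.le⟩)).2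
  have hd : ∀ u ∈ Icc a b, HasDerivWithinAt (fun u => q u - (u - a) • p a) 0 (Icc 0 S) u := by
    intro u hu
    have h1 := (h.free u (hsub hu) (hin u hu)).1
    rw [hp u hu] at h1
    have h2 : HasDerivWithinAt (fun u : ℝ => (u - a) • p a) (p a) (Icc 0 S) u := by
      simpa using (((hasDerivWithinAt_id u (Icc 0 S)).sub_const a).smul_const (p a))
    exact (h1.sub h2).congr_deriv (sub_self _)
  have hq := constant_of_has_deriv_right_zero
    (fun u hu => ((hd u hu).continuousWithinAt).mono hsub)
    fun u hu => hright u hu _ _ (hd u ⟨hu.1, hu.2.le⟩)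
  refine fun u hu => ⟨hp u hu, ?_⟩
  have := hq u hu
  simp only [sub_self, zero_smul, sub_zero] at this
  rw [← this, sub_add_cancel]

/-- Free motion between two possible collisions. -/
theorem IsBilliardTrajectory.free_on_Ioo (h : IsBilliardTrajectory B S q p) {a b : ℝ}
    (hab : a < b) (ha : 0 ≤ a) (hb : b ≤ S) (hin : ∀ u ∈ Ioo a b, q u ∈ interior B.D) :
    ∃ v, (∀ u ∈ Ioo a b, p u = v) ∧ (∀ u ∈ Icc a b, ∀ w ∈ Icc a b, q u = q w + (u - w) • v) ∧
      (q a ∈ interior B.D → p a = v) ∧ (q b ∈ interior B.D → p b = v) := by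
  set m := (a + b) / 2
  have hm : m ∈ Ioo a b := ⟨by simp only [m]; linarith, by simp only [m]; linarith⟩
  have key : ∀ x ∈ Icc a m, ∀ y ∈ Icc m b, (∀ u ∈ Icc x y, q u ∈ interior B.D) →
      ∀ u ∈ Icc x y, p u = p m ∧ q u = q m + (u - m) • p m := by
    intro x hx y hy hxy u hu
    have h1 := h.free_on_Icc (ha.trans hx.1) (hy.2.trans hb) hxy
    obtain ⟨h2, h3⟩ := h1 u hu
    obtain ⟨h4, h5⟩ := h1 m ⟨hx.2, hy.1⟩
    refine ⟨h2.trans h4.symm, ?_⟩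
    rw [h3, h5, h4, add_assoc, ← add_smul]
    congr 2
    ring
  have hopen : ∀ u ∈ Ioo a b, p u = p m ∧ q u = q m + (u - m) • p m := by
    intro u hu
    refine key (min u m) ⟨le_min hu.1.le hm.1.le, min_le_right _ _⟩ (max u m)
      ⟨le_max_right _ _, max_le hu.2.le hm.2.le⟩ (fun w hw => hin w ⟨?_, ?_⟩) u
      ⟨min_le_left _ _, le_max_left _ _⟩
    · exact (lt_min hu.1 hm.1).trans_le hw.1
    · exact hw.2.trans_lt (max_lt hu.2 hm.2)
  have hq : EqOn q (fun u => q m + (u - m) • p m) (Icc a b) := by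
    have h1 : EqOn q (fun u => q m + (u - m) • p m) (Ioo a b) := fun u hu => (hopen u hu).2
    refine h1.of_subset_closure (h.continuousOn.mono (Icc_subset_Icc ha hb)) (by fun_prop)
      Ioo_subset_Icc_self ?_
    rw [closure_Ioo hab.ne]
  refine ⟨p m, fun u hu => (hopen u hu).1, fun u hu w hw => ?_, fun hi => ?_, fun hi => ?_⟩
  · rw [hq hu, hq hw]
    simp only
    rw [add_assoc, ← add_smul]
    congr 2
    ring
  · refine (key a ⟨le_rfl, hm.1.le⟩ m ⟨le_rfl, hm.2.le⟩ (fun u hu => ?_) a ⟨le_rfl, hm.1.le⟩).1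
    rcases hu.1.eq_or_lt with h' | h'
    · rwa [← h']
    · exact hin u ⟨h', hu.2.trans_lt hm.2⟩
  · refine (key m ⟨hm.1.le, le_rfl⟩ b ⟨hm.2.le, le_rfl⟩ (fun u hu => ?_) b ⟨hm.2.le, le_rfl⟩).1
    rcases hu.2.eq_or_lt with h' | h'
    · rwa [h']
    · exact hin u ⟨hm.1.trans_le hu.1, h'⟩

theorem IsBilliardTrajectory.eventually_interior (h : IsBilliardTrajectory B S q p) (t : ℝ) :
    ∀ᶠ u in 𝓝[≠] t, u ∈ Icc 0 S → q u ∈ interior B.D := by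
  have h1 : IsClosed ({t ∈ Icc 0 S | q t ∈ frontier B.D} \ {t}) := (h.finite.sdiff).isClosed
  have h2 : ({t ∈ Icc 0 S | q t ∈ frontier B.D} \ {t})ᶜ ∈ 𝓝 t :=
    h1.isOpen_compl.mem_nhds fun h => h.2 rfl
  filter_upwards [nhdsWithin_le_nhds h2, self_mem_nhdsWithin] with u hu hut huS
  refine (h.mem_interior_or_frontier huS).resolve_right fun hf => hu ⟨⟨huS, hf⟩, hut⟩

/-- After any time there is an interval of free motion. -/
theorem IsBilliardTrajectory.exists_right (h : IsBilliardTrajectory B S q p) {t : ℝ}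
    (ht : t ∈ Ico 0 S) : ∃ s ∈ Ioc t S, ∃ v, (∀ u ∈ Ioc t s, q u ∈ interior B.D ∧ p u = v) ∧
      (∀ u ∈ Icc t s, q u = q t + (u - t) • v) ∧ (q t ∈ interior B.D → p t = v) := by
  have h1 : ∀ᶠ u in 𝓝[>] t, u ∈ Icc 0 S → q u ∈ interior B.D :=
    (h.eventually_interior t).filter_mono (nhdsWithin_mono _ fun u hu => ne_of_gt hu)
  obtain ⟨s, hs, hsub⟩ := mem_nhdsGT_iff_exists_Ioc_subset.1 h1
  have hs' : t < min s S := lt_min hs ht.2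
  have hin : ∀ u ∈ Ioc t (min s S), q u ∈ interior B.D := fun u hu =>
    hsub ⟨hu.1, hu.2.trans (min_le_left _ _)⟩
      ⟨ht.1.trans hu.1.le, hu.2.trans (min_le_right _ _)⟩
  obtain ⟨v, hv1, hv2, hv3, hv4⟩ := h.free_on_Ioo hs' ht.1 (min_le_right _ _)
    fun u hu => hin u ⟨hu.1, hu.2.le⟩
  refine ⟨min s S, ⟨hs', min_le_right _ _⟩, v, fun u hu => ⟨hin u hu, ?_⟩,
    fun u hu => hv2 u hu t ⟨le_rfl, hs'.le⟩, hv3⟩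
  rcases hu.2.eq_or_lt with h' | h'
  · rw [h']; exact hv4 (hin _ ⟨hs', le_rfl⟩)
  · exact hv1 u ⟨hu.1, h'⟩

/-- Before any time there is an interval of free motion. -/
theorem IsBilliardTrajectory.exists_left (h : IsBilliardTrajectory B S q p) {t : ℝ}
    (ht : t ∈ Ioc 0 S) : ∃ s ∈ Ico 0 t, ∃ v, (∀ u ∈ Ico s t, q u ∈ interior B.D ∧ p u = v) ∧
      (∀ u ∈ Icc s t, q u = q t + (u - t) • v) ∧ (q t ∈ interior B.D → p t = v) := by
  have h1 : ∀ᶠ u in 𝓝[<] t, u ∈ Icc 0 S → q u ∈ interior B.D :=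
    (h.eventually_interior t).filter_mono (nhdsWithin_mono _ fun u hu => ne_of_lt hu)
  obtain ⟨s, hs, hsub⟩ := mem_nhdsLT_iff_exists_Ico_subset.1 h1
  have hs' : max s 0 < t := max_lt hs ht.1
  have hin : ∀ u ∈ Ico (max s 0) t, q u ∈ interior B.D := fun u hu =>
    hsub ⟨(le_max_left _ _).trans hu.1, hu.2⟩
      ⟨(le_max_right _ _).trans hu.1, hu.2.le.trans ht.2⟩
  obtain ⟨v, hv1, hv2, hv3, hv4⟩ := h.free_on_Ioo hs' (le_max_right _ _) ht.2
    fun u hu => hin u ⟨hu.1.le, hu.2⟩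
  refine ⟨max s 0, ⟨le_max_right _ _, hs'⟩, v, fun u hu => ⟨hin u hu, ?_⟩,
    fun u hu => hv2 u hu t ⟨hs'.le, le_rfl⟩, hv4⟩
  rcases hu.1.eq_or_lt with h' | h'
  · rw [← h']; exact hv3 (hin _ ⟨le_rfl, hs'⟩)
  · exact hv1 u ⟨h', hu.2⟩

/-- The endpoints being inner, collisions occur at interior times. -/
theorem IsBilliardTrajectory.collision_time (h : IsBilliardTrajectory B S q p) {t : ℝ}
    (ht : t ∈ Icc 0 S) (hf : q t ∈ frontier B.D) : t ∈ Ioo 0 S := by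
  refine ⟨ht.1.lt_of_ne ?_, ht.2.lt_of_ne ?_⟩
  · rintro rfl
    exact hf.2 h.start_inner
  · rintro rfl
    exact hf.2 h.end_inner

theorem tendsto_of_eq_on_Ico {f : ℝ → Space d} {s t : ℝ} {v : Space d} (hst : s < t)
    (h : ∀ u ∈ Ico s t, f u = v) : Tendsto f (𝓝[<] t) (𝓝 v) :=
  tendsto_const_nhds.congr' <| by
    filter_upwards [Ico_mem_nhdsLT hst] with u hu using (h u hu).symm

theorem tendsto_of_eq_on_Ioc {f : ℝ → Space d} {s t : ℝ} {v : Space d} (hst : t < s)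
    (h : ∀ u ∈ Ioc t s, f u = v) : Tendsto f (𝓝[>] t) (𝓝 v) :=
  tendsto_const_nhds.congr' <| by
    filter_upwards [Ioc_mem_nhdsGT hst] with u hu using (h u hu).symm

theorem IsBilliardTrajectory.reflectionLaw (h : IsBilliardTrajectory B S q p) {t : ℝ}
    (ht : t ∈ Icc 0 S) (hf : q t ∈ frontier B.D) {v w : Space d} (hv : Tendsto p (𝓝[<] t) (𝓝 v))
    (hw : Tendsto p (𝓝[>] t) (𝓝 w)) : ReflectionLaw B.D (q t) v w := by
  obtain ⟨-, pin, pout, h1, h2, h3⟩ := h.collision t ht hf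
  rwa [tendsto_nhds_unique hv h1, tendsto_nhds_unique hw h2]

/-- The billiard flow is single-valued. -/
theorem BilliardMapsTo.unique {t : ℝ} {ρ σ σ' : Phase d} (h : BilliardMapsTo B t ρ σ)
    (h' : BilliardMapsTo B t ρ σ') : σ = σ' := by
  obtain ⟨q, p, hqp, h0, h1⟩ := h
  obtain ⟨q', p', hqp', h0', h1'⟩ := h'
  have hp0 : p 0 = p' 0 := congrArg Prod.snd (h0.trans h0'.symm)
  have hq0 : q 0 = q' 0 := congrArg Prod.fst (h0.trans h0'.symm)
  have hleft : ∀ u ∈ Ioc 0 t, (∀ w ∈ Icc 0 u, q w = q' w) → ∃ s < u, ∃ v,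
      (∀ w ∈ Ico s u, p w = v ∧ p' w = v) ∧
      (q u ∈ interior B.D → p u = v ∧ p' u = v) := by
    intro u hu hw
    obtain ⟨s, hs, v, hv1, hv2, hv3⟩ := hqp.exists_left hu
    obtain ⟨s', hs', v', hv1', hv2', hv3'⟩ := hqp'.exists_left hu
    have hm : max s s' < u := max_lt hs.2 hs'.2
    have hm0 : 0 ≤ max s s' := hs.1.trans (le_max_left _ _)
    have hvv : v = v' := by
      have e1 := hv2 (max s s') ⟨le_max_left _ _, hm.le⟩
      have e2 := hv2' (max s s') ⟨le_max_right _ _, hm.le⟩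
      rw [hw _ ⟨hm0, hm.le⟩, e2, ← hw u ⟨hu.1.le, le_rfl⟩, add_right_inj] at e1
      exact (smul_right_injective _ (sub_ne_zero.2 hm.ne) e1).symm
    refine ⟨max s s', hm, v, fun w hw => ⟨?_, ?_⟩, fun hi => ⟨hv3 hi, ?_⟩⟩
    · exact (hv1 w ⟨(le_max_left _ _).trans hw.1, hw.2⟩).2
    · rw [hvv]; exact (hv1' w ⟨(le_max_right _ _).trans hw.1, hw.2⟩).2
    · rw [hvv]; exact hv3' (hw u ⟨hu.1.le, le_rfl⟩ ▸ hi)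
  have hq : ∀ u ∈ Icc 0 t, q u = q' u := by
    refine real_induction hq0 ?_ ?_
    · intro u hu hw
      have h1 : EqOn q q' (Ico 0 u) := hw
      refine h1.of_subset_closure (hqp.continuousOn.mono (Icc_subset_Icc_right hu.2))
        (hqp'.continuousOn.mono (Icc_subset_Icc_right hu.2)) Ico_subset_Icc_self ?_
        ⟨hu.1.le, le_rfl⟩
      rw [closure_Ico hu.1.ne]
    · intro u hu hw
      obtain ⟨s, hs, v, hv1, hv2, hv3⟩ := hqp.exists_right hu
      obtain ⟨s', hs', v', hv1', hv2', hv3'⟩ := hqp'.exists_right hu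
      have hqu : q u = q' u := hw u ⟨hu.1, le_rfl⟩
      have huI : u ∈ Icc 0 t := ⟨hu.1, hu.2.le⟩
      have hvv : v = v' := by
        rcases hqp.mem_interior_or_frontier huI with hi | hf
        · rw [← hv3 hi, ← hv3' (hqu ▸ hi)]
          rcases hu.1.eq_or_lt with h | h
          · rwa [← h]
          · obtain ⟨-, -, v'', -, h2⟩ := hleft u ⟨h, hu.2.le⟩ hw
            rw [(h2 hi).1, (h2 hi).2]
        · have hut := hqp.collision_time huI hf
          obtain ⟨s'', hs'', v'', h1, -⟩ := hleft u ⟨hut.1, hu.2.le⟩ hw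
          have r1 := hqp.reflectionLaw huI hf
            (tendsto_of_eq_on_Ico hs'' fun w hw => (h1 w hw).1)
            (tendsto_of_eq_on_Ioc hs.1 fun w hw => (hv1 w hw).2)
          have r2 := hqp'.reflectionLaw huI (hqu ▸ hf)
            (tendsto_of_eq_on_Ico hs'' fun w hw => (h1 w hw).2)
            (tendsto_of_eq_on_Ioc hs'.1 fun w hw => (hv1' w hw).2)
          exact r1.unique (hqu ▸ r2)
      refine ⟨min s s', lt_min hs.1 hs'.1, fun w hw _ => ?_⟩
      rw [hv2 w ⟨hw.1.le, hw.2.trans (min_le_left _ _)⟩,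
        hv2' w ⟨hw.1.le, hw.2.trans (min_le_right _ _)⟩, hqu, hvv]
  have ht := hqp.nonneg
  have hp : p t = p' t := by
    rcases ht.eq_or_lt with h | h
    · rwa [← h]
    · obtain ⟨-, -, v, -, h2⟩ := hleft t ⟨h, le_rfl⟩ hq
      rw [(h2 hqp.end_inner).1, (h2 hqp.end_inner).2]
  rw [← h1, ← h1', hq t ⟨ht, le_rfl⟩, hp]

/-- Regular reflections and non-degenerate tangencies. -/
def IsAdmissibleCollision (D : Set (Space d)) (x v : Space d) : Prop :=
  IsRegularReflection D x v ∨ IsNondegenerateTangency D x v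

/-- A billiard trajectory all of whose collisions are regular reflections or non-degenerate
tangencies. -/
structure IsAdmissibleTrajectory (B : Table d r ι) (S : ℝ) (q p : ℝ → Space d) : Prop
    extends IsBilliardTrajectory B S q p where
  admissible : ∀ t ∈ Icc 0 S, q t ∈ frontier B.D → ∃ pin, Tendsto p (𝓝[<] t) (𝓝 pin) ∧
    IsAdmissibleCollision B.D (q t) pin

/-- `b_t ρ = σ`, along an admissible trajectory. -/
def AdmissibleMapsTo (B : Table d r ι) (t : ℝ) (ρ σ : Phase d) : Prop :=
  ∃ q p : ℝ → Space d, IsAdmissibleTrajectory B t q p ∧ (q 0, p 0) = ρ ∧ (q t, p t) = σ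

theorem AdmissibleMapsTo.billiardMapsTo {t : ℝ} {ρ σ : Phase d} (h : AdmissibleMapsTo B t ρ σ) :
    BilliardMapsTo B t ρ σ := by
  obtain ⟨q, p, h1, h2, h3⟩ := h
  exact ⟨q, p, h1.toIsBilliardTrajectory, h2, h3⟩

/-- Induction along an admissible trajectory: a property of times is inherited along free flights
and across collisions. -/
theorem IsAdmissibleTrajectory.induction (h : IsAdmissibleTrajectory B S q p) {M : ℝ → Prop}
    (h0 : M 0)
    (hfree : ∀ s t, 0 ≤ s → s ≤ t → t ≤ S → (∀ u ∈ Icc s t, q u ∈ interior B.D) → p t = p s →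
      (∀ u ∈ Icc s t, q u = q s + (u - s) • p s) → M s → M t)
    (hcoll : ∀ t ∈ Ioo 0 S, q t ∈ frontier B.D → q t ∉ B.corner →
      ∀ pin pout, ReflectionLaw B.D (q t) pin pout → IsAdmissibleCollision B.D (q t) pin →
      (∀ᶠ a in 𝓝[>] (0 : ℝ), q t - a • pin ∈ interior B.D ∧ (q (t - a), p (t - a)) =
        (q t - a • pin, pin)) →
      (∀ᶠ b in 𝓝[>] (0 : ℝ), q t + b • pout ∈ interior B.D ∧ (q (t + b), p (t + b)) =
        (q t + b • pout, pout)) →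
      ∃ a₀ > 0, ∀ a ∈ Ioo 0 a₀, ∀ b ∈ Ioo 0 a₀, 0 ≤ t - a → t + b ≤ S → M (t - a) → M (t + b)) :
    ∀ t ∈ Icc 0 S, q t ∈ interior B.D → M t := by
  have hB := h.toIsBilliardTrajectory
  refine real_induction (fun _ => h0) ?_ ?_
  · intro t ht hu hi
    obtain ⟨s, hs, v, hv1, hv2, hv3⟩ := hB.exists_left ht
    have hin : ∀ u ∈ Icc s t, q u ∈ interior B.D := fun u hu =>
      hu.2.eq_or_lt.elim (fun h => h ▸ hi) fun h => (hv1 u ⟨hu.1, h⟩).1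
    have hfl := hB.free_on_Icc hs.1 ht.2 hin
    exact hfree s t hs.1 hs.2.le ht.2 hin (hfl t ⟨hs.2.le, le_rfl⟩).1 (fun u hu => (hfl u hu).2)
      (hu s hs (hin s ⟨le_rfl, hs.2.le⟩))
  · intro t ht hu
    have htI : t ∈ Icc 0 S := ⟨ht.1, ht.2.le⟩
    obtain ⟨s, hs, v, hv1, hv2, hv3⟩ := hB.exists_right ht
    rcases hB.mem_interior_or_frontier htI with hi | hf
    · refine ⟨s, hs.1, fun u hu' huS hui => ?_⟩
      have hin : ∀ w ∈ Icc t u, q w ∈ interior B.D := fun w hw =>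
        hw.1.eq_or_lt.elim (fun h => h ▸ hi) fun h => (hv1 w ⟨h, hw.2.trans hu'.2⟩).1
      have hfl := hB.free_on_Icc ht.1 huS hin
      exact hfree t u ht.1 hu'.1.le huS hin (hfl u ⟨hu'.1.le, le_rfl⟩).1
        (fun w hw => (hfl w hw).2) (hu t ⟨ht.1, le_rfl⟩ hi)
    · have htS := hB.collision_time htI hf
      obtain ⟨s', hs', v', hv1', hv2', hv3'⟩ := hB.exists_left ⟨htS.1, htS.2.le⟩
      have hl := tendsto_of_eq_on_Ico hs'.2 fun w hw => (hv1' w hw).2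
      have hr := tendsto_of_eq_on_Ioc hs.1 fun w hw => (hv1 w hw).2
      obtain ⟨pin, hpin, hadm⟩ := h.admissible t htI hf
      rw [tendsto_nhds_unique hpin hl] at hadm
      have hleft : ∀ a ∈ Ioc 0 (t - s'), q t - a • v' ∈ interior B.D ∧
          (q (t - a), p (t - a)) = (q t - a • v', v') := by
        intro a ha
        have e1 := hv1' (t - a) ⟨by linarith [ha.2], by linarith [ha.1]⟩
        have e2 := hv2' (t - a) ⟨by linarith [ha.2], by linarith [ha.1]⟩
        have e3 : q (t - a) = q t - a • v' := by rw [e2]; simp [sub_eq_add_neg]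
        exact ⟨e3 ▸ e1.1, by rw [e3, e1.2]⟩
      obtain ⟨a₀, ha₀, hM⟩ := hcoll t htS hf (hB.collision t htI hf).1 v' v
        (hB.reflectionLaw htI hf hl hr) hadm
        (by filter_upwards [Ioc_mem_nhdsGT (sub_pos.2 hs'.2)] with a ha using hleft a ha)
        (by
          filter_upwards [Ioc_mem_nhdsGT (sub_pos.2 hs.1)] with b hb
          have e1 := hv1 (t + b) ⟨by linarith [hb.1], by linarith [hb.2]⟩
          have e2 := hv2 (t + b) ⟨by linarith [hb.1], by linarith [hb.2]⟩
          have e3 : q (t + b) = q t + b • v := by rw [e2]; simp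
          exact ⟨e3 ▸ e1.1, by rw [e3, e1.2]⟩)
      set a := min (a₀ / 2) (t - s')
      have ha : 0 < a := lt_min (by linarith) (sub_pos.2 hs'.2)
      have ha' : a ≤ t - s' := min_le_right _ _
      have haa : a < a₀ := (min_le_left _ _).trans_lt (by linarith)
      refine ⟨t + a₀ / 2, by linarith, fun u hu' huS _ => ?_⟩
      have := hM a ⟨ha, haa⟩ (u - t) ⟨by linarith [hu'.1], by linarith [hu'.2]⟩
        (by linarith [hs'.1]) (by linarith)
        (hu (t - a) ⟨by linarith [hs'.1], by linarith⟩
          (hv1' _ ⟨by linarith, by linarith⟩).1)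
      rwa [add_sub_cancel] at this

end SteepBilliard

namespace SteepBilliard

/-! ### Construction of billiard trajectories -/

variable {d r : ℕ} {ι : Type} {B : Table d r ι}

theorem continuousOn_concat {s t : ℝ} {f g : ℝ → Space d} (hs : 0 ≤ s) (ht : 0 ≤ t)
    (hfg : f s = g 0) (hf : ContinuousOn f (Icc 0 s)) (hg : ContinuousOn g (Icc 0 t)) :
    ContinuousOn (concat s f g) (Icc 0 (s + t)) := by
  rw [← Icc_union_Icc_eq_Icc hs (by linarith : s ≤ s + t)]
  refine ContinuousOn.union_of_isClosed ?_ ?_ isClosed_Icc isClosed_Icc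
  · exact hf.congr fun u hu => concat_of_le hu.2
  · have h1 : ContinuousOn (fun u => g (u - s)) (Icc s (s + t)) :=
      hg.comp (by fun_prop) fun u hu => ⟨by linarith [hu.1], by linarith [hu.2]⟩
    exact h1.congr fun u hu => concat_of_ge hfg hu.1

theorem concat_eventuallyEq_of_lt {s u : ℝ} {f g : ℝ → Space d} (h : u < s) :
    concat s f g =ᶠ[𝓝 u] f := by
  filter_upwards [Iio_mem_nhds h] with w hw using concat_of_le hw.le

theorem concat_eventuallyEq_of_gt {s u : ℝ} {f g : ℝ → Space d} (h : s < u) :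
    concat s f g =ᶠ[𝓝 u] fun w => g (w - s) := by
  filter_upwards [Ioi_mem_nhds h] with w hw using concat_of_lt hw

theorem tendsto_concat_nhdsLT {s u : ℝ} {f g : ℝ → Space d} {v : Space d} (hus : u ≠ s)
    (hf : u < s → Tendsto f (𝓝[<] u) (𝓝 v)) (hg : s < u → Tendsto g (𝓝[<] (u - s)) (𝓝 v)) :
    Tendsto (concat s f g) (𝓝[<] u) (𝓝 v) := by
  rcases hus.lt_or_gt with h | h
  · exact (hf h).congr' ((concat_eventuallyEq_of_lt h).filter_mono nhdsWithin_le_nhds).symm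
  · have h1 : Tendsto (fun w => w - s) (𝓝[<] u) (𝓝[<] (u - s)) := by
      refine ((continuous_sub_right s).continuousWithinAt).tendsto_nhdsWithin fun w hw => ?_
      exact sub_lt_sub_right (mem_Iio.1 hw) s
    exact ((hg h).comp h1).congr'
      ((concat_eventuallyEq_of_gt h).filter_mono nhdsWithin_le_nhds).symm

theorem tendsto_concat_nhdsGT {s u : ℝ} {f g : ℝ → Space d} {v : Space d} (hus : u ≠ s)
    (hf : u < s → Tendsto f (𝓝[>] u) (𝓝 v)) (hg : s < u → Tendsto g (𝓝[>] (u - s)) (𝓝 v)) :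
    Tendsto (concat s f g) (𝓝[>] u) (𝓝 v) := by
  rcases hus.lt_or_gt with h | h
  · exact (hf h).congr' ((concat_eventuallyEq_of_lt h).filter_mono nhdsWithin_le_nhds).symm
  · have h1 : Tendsto (fun w => w - s) (𝓝[>] u) (𝓝[>] (u - s)) := by
      refine ((continuous_sub_right s).continuousWithinAt).tendsto_nhdsWithin fun w hw => ?_
      exact sub_lt_sub_right (mem_Ioi.1 hw) s
    exact ((hg h).comp h1).congr'
      ((concat_eventuallyEq_of_gt h).filter_mono nhdsWithin_le_nhds).symm

theorem AdmissibleMapsTo.trans {s t : ℝ} {ρ σ τ : Phase d} (h : AdmissibleMapsTo B s ρ σ)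
    (h' : AdmissibleMapsTo B t σ τ) : AdmissibleMapsTo B (s + t) ρ τ := by
  obtain ⟨q, p, hqp, h0, h1⟩ := h
  obtain ⟨q', p', hqp', h0', h1'⟩ := h'
  have hs := hqp.nonneg
  have ht := hqp'.nonneg
  have hq : q s = q' 0 := congrArg Prod.fst (h1.trans h0'.symm)
  have hp : p s = p' 0 := congrArg Prod.snd (h1.trans h0'.symm)
  have hend : concat s q q' (s + t) = q' t := by
    rw [concat_of_ge hq (by linarith), add_sub_cancel_left]
  have hl : ∀ u ∈ Icc 0 (s + t), u ≤ s → u ∈ Icc 0 s := fun u hu h => ⟨hu.1, h⟩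
  have hr : ∀ u ∈ Icc 0 (s + t), s ≤ u → u - s ∈ Icc 0 t := fun u hu h =>
    ⟨by linarith, by linarith [hu.2]⟩
  -- at the joining time the point is inner, so that every collision is one of a single path
  have hne : ∀ u, concat s q q' u ∈ frontier B.D → u ≠ s := by
    rintro u hu rfl
    rw [concat_of_le le_rfl] at hu
    exact hu.2 hqp.end_inner
  refine ⟨concat s q q', concat s p p', ⟨⟨add_nonneg hs ht,
    continuousOn_concat hs ht hq hqp.continuousOn hqp'.continuousOn, ?_, ?_, ?_, ?_, ?_, ?_⟩, ?_⟩,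
    ?_, ?_⟩
  · intro u hu
    rcases le_or_gt u s with h | h
    · rw [concat_of_le h]; exact hqp.mem u (hl u hu h)
    · rw [concat_of_lt h]; exact hqp'.mem _ (hr u hu h.le)
  · rw [concat_of_le hs]; exact hqp.start_inner
  · rw [hend]; exact hqp'.end_inner
  · refine (hqp.finite.union (hqp'.finite.image fun u => u + s)).subset ?_
    rintro u ⟨hu, huf⟩
    rcases le_or_gt u s with h | h
    · rw [concat_of_le h] at huf
      exact Or.inl ⟨hl u hu h, huf⟩
    · rw [concat_of_lt h] at huf
      exact Or.inr ⟨u - s, ⟨hr u hu h.le, huf⟩, sub_add_cancel _ _⟩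
  · intro u hu hi
    refine ⟨hasDerivWithinAt_concat hs ht hq (fun h => ?_) fun h => ?_,
      hasDerivWithinAt_concat hs ht hp (fun h => ?_) fun h => ?_⟩
    · rw [concat_of_le h] at hi ⊢; exact (hqp.free u (hl u hu h) hi).1
    · rw [concat_of_ge hp h]; rw [concat_of_ge hq h] at hi
      exact (hqp'.free _ (hr u hu h) hi).1
    · rw [concat_of_le h] at hi; exact (hqp.free u (hl u hu h) hi).2
    · rw [concat_of_ge hq h] at hi
      exact (hqp'.free _ (hr u hu h) hi).2
  · intro u hu hf
    rcases (hne u hf).lt_or_gt with h | h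
    · rw [concat_of_le h.le] at hf ⊢
      obtain ⟨hc, pin, pout, h1, h2, h3⟩ := hqp.collision u (hl u hu h.le) hf
      exact ⟨hc, pin, pout, tendsto_concat_nhdsLT h.ne (fun _ => h1) fun h' => absurd h' h.not_gt,
        tendsto_concat_nhdsGT h.ne (fun _ => h2) fun h' => absurd h' h.not_gt, h3⟩
    · rw [concat_of_lt h] at hf ⊢
      obtain ⟨hc, pin, pout, h1, h2, h3⟩ := hqp'.collision _ (hr u hu h.le) hf
      exact ⟨hc, pin, pout, tendsto_concat_nhdsLT h.ne' (fun h' => absurd h' h.not_gt) fun _ => h1,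
        tendsto_concat_nhdsGT h.ne' (fun h' => absurd h' h.not_gt) fun _ => h2, h3⟩
  · intro u hu hf
    rcases (hne u hf).lt_or_gt with h | h
    · rw [concat_of_le h.le] at hf ⊢
      obtain ⟨pin, h1, h2⟩ := hqp.admissible u (hl u hu h.le) hf
      exact ⟨pin, tendsto_concat_nhdsLT h.ne (fun _ => h1) fun h' => absurd h' h.not_gt, h2⟩
    · rw [concat_of_lt h] at hf ⊢
      obtain ⟨pin, h1, h2⟩ := hqp'.admissible _ (hr u hu h.le) hf
      exact ⟨pin, tendsto_concat_nhdsLT h.ne' (fun h' => absurd h' h.not_gt) fun _ => h1, h2⟩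
  · rw [concat_of_le hs, concat_of_le hs, h0]
  · rw [hend, concat_of_ge hp (by linarith), add_sub_cancel_left, h1']

theorem hasDerivAt_line (y v : Space d) (u : ℝ) : HasDerivAt (fun u : ℝ => y + u • v) v u := by
  simpa using ((hasDerivAt_id u).smul_const v).const_add y

theorem admissibleMapsTo_free {y v : Space d} {τ : ℝ} (hτ : 0 ≤ τ)
    (hfree : ∀ u ∈ Icc 0 τ, y + u • v ∈ interior B.D) :
    AdmissibleMapsTo B τ (y, v) (y + τ • v, v) := by
  refine ⟨fun u => y + u • v, fun _ => v, ⟨⟨hτ, by fun_prop, fun u hu =>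
    interior_subset (hfree u hu), hfree 0 ⟨le_rfl, hτ⟩, hfree τ ⟨hτ, le_rfl⟩, ?_, ?_, ?_⟩, ?_⟩,
    by simp, rfl⟩
  · convert finite_empty
    rw [eq_empty_iff_forall_notMem]
    exact fun u hu => hu.2.2 (hfree u hu.1)
  · exact fun u _ _ => ⟨(hasDerivAt_line y v u).hasDerivWithinAt, hasDerivWithinAt_const _ _ _⟩
  · exact fun u hu hf => absurd (hfree u hu) hf.2
  · exact fun u hu hf => absurd (hfree u hu) hf.2

/-- A path that is free except for a single admissible collision is an admissible trajectory. -/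
theorem admissibleMapsTo_collision {y v w x : Space d} {τ S : ℝ} (hτ : τ ∈ Ioo 0 S)
    (hx : y + τ • v = x) (hxD : x ∈ frontier B.D) (hxc : x ∉ B.corner)
    (hrefl : ReflectionLaw B.D x v w) (hadm : IsAdmissibleCollision B.D x v)
    (hin : ∀ u ∈ Ico 0 τ, y + u • v ∈ interior B.D)
    (hout : ∀ u ∈ Ioc 0 (S - τ), x + u • w ∈ interior B.D) :
    AdmissibleMapsTo B S (y, v) (x + (S - τ) • w, w) := by
  set f : ℝ → Space d := fun u => y + u • v
  set g : ℝ → Space d := fun u => x + u • w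
  have hfg : f τ = g 0 := by simp [f, g, hx]
  have hS : τ + (S - τ) = S := by ring
  have hτS : 0 ≤ S - τ := sub_nonneg.2 hτ.2.le
  have hl : ∀ u, u ≤ τ → concat τ f g u = f u := fun u h => concat_of_le h
  have hr : ∀ u, τ < u → concat τ f g u = g (u - τ) := fun u h => concat_of_lt h
  have hinner : ∀ u ∈ Icc 0 S, u ≠ τ → concat τ f g u ∈ interior B.D := by
    intro u hu hne
    rcases hne.lt_or_gt with h | h
    · rw [hl u h.le]; exact hin u ⟨hu.1, h⟩
    · rw [hr u h]; exact hout _ ⟨sub_pos.2 h, by linarith [hu.2]⟩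
  have hτv : concat τ f g τ = x := (hl τ le_rfl).trans hx
  have honly : ∀ u ∈ Icc 0 S, concat τ f g u ∈ frontier B.D → u = τ := by
    intro u hu hf
    by_contra hne
    exact hf.2 (hinner u hu hne)
  have hpin : Tendsto (concat τ (fun _ => v) fun _ => w) (𝓝[<] τ) (𝓝 v) :=
    tendsto_of_eq_on_Ico hτ.1 fun u hu => concat_of_le hu.2.le
  have hpout : Tendsto (concat τ (fun _ => v) fun _ => w) (𝓝[>] τ) (𝓝 w) :=
    tendsto_of_eq_on_Ioc hτ.2 fun u hu => concat_of_lt hu.1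
  refine ⟨concat τ f g, concat τ (fun _ => v) fun _ => w, ⟨⟨(hτ.1.trans hτ.2).le, ?_, ?_, ?_, ?_,
    ?_, ?_, ?_⟩, ?_⟩, ?_, ?_⟩
  · have := continuousOn_concat (t := S - τ) hτ.1.le hτS hfg
      (by fun_prop : Continuous f).continuousOn (by fun_prop : Continuous g).continuousOn
    rwa [hS] at this
  · intro u hu
    by_cases h : u = τ
    · rw [h, hτv, ← B.isClosed.closure_eq]
      exact frontier_subset_closure hxD
    · exact interior_subset (hinner u hu h)
  · exact hinner 0 ⟨le_rfl, (hτ.1.trans hτ.2).le⟩ hτ.1.ne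
  · exact hinner S ⟨(hτ.1.trans hτ.2).le, le_rfl⟩ hτ.2.ne'
  · exact (finite_singleton τ).subset fun u hu => honly u hu.1 hu.2
  · intro u hu hi
    have hne : u ≠ τ := by
      rintro rfl
      rw [hτv] at hi
      exact hxD.2 hi
    refine ⟨?_, ?_⟩
    · rw [← hS]
      refine hasDerivWithinAt_concat hτ.1.le hτS hfg (fun h => ?_) fun h => ?_
      · rw [concat_of_le h]; exact (hasDerivAt_line y v u).hasDerivWithinAt
      · rw [concat_of_lt (h.lt_of_ne hne.symm)]
        exact (hasDerivAt_line x w _).hasDerivWithinAt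
    · rcases hne.lt_or_gt with h | h
      · exact ((hasDerivAt_const u v).congr_of_eventuallyEq
          (concat_eventuallyEq_of_lt h)).hasDerivWithinAt
      · exact ((hasDerivAt_const u w).congr_of_eventuallyEq
          (concat_eventuallyEq_of_gt h)).hasDerivWithinAt
  · intro u hu hf
    obtain rfl := honly u hu hf
    rw [hτv]
    exact ⟨hxc, v, w, hpin, hpout, hrefl⟩
  · intro u hu hf
    obtain rfl := honly u hu hf
    rw [hτv]
    exact ⟨v, hpin, hadm⟩
  · rw [hl 0 hτ.1.le, concat_of_le hτ.1.le]
    simp [f]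
  · rw [hr S hτ.2, concat_of_lt hτ.2]

/-- Stability of free flight for the billiard. -/
theorem flowTimeLimit_billiard_free {y v : Space d} {τ : ℝ} (hτ : 0 ≤ τ)
    (hfree : ∀ u ∈ Icc 0 τ, y + u • v ∈ interior B.D) :
    FlowTimeLimit (⊤ : Filter Unit) (fun _ => AdmissibleMapsTo B) τ (y, v) (y + τ • v, v) := by
  intro N hN
  obtain ⟨τ', hττ', hfree'⟩ := exists_free_extension isOpen_interior hτ hfree
  have h1 : ∀ᶠ ρ : Phase d in 𝓝 (y, v), ∀ u ∈ Icc 0 τ', ρ.1 + u • ρ.2 ∈ interior B.D := by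
    refine isCompact_Icc.eventually_forall_of_forall_eventually fun u hu => ?_
    have hc : Continuous fun z : Phase d × ℝ => z.1.1 + z.2 • z.1.2 := by fun_prop
    exact hc.continuousAt.eventually (isOpen_interior.mem_nhds (hfree' u hu))
  have h2 : ∀ᶠ z : Phase d × ℝ in 𝓝 (y, v) ×ˢ 𝓝[Ici 0] τ, (z.1.1 + z.2 • z.1.2, z.1.2) ∈ N := by
    have hc : Continuous fun z : Phase d × ℝ => (z.1.1 + z.2 • z.1.2, z.1.2) := by fun_prop
    have h3 : ∀ᶠ z in 𝓝 ((y, v), τ), (z.1.1 + z.2 • z.1.2, z.1.2) ∈ N :=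
      hc.continuousAt.eventually hN
    rw [nhds_prod_eq] at h3
    exact h3.filter_mono (Filter.prod_mono le_rfl nhdsWithin_le_nhds)
  have h3 : ∀ᶠ t in 𝓝[Ici 0] τ, 0 ≤ t ∧ t ≤ τ' := by
    filter_upwards [self_mem_nhdsWithin, nhdsWithin_le_nhds (Iic_mem_nhds hττ')] with t a b
    exact ⟨a, b⟩
  have h4 : ∀ᶠ z : Phase d × ℝ in 𝓝 (y, v) ×ˢ 𝓝[Ici 0] τ,
      ∃ σ ∈ N, AdmissibleMapsTo B z.2 z.1 σ := by
    filter_upwards [h2, tendsto_fst.eventually h1, tendsto_snd.eventually h3] with z a b c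
    exact ⟨_, a, admissibleMapsTo_free c.1 fun u hu => b u ⟨hu.1, hu.2.trans c.2⟩⟩
  exact tendsto_snd.eventually h4

end SteepBilliard

namespace SteepBilliard

/-! ### Barrier functions of one variable -/

/-- The properties of a single barrier function on `(-a, a)` which do not refer to the limit
`ε → 0`. -/
structure IsBarrier (a : ℝ) (W : ℝ → EReal) : Prop where
  ne_bot : ∀ x ∈ Ioo (-a) a, W x ≠ ⊥
  continuousOn : ContinuousOn W (Ioo (-a) a)
  contDiffOn : ContDiffOn ℝ 1 (fun x => (W x).toReal) {x ∈ Ioo (-a) a | W x ≠ ⊤}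
  deriv_ne : ∀ x ∈ Ioo (-a) a, W x ≠ ⊤ → deriv (fun x => (W x).toReal) x ≠ 0

namespace IsBarrier

variable {a : ℝ} {W : ℝ → EReal}

theorem isOpen_finite (h : IsBarrier a W) : IsOpen {x ∈ Ioo (-a) a | W x ≠ ⊤} :=
  h.continuousOn.isOpen_inter_preimage isOpen_Ioo isOpen_ne

theorem contDiffAt (h : IsBarrier a W) {x : ℝ} (hx : x ∈ Ioo (-a) a) (hfin : W x ≠ ⊤) :
    ContDiffAt ℝ 1 (fun x => (W x).toReal) x :=
  h.contDiffOn.contDiffAt (h.isOpen_finite.mem_nhds ⟨hx, hfin⟩)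

/-- The derivative of a barrier function does not vanish, so there is no finite interior
minimum. -/
theorem not_interior_min (h : IsBarrier a W) {b c m : ℝ} (hb : -a < b) (hc : c < a)
    (hm : m ∈ Ioo b c) (hmin : ∀ x ∈ Icc b c, W m ≤ W x) (hfin : W m ≠ ⊤) : False := by
  have hma : m ∈ Ioo (-a) a := ⟨hb.trans hm.1, hm.2.trans hc⟩
  refine h.deriv_ne m hma hfin (IsLocalMin.deriv_eq_zero ?_)
  filter_upwards [h.isOpen_finite.mem_nhds ⟨hma, hfin⟩, Ioo_mem_nhds hm.1 hm.2] with x hx hx'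
  exact EReal.toReal_le_toReal (hmin x ⟨hx'.1.le, hx'.2.le⟩) (h.ne_bot m hma) hx.2

/-- Below the barrier level `w`, which is exceeded on the left at `b`, the barrier function is
decreasing: otherwise it would have a minimum in between. -/
theorem le_of_le (h : IsBarrier a W) {b x y : ℝ} {w : EReal} (hb : -a < b) (hbx : b < x)
    (hxy : x ≤ y) (hy : y < a) (hWb : w < W b) (hWx : W x ≤ w) : W y ≤ W x := by
  by_contra! hlt
  have hcont : ContinuousOn W (Icc b y) :=
    h.continuousOn.mono fun u hu => ⟨hb.trans_le hu.1, hu.2.trans_lt hy⟩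
  obtain ⟨m, hm, hmin⟩ := isCompact_Icc.exists_isMinOn ⟨b, le_rfl, (hbx.trans_le hxy).le⟩ hcont
  have hmx : W m ≤ W x := hmin ⟨hbx.le, hxy⟩
  refine h.not_interior_min hb hy ⟨hm.1.lt_of_ne ?_, hm.2.lt_of_ne ?_⟩ (fun u hu => hmin hu) ?_
  · rintro rfl
    exact absurd (hmx.trans hWx) (not_le.2 hWb)
  · rintro rfl
    exact absurd hmx (not_le.2 hlt)
  · exact ((hmx.trans hWx).trans_lt (hWb.trans_le le_top)).ne

theorem deriv_neg (h : IsBarrier a W) {b x : ℝ} {w : EReal} (hb : -a < b) (hbx : b < x)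
    (hx : x < a) (hWb : w < W b) (hWx : W x ≤ w) : deriv (fun x => (W x).toReal) x < 0 := by
  have hxa : x ∈ Ioo (-a) a := ⟨hb.trans hbx, hx⟩
  have hfin : W x ≠ ⊤ := (hWx.trans_lt (hWb.trans_le le_top)).ne
  refine lt_of_le_of_ne ?_ (h.deriv_ne x hxa hfin)
  have hd : HasDerivAt (fun x => (W x).toReal) (deriv (fun x => (W x).toReal) x) x :=
    ((h.contDiffAt hxa hfin).differentiableAt one_ne_zero).hasDerivAt
  have h1 := (hasDerivAt_iff_tendsto_slope.1 hd).mono_left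
    (nhdsWithin_mono _ fun s hs => (ne_of_gt hs : s ≠ x) : 𝓝[>] x ≤ _)
  refine le_of_tendsto h1 ?_
  filter_upwards [Ioo_mem_nhdsGT hx] with y hy
  rw [slope_def_field]
  refine div_nonpos_of_nonpos_of_nonneg (sub_nonpos.2 ?_) (sub_nonneg.2 hy.1.le)
  exact EReal.toReal_le_toReal (h.le_of_le hb hbx hy.1.le hy.2 hWb hWx)
    (h.ne_bot y ⟨hxa.1.trans hy.1, hy.2⟩) hfin

/-- If the inverse function of the barrier is almost constant, then the barrier is steep. -/
theorem lt_abs_deriv (h : IsBarrier a W) {I : ℝ → ℝ} {w₁ w₂ x M : ℝ} (hM : 0 < M)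
    (hI : ∀ w ∈ Icc w₁ w₂, ∀ x ∈ Ioo (-a) a, W x = (w : EReal) → x = I w)
    (hI' : ∀ w ∈ Icc w₁ w₂, |deriv I w| < M⁻¹) (hx : x ∈ Ioo (-a) a) (h₁ : (w₁ : EReal) < W x)
    (h₂ : W x < w₂) : M < |deriv (fun x => (W x).toReal) x| := by
  have hfin : W x ≠ ⊤ := (h₂.trans_le le_top).ne
  set f : ℝ → ℝ := fun x => (W x).toReal
  have hcoe : ∀ y ∈ Ioo (-a) a, W y ≠ ⊤ → ((f y : ℝ) : EReal) = W y := fun y hy hy' =>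
    EReal.coe_toReal hy' (h.ne_bot y hy)
  have hfx : f x ∈ Ioo w₁ w₂ := by
    constructor
    · exact EReal.coe_lt_coe_iff.1 ((hcoe x hx hfin).symm ▸ h₁)
    · exact EReal.coe_lt_coe_iff.1 ((hcoe x hx hfin).symm ▸ h₂)
  have hc := h.contDiffAt hx hfin
  have hinv : ∀ᶠ y in 𝓝 x, I (f y) = y := by
    filter_upwards [h.isOpen_finite.mem_nhds ⟨hx, hfin⟩,
      hc.continuousAt.eventually (Ioo_mem_nhds hfx.1 hfx.2)] with y hy hy'
    exact (hI (f y) ⟨hy'.1.le, hy'.2.le⟩ y hy.1 (hcoe y hy.1 hy.2).symm).symm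
  have hne := h.deriv_ne x hx hfin
  have hd := ((hc.hasStrictDerivAt one_ne_zero).to_local_left_inverse hne hinv).hasDerivAt.deriv
  have := hI' (f x) ⟨hfx.1.le, hfx.2.le⟩
  rw [hd, abs_inv] at this
  exact (inv_lt_inv₀ (abs_pos.2 hne) hM).1 this

end IsBarrier

/-! ### Boundary charts -/

variable {d r : ℕ} {ι : Type} {B : Table d r ι}

/-- What conditions I-IV give in a ball around a boundary point `x` which is not a corner: functions
`F ε`, whose limit `F 0` defines the table, such that the force of the potential `V ε` has the
direction of `∇F ε` at all points where the potential is at most `w < e`; this force is large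
where the potential is in a compact part of `(0, e)`, and points with potential at most `w` are
almost in the table. -/
structure IsBoundaryChart (B : Table d r ι) (V : ℝ → Space d → EReal) (e : EReal) (x : Space d)
    (R : ℝ) (F : ℝ → Space d → ℝ) : Prop where
  pos : 0 < R
  notMem_corner : ∀ y ∈ Metric.ball x R, y ∉ B.corner
  contDiffOn : ∀ᶠ ε in 𝓝[Ici 0] (0 : ℝ), ContDiffOn ℝ 2 (F ε) (Metric.ball x R)
  tendsto : ∀ y ∈ Metric.ball x R,
    Tendsto (fun z : ℝ × Space d => F z.1 z.2) (𝓝[Ici 0] 0 ×ˢ 𝓝 y) (𝓝 (F 0 y))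
  tendsto_gradient : ∀ y ∈ Metric.ball x R,
    Tendsto (fun z : ℝ × Space d => gradient (F z.1) z.2) (𝓝[Ici 0] 0 ×ˢ 𝓝 y)
      (𝓝 (gradient (F 0) y))
  tendsto_hessian : ∀ y ∈ Metric.ball x R, ∀ v : Space d,
    Tendsto (fun z : ℝ × Space d × Space d => fderiv ℝ (fderiv ℝ (F z.1)) z.2.1 z.2.2 z.2.2)
      (𝓝[Ici 0] 0 ×ˢ 𝓝 (y, v)) (𝓝 (fderiv ℝ (fderiv ℝ (F 0)) y v v))
  zero : F 0 x = 0
  gradient_ne : ∀ y ∈ Metric.ball x R, gradient (F 0) y ≠ 0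
  mem_iff : ∀ y ∈ Metric.ball x R, (y ∈ B.D ↔ 0 ≤ F 0 y)
  lower : ∀ η > 0, ∀ᶠ ε in 𝓝[>] (0 : ℝ), ∀ y ∈ Metric.ball x R, ((-η : ℝ) : EReal) ≤ V ε y
  outside : ∀ w : ℝ, (w : EReal) < e → ∀ η > 0, ∀ᶠ ε in 𝓝[>] (0 : ℝ), ∀ y ∈ Metric.ball x R,
    V ε y ≤ w → -η ≤ F ε y
  force : ∀ w : ℝ, (w : EReal) < e → ∀ᶠ ε in 𝓝[>] (0 : ℝ), ∀ y ∈ Metric.ball x R,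
    V ε y ≤ w → ∃ g : ℝ, 0 ≤ g ∧ -gradient (fun q => (V ε q).toReal) y = g • gradient (F ε) y
  steep : ∀ w₁ w₂ M : ℝ, 0 < w₁ → w₁ < w₂ → (w₂ : EReal) < e → ∀ᶠ ε in 𝓝[>] (0 : ℝ),
    ∀ y ∈ Metric.ball x R, (w₁ : EReal) ≤ V ε y → V ε y ≤ w₂ →
      ∃ g : ℝ, M ≤ g ∧ -gradient (fun q => (V ε q).toReal) y = g • gradient (F ε) y

section Continuity

variable {Q : ℝ → Space d → ℝ} {y : Space d} {l : Filter (ℝ × Space d)}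

theorem tendsto_of_iteratedFDeriv_zero (h : Tendsto
    (fun z : ℝ × Space d => iteratedFDeriv ℝ 0 (Q z.1) z.2) l (𝓝 (iteratedFDeriv ℝ 0 (Q 0) y))) :
    Tendsto (fun z : ℝ × Space d => Q z.1 z.2) l (𝓝 (Q 0 y)) := by
  have := h.eval_const (fun _ => 0)
  simpa only [iteratedFDeriv_zero_apply] using this

theorem tendsto_gradient_of_iteratedFDeriv_one (h : Tendsto
    (fun z : ℝ × Space d => iteratedFDeriv ℝ 1 (Q z.1) z.2) l (𝓝 (iteratedFDeriv ℝ 1 (Q 0) y))) :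
    Tendsto (fun z : ℝ × Space d => gradient (Q z.1) z.2) l (𝓝 (gradient (Q 0) y)) := by
  have h1 : ∀ (f : Space d → ℝ) x, gradient f x = (InnerProductSpace.toDual ℝ (Space d)).symm
      (continuousMultilinearCurryFin1 ℝ (Space d) ℝ (iteratedFDeriv ℝ 1 f x)) := by
    intro f x
    rw [gradient]
    congr 1
    ext v
    rw [continuousMultilinearCurryFin1_apply, iteratedFDeriv_one_apply]
    simp [Fin.snoc]
  simp only [h1]
  exact (((InnerProductSpace.toDual ℝ (Space d)).symm.continuous.comp
    (continuousMultilinearCurryFin1 ℝ (Space d) ℝ).continuous).tendsto _).comp h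

theorem tendsto_hessian_of_iteratedFDeriv_two {k : Filter ℝ} (h : Tendsto
    (fun z : ℝ × Space d => iteratedFDeriv ℝ 2 (Q z.1) z.2) (k ×ˢ 𝓝 y)
      (𝓝 (iteratedFDeriv ℝ 2 (Q 0) y))) (v : Space d) :
    Tendsto (fun z : ℝ × Space d × Space d => fderiv ℝ (fderiv ℝ (Q z.1)) z.2.1 z.2.2 z.2.2)
      (k ×ˢ 𝓝 (y, v)) (𝓝 (fderiv ℝ (fderiv ℝ (Q 0)) y v v)) := by
  have h1 : ∀ (f : Space d → ℝ) x v, fderiv ℝ (fderiv ℝ f) x v v =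
      iteratedFDeriv ℝ 2 f x (fun _ => v) := by
    intro f x v
    rw [iteratedFDeriv_two_apply]
  simp only [h1]
  have h2 : Tendsto (fun z : ℝ × Space d × Space d => (z.1, z.2.1)) (k ×ˢ 𝓝 (y, v)) (k ×ˢ 𝓝 y) := by
    rw [nhds_prod_eq]
    exact tendsto_fst.prodMk (tendsto_fst.comp tendsto_snd)
  have h3 : Tendsto (fun z : ℝ × Space d × Space d => z.2.2) (k ×ˢ 𝓝 (y, v)) (𝓝 v) := by
    rw [nhds_prod_eq]
    exact tendsto_snd.comp tendsto_snd
  have h4 : Continuous fun z : (Space d [×2]→L[ℝ] ℝ) × Space d => z.1 fun _ => z.2 := by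
    have h5 : Continuous fun z : (Space d [×2]→L[ℝ] ℝ) × (Fin 2 → Space d) => z.1 z.2 := by fun_prop
    exact h5.comp (continuous_fst.prodMk (continuous_pi fun _ => continuous_snd))
  exact (h4.tendsto (iteratedFDeriv ℝ 2 (Q 0) y, v)).comp ((h.comp h2).prodMk_nhds h3)

end Continuity

end SteepBilliard

namespace SteepBilliard

/-! ### Existence of boundary charts -/

variable {d r : ℕ} {ι : Type} {B : Table d r ι}

theorem gradient_comp {f : ℝ → ℝ} {F : Space d → ℝ} {y : Space d} {f' : ℝ}
    (hf : HasDerivAt f f' (F y)) (hF : DifferentiableAt ℝ F y) :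
    gradient (fun q => f (F q)) y = f' • gradient F y := by
  have h := (hf.comp_hasFDerivAt y hF.hasFDerivAt).fderiv
  have h' : fderiv ℝ (fun q => f (F q)) y = f' • fderiv ℝ F y := h
  simp [gradient, h']

theorem gradient_sub_const (f : Space d → ℝ) (c : ℝ) :
    gradient (fun q => f q - c) = gradient f := by
  funext y
  rw [gradient, gradient, fderiv_sub_const]

theorem BoundaryLayer.isBarrier {N : Set (Space d)} (L : BoundaryLayer B N) (hL : ConditionIIc L)
    (i : ι) {ε : ℝ} (hε : ε ∈ Ioc 0 L.ε₀) : IsBarrier L.width (L.W i ε) :=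
  { ne_bot := L.W_ne_bot i ε hε
    continuousOn := L.continuousOn_W i ε hε
    contDiffOn := (L.contDiffOn_W i ε hε).of_le (by exact_mod_cast (by omega : 1 ≤ r + 1))
    deriv_ne := (hL i).2 ε hε }

/-- Conditions I-IV provide a boundary chart at every boundary point that is not a corner. -/
theorem exists_isBoundaryChart (hr : 1 ≤ r) {V : ℝ → Space d → EReal} {E : ι → EReal}
    (hcond : ConditionsItoIV B V E) {e : EReal} (he : 0 < e) (heE : ∀ i, e ≤ E i) {x : Space d}
    (hx : x ∈ frontier B.D) (hxc : x ∉ B.corner) :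
    ∃ R F, IsBoundaryChart B V e x R F := by
  rw [B.frontier_eq, mem_iUnion] at hx
  obtain ⟨i, hxi⟩ := hx
  -- the conditions are used outside the complement of the single point `x`
  obtain ⟨L, hIIa, hIIb, hIIc, hIII, hIV⟩ := hcond.2 {x}ᶜ isOpen_compl_singleton
    fun y hy hyx => hxc (mem_singleton_iff.1 hyx ▸ hy)
  have hxn : x ∈ L.nbhd i := L.subset_nbhd i ⟨hxi, fun h => h rfl⟩
  have hr2 : (2 : WithTop ℕ∞) ≤ ((r + 1 : ℕ) : WithTop ℕ∞) := by
    exact_mod_cast (by omega : 2 ≤ r + 1)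
  set F : ℝ → Space d → ℝ := fun ε q => L.Q ε q - L.level i
  have hgradF : ∀ ε, gradient (F ε) = gradient (L.Q ε) := fun ε => gradient_sub_const _ _
  have hfderivF : ∀ ε, fderiv ℝ (F ε) = fderiv ℝ (L.Q ε) := fun ε => by
    funext y
    exact fderiv_sub_const _
  have hQ : ∀ k ≤ 2, ∀ y ∈ L.nbhd i, Tendsto
      (fun z : ℝ × Space d => iteratedFDeriv ℝ k (L.Q z.1) z.2) (𝓝[Ici 0] 0 ×ˢ 𝓝 y)
        (𝓝 (iteratedFDeriv ℝ k (L.Q 0) y)) := by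
    intro k hk y hy
    have h1 := L.continuousOn_Q i k (by omega) (0, y) ⟨⟨le_rfl, L.ε₀_pos.le⟩, hy⟩
    rwa [ContinuousWithinAt, nhdsWithin_prod_eq, nhdsWithin_Icc_eq_nhdsGE L.ε₀_pos,
      (L.isOpen_nbhd i).nhdsWithin_eq hy] at h1
  have htendsto : ∀ y ∈ L.nbhd i,
      Tendsto (fun z : ℝ × Space d => F z.1 z.2) (𝓝[Ici 0] 0 ×ˢ 𝓝 y) (𝓝 (F 0 y)) := fun y hy =>
    (tendsto_of_iteratedFDeriv_zero (hQ 0 (by norm_num) y hy)).sub_const _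
  have hzero : F 0 x = 0 := sub_eq_zero.2 ((hIIa i).1 x ⟨hxi, hxn⟩)
  have hw : 0 < L.width := L.width_pos
  -- a ball in which `|F ε|` is less than half of the width of the layer
  have hball : ∃ R > 0, Metric.ball x R ⊆ L.nbhd i ∩ B.cornerᶜ ∧
      ∀ᶠ ε in 𝓝[Ici 0] (0 : ℝ), ∀ y ∈ Metric.ball x R, |F ε y| < L.width / 2 := by
    have h1 : Tendsto (fun z : ℝ × Space d => |F z.1 z.2|) (𝓝[Ici 0] 0 ×ˢ 𝓝 x) (𝓝 0) := by
      have := (htendsto x hxn).abs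
      rwa [hzero, abs_zero] at this
    obtain ⟨P, hP, P', hP', hPP⟩ := eventually_prod_iff.1
      (h1.eventually (gt_mem_nhds (half_pos hw)))
    have h2 : ∀ᶠ y in 𝓝 x, P' y ∧ y ∈ L.nbhd i ∩ B.cornerᶜ :=
      hP'.and (((L.isOpen_nbhd i).inter B.isClosed_corner.isOpen_compl).mem_nhds ⟨hxn, hxc⟩)
    obtain ⟨R, hR, hRsub⟩ := Metric.eventually_nhds_iff_ball.1 h2
    exact ⟨R, hR, fun y hy => (hRsub y hy).2, hP.mono fun ε hε y hy => hPP hε (hRsub y hy).1⟩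
  obtain ⟨R, hR, hsub, hwidth⟩ := hball
  have hsubn : ∀ y ∈ Metric.ball x R, y ∈ L.nbhd i := fun y hy => (hsub hy).1
  have hpos : 𝓝[>] (0 : ℝ) ≤ 𝓝[Ici 0] 0 := nhdsWithin_mono _ fun s hs => mem_Ici.2 (le_of_lt (mem_Ioi.1 hs))
  have hε₀ : ∀ᶠ ε in 𝓝[>] (0 : ℝ), ε ∈ Ioc 0 L.ε₀ := Ioc_mem_nhdsGT L.ε₀_pos
  have hb : -L.width < -(L.width / 2) := by linarith
  have hVW : ∀ ε ∈ Ioc 0 L.ε₀, ∀ y ∈ L.nbhd i, V ε y = L.W i ε (F ε y) := hIIb i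
  have hleft : ∀ η > 0, η < L.width → ∀ w : ℝ, (w : EReal) < e →
      ∀ᶠ ε in 𝓝[>] (0 : ℝ), (w : EReal) < L.W i ε (-η) := fun η hη hηw w hwe =>
    ((hIII i).2.2 (-η) ⟨by linarith, by linarith⟩).eventually (lt_mem_nhds (hwe.trans_le (heE i)))
  have hgrad : ∀ ε ∈ Ioc 0 L.ε₀, ∀ y ∈ Metric.ball x R, |F ε y| < L.width / 2 → V ε y ≠ ⊤ →
      -gradient (fun q => (V ε q).toReal) y =
        (-deriv (fun x => (L.W i ε x).toReal) (F ε y)) • gradient (F ε) y := by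
    intro ε hε y hy hFy hfin
    have hFw : F ε y ∈ Ioo (-L.width) L.width := by
      rw [abs_lt] at hFy
      exact ⟨by linarith [hFy.1], by linarith [hFy.2]⟩
    have h1 : (fun q => (V ε q).toReal) =ᶠ[𝓝 y] fun q => (L.W i ε (F ε q)).toReal := by
      filter_upwards [(L.isOpen_nbhd i).mem_nhds (hsubn y hy)] with q hq
      rw [hVW ε hε q hq]
    have h2 : gradient (fun q => (V ε q).toReal) y =
        gradient (fun q => (L.W i ε (F ε q)).toReal) y := by
      rw [gradient, gradient, h1.fderiv_eq]
    have h3 : DifferentiableAt ℝ (F ε) y :=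
      (((L.contDiffOn_Q i ε ⟨hε.1.le, hε.2⟩).contDiffAt
        ((L.isOpen_nbhd i).mem_nhds (hsubn y hy))).differentiableAt
          (by exact_mod_cast (by omega : r + 1 ≠ 0))).sub_const _
    rw [hVW ε hε y (hsubn y hy)] at hfin
    have h4 := (((L.isBarrier hIIc i hε).contDiffAt hFw hfin).differentiableAt
      one_ne_zero).hasDerivAt
    rw [h2, gradient_comp h4 h3, neg_smul]
  have hforce : ∀ w : ℝ, (w : EReal) < e → ∀ᶠ ε in 𝓝[>] (0 : ℝ), ∀ y ∈ Metric.ball x R,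
      V ε y ≤ w → deriv (fun x => (L.W i ε x).toReal) (F ε y) < 0 := by
    intro w hwe
    filter_upwards [hε₀, hpos hwidth, hleft (L.width / 2) (by linarith) (by linarith) w hwe]
      with ε hε hεw hεl y hy hVy
    rw [hVW ε hε y (hsubn y hy)] at hVy
    have := abs_lt.1 (hεw y hy)
    exact (L.isBarrier hIIc i hε).deriv_neg hb this.1 (by linarith) hεl hVy
  refine ⟨R, F, ⟨hR, fun y hy => (hsub hy).2, ?_, fun y hy => htendsto y (hsubn y hy), ?_, ?_, hzero,
    ?_, ?_, ?_, ?_, ?_, ?_⟩⟩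
  · filter_upwards [Icc_mem_nhdsGE L.ε₀_pos] with ε hε
    exact (((L.contDiffOn_Q i ε hε).of_le hr2).sub contDiffOn_const).mono hsubn
  · intro y hy
    simp only [hgradF]
    exact tendsto_gradient_of_iteratedFDeriv_one (hQ 1 (by norm_num) y (hsubn y hy))
  · intro y hy v
    simp only [hfderivF]
    exact tendsto_hessian_of_iteratedFDeriv_two (hQ 2 le_rfl y (hsubn y hy)) v
  · intro y hy
    rw [hgradF]
    exact (hIIc i).1 0 ⟨le_rfl, L.ε₀_pos.le⟩ y (hsubn y hy)
  · intro y hy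
    rw [(hIIa i).2 y (hsubn y hy), ← sub_nonneg]
  · intro η hη
    obtain ⟨w, hw0, hwe⟩ := EReal.lt_iff_exists_real_btwn.1 he
    have h1 : ∀ᶠ ε in 𝓝[>] (0 : ℝ), ((-η : ℝ) : EReal) < L.W i ε (L.width / 2) :=
      ((hIII i).2.1 (L.width / 2) ⟨by linarith, by linarith⟩).eventually
        (lt_mem_nhds (by exact_mod_cast neg_neg_of_pos hη))
    filter_upwards [hε₀, hpos hwidth, hleft (L.width / 2) (by linarith) (by linarith) w hwe, h1]
      with ε hε hεw hεl hε1 y hy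
    have hFy := abs_lt.1 (hεw y hy)
    rw [hVW ε hε y (hsubn y hy)]
    rcases le_or_gt (L.W i ε (F ε y)) w with h | h
    · exact hε1.le.trans ((L.isBarrier hIIc i hε).le_of_le hb hFy.1 hFy.2.le (by linarith) hεl h)
    · refine le_trans ?_ h.le
      exact le_trans (by exact_mod_cast neg_nonpos.2 hη.le) hw0.le
  · intro w hwe η hη
    set η' := min η (L.width / 2)
    have hη' : 0 < η' := lt_min hη (by linarith)
    have hη'w : η' ≤ L.width / 2 := min_le_right _ _
    filter_upwards [hε₀, hpos hwidth, hleft (L.width / 2) (by linarith) (by linarith) w hwe,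
      hleft η' hη' (by linarith) w hwe] with ε hε hεw hεl hεl' y hy hVy
    have hFy := abs_lt.1 (hεw y hy)
    rw [hVW ε hε y (hsubn y hy)] at hVy
    refine le_trans (neg_le_neg (min_le_left η (L.width / 2))) ?_
    by_contra! hlt
    exact absurd (((L.isBarrier hIIc i hε).le_of_le hb hFy.1 hlt.le (by linarith) hεl hVy).trans
      hVy) (not_le.2 hεl')
  · intro w hwe
    filter_upwards [hε₀, hpos hwidth, hforce w hwe] with ε hε hεw hf y hy hVy
    exact ⟨_, (neg_pos.2 (hf y hy hVy)).le, hgrad ε hε y hy (hεw y hy)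
      (hVy.trans_lt (EReal.coe_lt_top w)).ne⟩
  · intro w₁ w₂ M hw₁ hw₁₂ hw₂e
    obtain ⟨w₃, hw₂₃, hw₃⟩ := EReal.lt_iff_exists_real_btwn.1 hw₂e
    have hw₂₃' : w₂ < w₃ := by exact_mod_cast hw₂₃
    obtain ⟨I, hI⟩ := hIV i
    obtain ⟨hI1, hI2⟩ := hI (w₁ / 2) w₃ (by linarith) (by linarith) (hw₃.trans_le (heE i))
    have hM : 0 < max M 1 := lt_of_lt_of_le one_pos (le_max_right _ _)
    have hI3 := Metric.tendstoUniformlyOn_iff.1 (hI2 1 (by omega)) (max M 1)⁻¹ (inv_pos.2 hM)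
    filter_upwards [hε₀, hpos hwidth, hforce w₂ hw₂e, hI1, hI3]
      with ε hε hεw hf hI1 hI3 y hy hVy₁ hVy₂
    refine ⟨_, ?_, hgrad ε hε y hy (hεw y hy) (hVy₂.trans_lt (EReal.coe_lt_top w₂)).ne⟩
    have hneg := hf y hy hVy₂
    rw [hVW ε hε y (hsubn y hy)] at hVy₁ hVy₂
    have hFy := abs_lt.1 (hεw y hy)
    have := (L.isBarrier hIIc i hε).lt_abs_deriv (I := I ε) (w₁ := w₁ / 2) (w₂ := w₃) hM
      (fun w hw x hx => ((hI1 w hw).2 x hx).1)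
      (fun w hw => by
        have := hI3 w hw
        rwa [Pi.zero_apply, iteratedDeriv_one, dist_zero_left, Real.norm_eq_abs] at this)
      (x := F ε y) ⟨by linarith [hFy.1], by linarith [hFy.2]⟩
      (lt_of_lt_of_le (by exact_mod_cast (by linarith : w₁ / 2 < w₁)) hVy₁)
      (hVy₂.trans_lt hw₂₃)
    rw [abs_of_neg hneg] at this
    exact (le_max_left _ _).trans this.le

/-! ### Geometry in a boundary chart -/

namespace IsBoundaryChart

variable {V : ℝ → Space d → EReal} {e : EReal} {x : Space d} {R : ℝ} {F : ℝ → Space d → ℝ}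

theorem contDiffAt (h : IsBoundaryChart B V e x R F) {y : Space d} (hy : y ∈ Metric.ball x R) :
    ContDiffAt ℝ 2 (F 0) y :=
  (h.contDiffOn.self_of_nhdsWithin (mem_Ici.2 le_rfl)).contDiffAt (Metric.isOpen_ball.mem_nhds hy)

theorem continuousAt (h : IsBoundaryChart B V e x R F) {y : Space d} (hy : y ∈ Metric.ball x R) :
    ContinuousAt (F 0) y := (h.contDiffAt hy).continuousAt

theorem mem_interior (h : IsBoundaryChart B V e x R F) {y : Space d} (hy : y ∈ Metric.ball x R)
    (hF : 0 < F 0 y) : y ∈ interior B.D := by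
  rw [mem_interior_iff_mem_nhds]
  filter_upwards [Metric.isOpen_ball.mem_nhds hy,
    (h.continuousAt hy).eventually (lt_mem_nhds hF)] with z hz hz'
  exact (h.mem_iff z hz).2 hz'.le

theorem isDefiningFunction (h : IsBoundaryChart B V e x R F) {y : Space d}
    (hy : y ∈ Metric.ball x R) (hF : F 0 y = 0) : IsDefiningFunction 2 B.D (F 0) y where
  contDiffAt := h.contDiffAt hy
  zero := hF
  gradient_ne := h.gradient_ne y hy
  mem_iff := by
    filter_upwards [Metric.isOpen_ball.mem_nhds hy] with z hz
    exact h.mem_iff z hz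

theorem isInwardNormal (h : IsBoundaryChart B V e x R F) {y : Space d}
    (hy : y ∈ Metric.ball x R) (hF : F 0 y = 0) :
    IsInwardNormal B.D y (‖gradient (F 0) y‖⁻¹ • gradient (F 0) y) :=
  ⟨F 0, h.isDefiningFunction hy hF, rfl⟩

theorem mem_frontier (h : IsBoundaryChart B V e x R F) {y : Space d}
    (hy : y ∈ Metric.ball x R) (hF : F 0 y = 0) : y ∈ frontier B.D := by
  refine ⟨subset_closure ((h.mem_iff y hy).2 hF.ge), fun hi => ?_⟩
  -- a direction opposite to the gradient leaves the table
  set w := -gradient (F 0) y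
  have h1 : ∀ᶠ s in 𝓝[>] (0 : ℝ), y + s • w ∈ B.D := by
    have hc : ContinuousAt (fun s : ℝ => y + s • w) 0 := by fun_prop
    have h2 : ∀ᶠ s in 𝓝 (0 : ℝ), y + s • w ∈ interior B.D :=
      hc.eventually (isOpen_interior.mem_nhds (by simpa using hi))
    exact nhdsWithin_le_nhds (h2.mono fun s hs => interior_subset hs)
  have h2 := (h.isDefiningFunction hy hF).inner_nonneg (by norm_num) h1
  rw [inner_neg_right, real_inner_self_eq_norm_sq] at h2
  have : 0 < ‖gradient (F 0) y‖ := norm_pos_iff.2 (h.gradient_ne y hy)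
  nlinarith

theorem pos_of_mem_interior (h : IsBoundaryChart B V e x R F) {y : Space d}
    (hy : y ∈ Metric.ball x R) (hi : y ∈ interior B.D) : 0 < F 0 y := by
  refine ((h.mem_iff y hy).1 (interior_subset hi)).lt_of_ne fun h0 => ?_
  exact (h.mem_frontier hy h0.symm).2 hi

end IsBoundaryChart

end SteepBilliard

namespace SteepBilliard

/-! ### Limits of Hamiltonian trajectories along an ultrafilter -/

variable {d r : ℕ} {ι : Type} {B : Table d r ι}

theorem IsHamiltonianTrajectory.hasDerivWithinAt_Ici {V : Space d → EReal} {S : ℝ}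
    {q p : ℝ → Space d} (h : IsHamiltonianTrajectory V S q p) {t : ℝ} (ht : t ∈ Ico 0 S) :
    HasDerivWithinAt q (p t) (Ici t) t ∧
      HasDerivWithinAt p (-gradient (fun x => (V x).toReal) (q t)) (Ici t) t := by
  obtain ⟨-, h1, h2⟩ := h.2 t ⟨ht.1, ht.2.le⟩
  exact ⟨(h1.mono (Icc_subset_Icc_left ht.1)).mono_of_mem_nhdsWithin (Icc_mem_nhdsGE ht.2),
    (h2.mono (Icc_subset_Icc_left ht.1)).mono_of_mem_nhdsWithin (Icc_mem_nhdsGE ht.2)⟩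

/-- A trajectory in a ball where the potential is bounded below has bounded speed, and cannot leave
the ball quickly. -/
theorem IsHamiltonianTrajectory.norm_sub_le_of_lower {V : Space d → EReal} (hV : IsC2Potential V)
    {x : Space d} {R C η s : ℝ} (hC : 0 ≤ C)
    (hlow : ∀ y ∈ Metric.ball x R, ((-η : ℝ) : EReal) ≤ V y) {q p : ℝ → Space d}
    (h : IsHamiltonianTrajectory V s q p)
    (hE : ‖p 0‖ ^ 2 / 2 + (V (q 0)).toReal + η < C ^ 2 / 2) (hs : dist (q 0) x + C * s < R) :
    ∀ t ∈ Icc 0 s, ‖q t - q 0‖ ≤ C * t ∧ ‖p t‖ ≤ C := by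
  have hspeed : ∀ t ∈ Icc 0 s, ‖q t - q 0‖ ≤ C * t → ‖p t‖ < C := by
    intro t ht hqt
    have hball : q t ∈ Metric.ball x R := by
      rw [Metric.mem_ball]
      have h1 := dist_triangle (q t) (q 0) x
      rw [dist_eq_norm (q t) (q 0)] at h1
      have h2 : C * t ≤ C * s := mul_le_mul_of_nonneg_left ht.2 hC
      linarith
    have h1 := h.energy hV t ht
    have h2 : -η ≤ (V (q t)).toReal := by
      have := EReal.toReal_le_toReal (hlow _ hball) (EReal.coe_ne_bot _) (h.2 t ht).1
      simpa using this
    exact (sq_lt_sq₀ (norm_nonneg _) hC).1 (by linarith)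
  have hq : ∀ t ∈ Icc 0 s, ‖q t - q 0‖ ≤ C * t := by
    refine image_norm_le_of_norm_deriv_right_lt_deriv_boundary (f := fun t => q t - q 0)
      (f' := p) (B' := fun _ => C) (h.continuousOn_q.sub continuousOn_const)
      (fun t ht => (h.hasDerivWithinAt_Ici ht).1.sub_const _) (by simp)
      (fun t => by simpa using (hasDerivAt_id t).const_mul C) fun t ht hft => ?_
    exact hspeed t ⟨ht.1, ht.2.le⟩ hft.le
  exact fun t ht => ⟨hq t ht, (hspeed t ht (hq t ht)).le⟩

/-- If the potential is bounded below in a ball, then trajectories with energy below `C² / 2` exist as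
long as the speed `C` does not allow them to leave the ball. -/
theorem exists_trajectory_of_lower {V : Space d → EReal} (hV : IsC2Potential V)
    {x : Space d} {R C η S : ℝ} (hC : 0 ≤ C) (hS : 0 ≤ S)
    (hlow : ∀ y ∈ Metric.ball x R, ((-η : ℝ) : EReal) ≤ V y) {ρ : Phase d} (hρ : V ρ.1 ≠ ⊤)
    (hE : ‖ρ.2‖ ^ 2 / 2 + (V ρ.1).toReal + η < C ^ 2 / 2) (hs : dist ρ.1 x + C * S < R) :
    ∃ q p : ℝ → Space d, (q 0, p 0) = ρ ∧ IsHamiltonianTrajectory V S q p ∧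
      ∀ t ∈ Icc 0 S, ‖q t - q 0‖ ≤ C * t ∧ ‖p t‖ ≤ C := by
  obtain ⟨H, hH⟩ : ∃ H, H = ‖ρ.2‖ ^ 2 / 2 + (V ρ.1).toReal := ⟨_, rfl⟩
  -- by conservation of energy the solution cannot approach the set where `V = ⊤`
  set K : Set (Phase d) := (Metric.closedBall x R ×ˢ Metric.closedBall 0 C) ∩ {z | V z.1 ≤ (H : ℝ)}
  have hK : IsCompact K := by
    refine ((isCompact_closedBall x R).prod (isCompact_closedBall 0 C)).inter_right ?_
    exact isClosed_le (hV.continuous.comp continuous_fst) continuous_const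
  have hap : ∀ s ∈ Icc 0 S, ∀ q p : ℝ → Space d, (q 0, p 0) = ρ → IsHamiltonianTrajectory V s q p →
      ∀ t ∈ Icc 0 s, (q t, p t) ∈ K := by
    intro s hs' q p h0 h t ht
    have hq0 : q 0 = ρ.1 := congrArg Prod.fst h0
    have hp0 : p 0 = ρ.2 := congrArg Prod.snd h0
    have hCs : C * s ≤ C * S := mul_le_mul_of_nonneg_left hs'.2 hC
    obtain ⟨h1, h2⟩ := h.norm_sub_le_of_lower hV hC hlow (by rw [hq0, hp0]; exact hE)
      (by rw [hq0]; linarith) t ht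
    refine ⟨⟨?_, by simpa using h2⟩, ?_⟩
    · show dist (q t) x ≤ R
      have h3 := dist_triangle (q t) (q 0) x
      rw [dist_eq_norm (q t) (q 0)] at h3
      have h4 : C * t ≤ C * s := mul_le_mul_of_nonneg_left ht.2 hC
      rw [hq0] at h3 h1
      linarith
    · have h3 := h.energy hV t ht
      rw [hp0, hq0] at h3
      show V (q t) ≤ (H : ℝ)
      rw [← EReal.coe_toReal (h.2 t ht).1 (hV.ne_bot _), EReal.coe_le_coe_iff]
      have : 0 ≤ ‖p t‖ ^ 2 := sq_nonneg _
      linarith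
  have hρK : ρ ∈ K := by
    refine ⟨⟨?_, ?_⟩, ?_⟩
    · rw [Metric.mem_closedBall]
      have := mul_nonneg hC hS
      linarith
    · have hlow' : -η ≤ (V ρ.1).toReal := by
        have hb : ρ.1 ∈ Metric.ball x R := by
          rw [Metric.mem_ball]
          have := mul_nonneg hC hS
          linarith
        have := EReal.toReal_le_toReal (hlow _ hb) (EReal.coe_ne_bot _) hρ
        simpa using this
      rw [mem_closedBall_zero_iff]
      exact ((sq_lt_sq₀ (norm_nonneg _) hC).1 (by linarith)).le
    · show V ρ.1 ≤ (H : ℝ)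
      rw [← EReal.coe_toReal hρ (hV.ne_bot _), EReal.coe_le_coe_iff]
      have : 0 ≤ ‖ρ.2‖ ^ 2 := sq_nonneg _
      linarith
  obtain ⟨q, p, h0, h⟩ := exists_trajectory_of_apriori hV hK
    (fun z hz => (lt_of_le_of_lt hz.2 (EReal.coe_lt_top _)).ne) hS hρK hap
  refine ⟨q, p, h0, h, h.norm_sub_le_of_lower hV hC hlow ?_ ?_⟩
  · rw [← h0] at hE; exact hE
  · rw [← h0] at hs; exact hs

/-- A family of Hamiltonian trajectories of bounded speed on `[0, S]`, for parameters `ε z → 0+`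
along an ultrafilter, together with its pointwise limit `(q₀, p₀)`. -/
structure LimitFamily {α : Type*} (V : ℝ → Space d → EReal) (𝓤 : Ultrafilter α) (ε : α → ℝ)
    (q p : α → ℝ → Space d) (S C : ℝ) (q₀ p₀ : ℝ → Space d) : Prop where
  tendsto_ε : Tendsto ε 𝓤 (𝓝[>] 0)
  isC2 : ∀ᶠ z in (𝓤 : Filter α), IsC2Potential (V (ε z))
  traj : ∀ᶠ z in (𝓤 : Filter α), IsHamiltonianTrajectory (V (ε z)) S (q z) (p z)
  speed : ∀ᶠ z in (𝓤 : Filter α), ∀ t ∈ Icc 0 S, ‖p z t‖ ≤ C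
  tendsto_q : ∀ t ∈ Icc 0 S, Tendsto (fun z => q z t) 𝓤 (𝓝 (q₀ t))
  tendsto_p : ∀ t ∈ Icc 0 S, Tendsto (fun z => p z t) 𝓤 (𝓝 (p₀ t))

/-- Bounded functions converge along ultrafilters. -/
theorem exists_ultrafilter_limit {α : Type*} {𝓤 : Ultrafilter α} {f : α → Space d} {y : Space d}
    {C : ℝ} (h : ∀ᶠ z in (𝓤 : Filter α), f z ∈ Metric.closedBall y C) :
    ∃ l, Tendsto f 𝓤 (𝓝 l) := by
  obtain ⟨l, -, hl⟩ := (isCompact_closedBall y C).ultrafilter_le_nhds (𝓤.map f)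
    (by rw [le_principal_iff]; exact h)
  exact ⟨l, hl⟩

theorem norm_sub_le_of_norm_deriv_le {f f' : ℝ → Space d} {s t C : ℝ} (hst : s ≤ t)
    (hf : ContinuousOn f (Icc s t)) (hf' : ∀ u ∈ Ico s t, HasDerivWithinAt f (f' u) (Ici u) u)
    (hC : ∀ u ∈ Ico s t, ‖f' u‖ ≤ C) : ‖f t - f s‖ ≤ C * (t - s) :=
  norm_image_sub_le_of_norm_deriv_right_le_segment hf hf' hC t ⟨hst, le_rfl⟩

namespace LimitFamily

variable {α : Type*} {V : ℝ → Space d → EReal} {𝓤 : Ultrafilter α} {ε : α → ℝ}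
  {q p : α → ℝ → Space d} {S C : ℝ} {q₀ p₀ : ℝ → Space d}

theorem lipschitz (h : LimitFamily V 𝓤 ε q p S C q₀ p₀) : ∀ᶠ z in (𝓤 : Filter α),
    ∀ s ∈ Icc 0 S, ∀ t ∈ Icc 0 S, ‖q z t - q z s‖ ≤ C * |t - s| := by
  filter_upwards [h.traj, h.speed] with z hz hC
  have key : ∀ s ∈ Icc 0 S, ∀ t ∈ Icc 0 S, s ≤ t → ‖q z t - q z s‖ ≤ C * (t - s) := by
    intro s hs t ht hst
    refine norm_sub_le_of_norm_deriv_le hst (hz.continuousOn_q.mono (Icc_subset_Icc hs.1 ht.2))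
      (fun u hu => (hz.hasDerivWithinAt_Ici ⟨hs.1.trans hu.1, hu.2.trans_le ht.2⟩).1)
      fun u hu => hC u ⟨hs.1.trans hu.1, hu.2.le.trans ht.2⟩
  intro s hs t ht
  rcases le_total s t with hst | hst
  · rw [abs_of_nonneg (sub_nonneg.2 hst)]; exact key s hs t ht hst
  · rw [norm_sub_rev, abs_sub_comm, abs_of_nonneg (sub_nonneg.2 hst)]; exact key t ht s hs hst

theorem limit_lipschitz (h : LimitFamily V 𝓤 ε q p S C q₀ p₀) {s t : ℝ} (hs : s ∈ Icc 0 S)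
    (ht : t ∈ Icc 0 S) : ‖q₀ t - q₀ s‖ ≤ C * |t - s| := by
  refine le_of_tendsto ((h.tendsto_q t ht).sub (h.tendsto_q s hs)).norm ?_
  filter_upwards [h.lipschitz] with z hz using hz s hs t ht

theorem continuousOn (h : LimitFamily V 𝓤 ε q p S C q₀ p₀) : ContinuousOn q₀ (Icc 0 S) := by
  intro s hs
  rw [ContinuousWithinAt, tendsto_iff_norm_sub_tendsto_zero]
  have h1 : Tendsto (fun t => C * |t - s|) (𝓝[Icc 0 S] s) (𝓝 0) := by
    have : ContinuousAt (fun t => C * |t - s|) s := by fun_prop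
    simpa [ContinuousAt] using this.mono_left (nhdsWithin_le_nhds (s := Icc 0 S))
  refine squeeze_zero' (Eventually.of_forall fun _ => norm_nonneg _) ?_ h1
  filter_upwards [self_mem_nhdsWithin] with t ht using h.limit_lipschitz hs ht

/-- The convergence is uniform in time. -/
theorem uniform (h : LimitFamily V 𝓤 ε q p S C q₀ p₀) {θ : ℝ} (hθ : 0 < θ) :
    ∀ᶠ z in (𝓤 : Filter α), ∀ t ∈ Icc 0 S, ‖q z t - q₀ t‖ < θ := by
  by_contra hcon
  rw [← Ultrafilter.eventually_not] at hcon
  have hcon' : ∀ᶠ z in (𝓤 : Filter α), ∃ t ∈ Icc 0 S, θ ≤ ‖q z t - q₀ t‖ :=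
    hcon.mono fun z hz => by push Not at hz; exact hz
  obtain ⟨T, hT⟩ := hcon'.choice
  obtain ⟨t, ht, hlim⟩ := (isCompact_Icc (a := (0 : ℝ)) (b := S)).ultrafilter_le_nhds (𝓤.map T)
    (by rw [le_principal_iff]; exact hT.mono fun z hz => hz.1)
  have hlim' : Tendsto T 𝓤 (𝓝 t) := hlim
  have h1 : Tendsto (fun z => C * |T z - t| + ‖q z t - q₀ t‖ + C * |t - T z|) 𝓤 (𝓝 0) := by
    have e1 : Tendsto (fun z => C * |T z - t|) 𝓤 (𝓝 (C * |t - t|)) :=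
      ((hlim'.sub_const t).abs).const_mul C
    have e2 : Tendsto (fun z => C * |t - T z|) 𝓤 (𝓝 (C * |t - t|)) :=
      ((hlim'.const_sub t).abs).const_mul C
    have e3 := tendsto_iff_norm_sub_tendsto_zero.1 (h.tendsto_q t ht)
    simpa using (e1.add e3).add e2
  obtain ⟨z, hz1, hz2, hz3⟩ :=
    ((h1.eventually (gt_mem_nhds hθ)).and (hT.and h.lipschitz)).exists
  have e1 := hz3 t ht (T z) hz2.1
  have e2 := h.limit_lipschitz hz2.1 ht
  have e3 : ‖q z (T z) - q₀ (T z)‖ ≤ ‖q z (T z) - q z t‖ + ‖q z t - q₀ t‖ + ‖q₀ t - q₀ (T z)‖ := by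
    have : q z (T z) - q₀ (T z) = (q z (T z) - q z t) + (q z t - q₀ t) + (q₀ t - q₀ (T z)) := by
      abel
    rw [this]
    exact norm_add₃_le
  linarith [hz2.2]

theorem nonneg_speed (h : LimitFamily V 𝓤 ε q p S C q₀ p₀) (hS : 0 ≤ S) : 0 ≤ C := by
  obtain ⟨z, hz⟩ := h.speed.exists
  exact (norm_nonneg _).trans (hz 0 ⟨le_rfl, hS⟩)

/-- As long as the limit path is in the interior of the table, it is a free motion. -/
theorem free (h : LimitFamily V 𝓤 ε q p S C q₀ p₀) (hI : ConditionI B V) {a b : ℝ} (ha : 0 ≤ a)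
    (hb : b ≤ S) (hin : ∀ t ∈ Icc a b, q₀ t ∈ interior B.D) :
    ∀ t ∈ Icc a b, p₀ t = p₀ a ∧ q₀ t = q₀ a + (t - a) • p₀ a := by
  intro t ht
  have hab : Icc a b ⊆ Icc 0 S := Icc_subset_Icc ha hb
  have haS : a ∈ Icc 0 S := hab ⟨le_rfl, ht.1.trans ht.2⟩
  have htS : t ∈ Icc 0 S := hab ht
  have hK0 : IsCompact (q₀ '' Icc a b) := isCompact_Icc.image_of_continuousOn (h.continuousOn.mono hab)
  obtain ⟨δ, hδ, hδD⟩ := hK0.exists_cthickening_subset_open isOpen_interior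
    (by rintro _ ⟨u, hu, rfl⟩; exact hin u hu)
  have hforce : ∀ η > 0, ∀ᶠ z in (𝓤 : Filter α), ‖p z t - p z a‖ ≤ η * (t - a) ∧
      ‖q z t - q z a - (t - a) • p z a‖ ≤ η * (t - a) * (t - a) := by
    intro η hη
    filter_upwards [h.traj, h.uniform hδ,
      h.tendsto_ε.eventually (hI.eventually_small hK0.cthickening hδD hη)] with z hz hzδ hzη
    have hp : ∀ u ∈ Icc a t, ‖p z u - p z a‖ ≤ η * (u - a) := by
      intro u hu
      refine norm_sub_le_of_norm_deriv_le hu.1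
        (hz.continuousOn_p.mono (Icc_subset_Icc ha (hu.2.trans htS.2)))
        (fun w hw => (hz.hasDerivWithinAt_Ici
          ⟨ha.trans hw.1, hw.2.trans_le (hu.2.trans htS.2)⟩).2) fun w hw => ?_
      rw [norm_neg]
      have hwb : w ∈ Icc a b := ⟨hw.1, hw.2.le.trans (hu.2.trans ht.2)⟩
      refine (hzη _ (Metric.mem_cthickening_of_dist_le _ _ _ _ (mem_image_of_mem q₀ hwb) ?_)).2.2.le
      rw [dist_eq_norm]
      exact (hzδ w (hab hwb)).le
    refine ⟨hp t ⟨ht.1, le_rfl⟩, ?_⟩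
    have h2 := norm_sub_le_of_norm_deriv_le (f := fun u => q z u - (u - a) • p z a)
      (f' := fun u => p z u - p z a) (C := η * (t - a)) ht.1
      ((hz.continuousOn_q.mono (Icc_subset_Icc ha htS.2)).sub (by fun_prop)) (fun u hu => ?_)
      fun u hu => (hp u ⟨hu.1, hu.2.le⟩).trans
        (mul_le_mul_of_nonneg_left (by linarith [hu.2]) hη.le)
    · have e : q z t - q z a - (t - a) • p z a =
          (q z t - (t - a) • p z a) - (q z a - (a - a) • p z a) := by
        simp only [sub_self, zero_smul, sub_zero]; abel
      rw [e]
      exact h2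
    · have e1 := (hz.hasDerivWithinAt_Ici ⟨ha.trans hu.1, hu.2.trans_le htS.2⟩).1
      have e2 : HasDerivWithinAt (fun u : ℝ => (u - a) • p z a) (p z a) (Ici u) u := by
        simpa using ((hasDerivWithinAt_id u (Ici u)).sub_const a).smul_const (p z a)
      exact e1.sub e2
  have hpt := h.tendsto_p t htS
  have hpa := h.tendsto_p a haS
  have hqt := h.tendsto_q t htS
  have hqa := h.tendsto_q a haS
  have hzero : ∀ {y : Space d} {c : ℝ}, (∀ η > 0, ‖y‖ ≤ η * c) → y = 0 := by
    intro y c hy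
    have h1 : Tendsto (fun η : ℝ => η * c) (𝓝[>] 0) (𝓝 0) := by
      have : ContinuousAt (fun η : ℝ => η * c) 0 := by fun_prop
      simpa [ContinuousAt] using this.mono_left (nhdsWithin_le_nhds (s := Ioi 0))
    refine norm_le_zero_iff.1 (ge_of_tendsto h1 ?_)
    filter_upwards [self_mem_nhdsWithin] with η hη using hy η hη
  constructor
  · refine sub_eq_zero.1 (hzero (c := t - a) fun η hη => ?_)
    exact le_of_tendsto (hpt.sub hpa).norm ((hforce η hη).mono fun z hz => hz.1)
  · have e : q₀ t - q₀ a - (t - a) • p₀ a = 0 := by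
      refine hzero (c := (t - a) * (t - a)) fun η hη => ?_
      refine le_of_tendsto ((hqt.sub hqa).sub (hpa.const_smul (t - a))).norm ?_
      filter_upwards [hforce η hη] with z hz
      rw [← mul_assoc]
      exact hz.2
    rw [sub_sub, sub_eq_zero] at e
    exact e

/-- A free segment in the interior of the table is followed by the limit path. -/
theorem eq_of_free_segment (h : LimitFamily V 𝓤 ε q p S C q₀ p₀) (hI : ConditionI B V) {c b : ℝ}
    (hc : 0 ≤ c) (hb : b ≤ S)
    (hin : ∀ u ∈ Icc 0 (b - c), q₀ c + u • p₀ c ∈ interior B.D) :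
    ∀ t ∈ Icc c b, p₀ t = p₀ c ∧ q₀ t = q₀ c + (t - c) • p₀ c := by
  have hq : ∀ u ∈ Icc 0 (b - c), q₀ (c + u) = q₀ c + u • p₀ c := by
    have hcont : ∀ u ∈ Icc 0 (b - c), ContinuousWithinAt (fun u => q₀ (c + u)) (Icc 0 (b - c)) u := by
      intro u hu
      refine ContinuousWithinAt.comp (t := Icc 0 S)
        (h.continuousOn (c + u) ⟨by linarith [hu.1], by linarith [hu.2]⟩) (by fun_prop) ?_
      exact fun w hw => ⟨by linarith [hw.1], by linarith [hw.2]⟩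
    refine real_induction (by simp) ?_ ?_
    · intro u hu hw
      have h1 : EqOn (fun u => q₀ (c + u)) (fun u => q₀ c + u • p₀ c) (Ico 0 u) := hw
      refine h1.of_subset_closure (t := Icc 0 u) ?_ (by fun_prop) Ico_subset_Icc_self ?_
        ⟨hu.1.le, le_rfl⟩
      · exact fun w hw => (hcont w ⟨hw.1, hw.2.trans hu.2⟩).mono (Icc_subset_Icc_right hu.2)
      · rw [closure_Ico hu.1.ne]
    · intro u hu hw
      have h1 : ∀ᶠ w in 𝓝[>] u, q₀ (c + w) ∈ interior B.D := by
        have h2 := (hcont u ⟨hu.1, hu.2.le⟩).mono_left (nhdsWithin_le_of_mem (t := Ioi u)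
          (mem_of_superset (Ioo_mem_nhdsGT hu.2) fun w hw => ⟨hu.1.trans (le_of_lt hw.1), le_of_lt hw.2⟩))
        refine h2.eventually (isOpen_interior.mem_nhds ?_)
        simp only
        rw [hw u ⟨hu.1, le_rfl⟩]
        exact hin u ⟨hu.1, hu.2.le⟩
      obtain ⟨s, hs, hsub⟩ := mem_nhdsGT_iff_exists_Ioc_subset.1 h1
      refine ⟨s, hs, fun w hw' hwb => ?_⟩
      have hin' : ∀ t ∈ Icc c (c + w), q₀ t ∈ interior B.D := by
        intro t ht
        have e : t = c + (t - c) := by ring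
        rcases le_or_gt (t - c) u with h' | h'
        · rw [e, hw (t - c) ⟨by linarith [ht.1], h'⟩]
          exact hin _ ⟨by linarith [ht.1], by linarith [hu.2]⟩
        · rw [e]
          exact hsub ⟨h', by linarith [ht.2, hw'.2]⟩
      have := (h.free hI hc (by linarith) hin' (c + w)
        ⟨by linarith [hw'.1, hu.1], le_rfl⟩).2
      rwa [add_sub_cancel_left] at this
  refine h.free hI hc hb fun t ht => ?_
  have e : t = c + (t - c) := by ring
  rw [e, hq (t - c) ⟨by linarith [ht.1], by linarith [ht.2]⟩]
  exact hin _ ⟨by linarith [ht.1], by linarith [ht.2]⟩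

theorem tendsto_potential (h : LimitFamily V 𝓤 ε q p S C q₀ p₀) (hI : ConditionI B V) {t : ℝ}
    (ht : t ∈ Icc 0 S) (hin : q₀ t ∈ interior B.D) :
    Tendsto (fun z => (V (ε z) (q z t)).toReal) 𝓤 (𝓝 0) := by
  obtain ⟨K, hK, hKt, hKD⟩ := exists_compact_subset isOpen_interior hin
  rw [Metric.tendsto_nhds]
  intro η hη
  filter_upwards [(h.tendsto_q t ht).eventually (isOpen_interior.mem_nhds hKt),
    h.tendsto_ε.eventually (hI.eventually_small hK hKD hη)] with z hz hz'
  rw [Real.dist_eq, sub_zero]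
  exact (hz' _ (interior_subset hz)).2.1

/-- The energy of the trajectories tends to the energy of free motion. -/
theorem tendsto_energy (h : LimitFamily V 𝓤 ε q p S C q₀ p₀) (hI : ConditionI B V) (hS : 0 ≤ S)
    (hin : q₀ 0 ∈ interior B.D) :
    Tendsto (fun z => ‖p z 0‖ ^ 2 / 2 + (V (ε z) (q z 0)).toReal) 𝓤 (𝓝 (‖p₀ 0‖ ^ 2 / 2)) := by
  have h0 : (0 : ℝ) ∈ Icc 0 S := ⟨le_rfl, hS⟩
  simpa using (((h.tendsto_p 0 h0).norm.pow 2).div_const 2).add (h.tendsto_potential hI h0 hin)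

theorem energy (h : LimitFamily V 𝓤 ε q p S C q₀ p₀) : ∀ᶠ z in (𝓤 : Filter α), ∀ t ∈ Icc 0 S,
    ‖p z t‖ ^ 2 / 2 + (V (ε z) (q z t)).toReal =
      ‖p z 0‖ ^ 2 / 2 + (V (ε z) (q z 0)).toReal := by
  filter_upwards [h.isC2, h.traj] with z hz hz' using hz'.energy hz

theorem norm_eq (h : LimitFamily V 𝓤 ε q p S C q₀ p₀) (hI : ConditionI B V) {t : ℝ}
    (ht : t ∈ Icc 0 S) (hin0 : q₀ 0 ∈ interior B.D) (hin : q₀ t ∈ interior B.D) :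
    ‖p₀ t‖ = ‖p₀ 0‖ := by
  have h1 := h.tendsto_energy hI (ht.1.trans ht.2) hin0
  have h2 : Tendsto (fun z => ‖p z t‖ ^ 2 / 2 + (V (ε z) (q z t)).toReal) 𝓤
      (𝓝 (‖p₀ t‖ ^ 2 / 2)) := by
    simpa using (((h.tendsto_p t ht).norm.pow 2).div_const 2).add (h.tendsto_potential hI ht hin)
  have h3 := tendsto_nhds_unique (h2.congr' (h.energy.mono fun z hz => hz t ht)) h1
  have h4 : ‖p₀ t‖ ^ 2 = ‖p₀ 0‖ ^ 2 := by linarith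
  exact (pow_left_inj₀ (norm_nonneg _) (norm_nonneg _) two_ne_zero).1 h4

end LimitFamily

end SteepBilliard

namespace SteepBilliard

/-! ### Tangential and normal momentum -/

variable {d r : ℕ} {ι : Type} {B : Table d r ι}

/-- The projection `u ↦ u - ⟨n, u⟩ n` along the unit vector `n`. -/
noncomputable def tangential (n : Space d) : Space d →L[ℝ] Space d :=
  ContinuousLinearMap.id ℝ (Space d) - (innerSL ℝ n).smulRight n

theorem tangential_apply (n u : Space d) : tangential n u = u - inner ℝ n u • n := by
  simp [tangential]

theorem norm_sq_eq_tangential {n : Space d} (hn : ‖n‖ = 1) (u : Space d) :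
    ‖u‖ ^ 2 = ‖tangential n u‖ ^ 2 + inner ℝ n u ^ 2 := by
  rw [tangential_apply, norm_sub_sq_real, inner_smul_right, norm_smul, hn, mul_one,
    Real.norm_eq_abs, sq_abs, real_inner_comm]
  ring

theorem norm_tangential_le {n : Space d} (hn : ‖n‖ = 1) (u : Space d) :
    ‖tangential n u‖ ≤ ‖u‖ := by
  refine (sq_le_sq₀ (norm_nonneg _) (norm_nonneg _)).1 ?_
  rw [norm_sq_eq_tangential hn u]
  linarith [sq_nonneg (inner ℝ n u)]

theorem tangential_self {n : Space d} (hn : ‖n‖ = 1) : tangential n n = 0 := by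
  rw [tangential_apply, real_inner_self_eq_norm_sq, hn]
  simp

theorem abs_inner_le_norm_of_unit {n : Space d} (hn : ‖n‖ = 1) (u : Space d) :
    |inner ℝ n u| ≤ ‖u‖ := by
  have := abs_real_inner_le_norm n u
  rwa [hn, one_mul] at this

theorem add_mul_le_of_le_deriv {f f' : ℝ → ℝ} {c s t : ℝ} (hst : s ≤ t)
    (hf : ContinuousOn f (Icc s t)) (hf' : ∀ u ∈ Ico s t, HasDerivWithinAt f (f' u) (Ici u) u)
    (hc : ∀ u ∈ Ico s t, c ≤ f' u) : f s + c * (t - s) ≤ f t := by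
  refine image_le_of_deriv_right_le_deriv_boundary (f := fun u => f s + c * (u - s))
    (f' := fun _ => c) (by fun_prop) (fun u _ => ?_) (by simp) hf hf' hc ⟨hst, le_rfl⟩
  simpa using (((hasDerivWithinAt_id u (Ici u)).sub_const s).const_mul c).const_add (f s)

theorem quadratic_le_of_le_deriv {f f' : ℝ → ℝ} {b c s t : ℝ} (hst : s ≤ t)
    (hf : ContinuousOn f (Icc s t)) (hf' : ∀ u ∈ Ico s t, HasDerivWithinAt f (f' u) (Ici u) u)
    (hc : ∀ u ∈ Ico s t, b + c * (u - s) ≤ f' u) :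
    f s + b * (t - s) + c / 2 * (t - s) ^ 2 ≤ f t := by
  refine image_le_of_deriv_right_le_deriv_boundary
    (f := fun u => f s + b * (u - s) + c / 2 * (u - s) ^ 2)
    (f' := fun u => b + c * (u - s)) (by fun_prop) (fun u _ => ?_) (by simp) hf hf' hc ⟨hst, le_rfl⟩
  have h1 := (hasDerivWithinAt_id u (Ici u)).sub_const s
  have h2 := ((h1.const_mul b).const_add (f s)).add ((h1.pow 2).const_mul (c / 2))
  refine h2.congr_deriv ?_
  simp
  ring

/-- A force whose direction is nearly constant transfers little momentum in the transversal
directions: the change of the tangential momentum is controlled by that of the normal momentum,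
which is increasing. -/
theorem norm_tangential_sub_le {p p' : ℝ → Space d} {n : Space d} {m η s t : ℝ} (hn : ‖n‖ = 1)
    (hm : 0 < m) (hη : 0 ≤ η) (hηm : η ≤ m / 2) (hst : s ≤ t) (hp : ContinuousOn p (Icc s t))
    (hp' : ∀ u ∈ Ico s t, HasDerivWithinAt p (p' u) (Ici u) u)
    (hforce : ∀ u ∈ Ico s t, ∃ g : ℝ, 0 ≤ g ∧ ∃ G, ‖G - m • n‖ ≤ η ∧ p' u = g • G) :
    inner ℝ n (p s) ≤ inner ℝ n (p t) ∧
      ‖tangential n (p t) - tangential n (p s)‖ ≤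
        2 * η / m * (inner ℝ n (p t) - inner ℝ n (p s)) := by
  have hnd : ∀ u ∈ Ico s t, HasDerivWithinAt (fun u => inner ℝ n (p u)) (inner ℝ n (p' u))
      (Ici u) u := fun u hu => (innerSL ℝ n).hasFDerivAt.comp_hasDerivWithinAt u (hp' u hu)
  have hnc : ContinuousOn (fun u => inner ℝ n (p u)) (Icc s t) :=
    (innerSL ℝ n).continuous.comp_continuousOn hp
  have hbound : ∀ u ∈ Ico s t, 0 ≤ inner ℝ n (p' u) ∧
      ‖tangential n (p' u)‖ ≤ 2 * η / m * inner ℝ n (p' u) := by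
    intro u hu
    obtain ⟨g, hg, G, hG, hpG⟩ := hforce u hu
    have h1 : inner ℝ n G = m + inner ℝ n (G - m • n) := by
      rw [inner_sub_right, inner_smul_right, real_inner_self_eq_norm_sq, hn]
      ring
    have h2 := (abs_le.1 ((abs_inner_le_norm_of_unit hn (G - m • n)).trans hG)).1
    have h3 : m / 2 ≤ inner ℝ n G := by linarith
    have h4 : ‖tangential n G‖ ≤ η := by
      have : tangential n G = tangential n (G - m • n) := by
        rw [map_sub, map_smul, tangential_self hn, smul_zero, sub_zero]
      rw [this]
      exact (norm_tangential_le hn _).trans hG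
    rw [hpG, inner_smul_right, map_smul, norm_smul, Real.norm_of_nonneg hg]
    refine ⟨mul_nonneg hg (by linarith), ?_⟩
    have h5 : η ≤ 2 * η / m * inner ℝ n G := by
      have : 2 * η / m * (m / 2) = η := by field_simp
      calc η = 2 * η / m * (m / 2) := this.symm
        _ ≤ _ := by gcongr
    calc g * ‖tangential n G‖ ≤ g * (2 * η / m * inner ℝ n G) := by
          gcongr
          exact h4.trans h5
      _ = _ := by ring
  constructor
  · have := add_mul_le_of_le_deriv hst hnc hnd fun u hu => (hbound u hu).1
    linarith
  · refine image_norm_le_of_norm_deriv_right_le_deriv_boundary'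
      (f := fun u => tangential n (p u) - tangential n (p s))
      (f' := fun u => tangential n (p' u))
      (B := fun u => 2 * η / m * (inner ℝ n (p u) - inner ℝ n (p s)))
      (B' := fun u => 2 * η / m * inner ℝ n (p' u)) ?_ (fun u hu => ?_) (by simp) ?_
      (fun u hu => ?_) (fun u hu => (hbound u hu).2) ⟨hst, le_rfl⟩
    · exact ((tangential n).continuous.comp_continuousOn hp).sub continuousOn_const
    · exact ((tangential n).hasFDerivAt.comp_hasDerivWithinAt u (hp' u hu)).sub_const _
    · exact (hnc.sub continuousOn_const).const_smul (2 * η / m)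
    · exact ((hnd u hu).sub_const _).const_mul _

/-! ### The limit of the Hamiltonian flow at a collision -/

/-- A family of Hamiltonian trajectories in a boundary chart at `x`, whose limit moves freely with
momentum `v` until it hits the boundary in `x` at the time `a`. -/
structure CollisionFamily {α : Type*} (B : Table d r ι) (V : ℝ → Space d → EReal) (e : EReal)
    (x : Space d) (R : ℝ) (F : ℝ → Space d → ℝ) (𝓤 : Ultrafilter α) (ε : α → ℝ)
    (q p : α → ℝ → Space d) (S C : ℝ) (q₀ p₀ : ℝ → Space d) (a : ℝ) (v : Space d) : Prop
    extends LimitFamily V 𝓤 ε q p S C q₀ p₀ where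
  chart : IsBoundaryChart B V e x R F
  condI : ConditionI B V
  time_mem : a ∈ Ioo 0 S
  before : ∀ t ∈ Ico 0 a, q₀ t ∈ interior B.D ∧ q₀ t = x + (t - a) • v ∧ p₀ t = v
  hit : q₀ a = x
  mem_ball : ∀ᶠ z in (𝓤 : Filter α), ∀ t ∈ Icc 0 S, q z t ∈ Metric.ball x R
  limit_mem_ball : ∀ t ∈ Icc 0 S, q₀ t ∈ Metric.ball x R
  energy_lt : ((‖v‖ ^ 2 / 2 : ℝ) : EReal) < e

namespace CollisionFamily

variable {α : Type*} {V : ℝ → Space d → EReal} {e : EReal} {x : Space d} {R : ℝ}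
  {F : ℝ → Space d → ℝ} {𝓤 : Ultrafilter α} {ε : α → ℝ} {q p : α → ℝ → Space d} {S C : ℝ}
  {q₀ p₀ : ℝ → Space d} {a : ℝ} {v : Space d}

theorem zero_mem (h : CollisionFamily B V e x R F 𝓤 ε q p S C q₀ p₀ a v) : (0 : ℝ) ∈ Ico 0 a :=
  ⟨le_rfl, h.time_mem.1⟩

theorem tendsto_ε' (h : CollisionFamily B V e x R F 𝓤 ε q p S C q₀ p₀ a v) :
    Tendsto ε 𝓤 (𝓝[Ici 0] 0) :=
  h.tendsto_ε.mono_right (nhdsWithin_mono _ fun _ hs => mem_Ici.2 (le_of_lt (mem_Ioi.1 hs)))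

theorem tendsto_energy' (h : CollisionFamily B V e x R F 𝓤 ε q p S C q₀ p₀ a v) :
    Tendsto (fun z => ‖p z 0‖ ^ 2 / 2 + (V (ε z) (q z 0)).toReal) 𝓤 (𝓝 (‖v‖ ^ 2 / 2)) := by
  have := h.tendsto_energy h.condI (h.time_mem.1.trans h.time_mem.2).le (h.before 0 h.zero_mem).1
  rwa [(h.before 0 h.zero_mem).2.2] at this

theorem potential_le (h : CollisionFamily B V e x R F 𝓤 ε q p S C q₀ p₀ a v) {w : ℝ}
    (hw : ‖v‖ ^ 2 / 2 < w) :
    ∀ᶠ z in (𝓤 : Filter α), ∀ t ∈ Icc 0 S, V (ε z) (q z t) ≤ w := by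
  filter_upwards [h.energy, h.isC2, h.traj, h.tendsto_energy'.eventually (gt_mem_nhds hw)]
    with z h1 h2 h3 h4 t ht
  rw [← EReal.coe_toReal (h3.2 t ht).1 (h2.ne_bot _), EReal.coe_le_coe_iff]
  have := h1 t ht
  have : 0 ≤ ‖p z t‖ ^ 2 := sq_nonneg _
  linarith

theorem exists_cap (h : CollisionFamily B V e x R F 𝓤 ε q p S C q₀ p₀ a v) :
    ∃ w : ℝ, ‖v‖ ^ 2 / 2 < w ∧ (w : EReal) < e := by
  obtain ⟨w, h1, h2⟩ := EReal.lt_iff_exists_real_btwn.1 h.energy_lt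
  exact ⟨w, by exact_mod_cast h1, h2⟩

theorem norm_sq_le (h : CollisionFamily B V e x R F 𝓤 ε q p S C q₀ p₀ a v) {η : ℝ} (hη : 0 < η) :
    ∀ᶠ z in (𝓤 : Filter α), ∀ t ∈ Icc 0 S, ‖p z t‖ ^ 2 ≤ ‖v‖ ^ 2 + η := by
  filter_upwards [h.energy, h.isC2, h.traj, h.mem_ball,
    h.tendsto_energy'.eventually (gt_mem_nhds (by linarith : ‖v‖ ^ 2 / 2 < ‖v‖ ^ 2 / 2 + η / 4)),
    h.tendsto_ε.eventually (h.chart.lower (η / 4) (by linarith))] with z h1 h2 h3 h4 h5 h6 t ht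
  have e1 := h1 t ht
  have e2 := EReal.toReal_le_toReal (h6 _ (h4 t ht)) (EReal.coe_ne_bot _) (h3.2 t ht).1
  rw [EReal.toReal_coe] at e2
  linarith

/-- The limit path stays in the table. -/
theorem limit_nonneg (h : CollisionFamily B V e x R F 𝓤 ε q p S C q₀ p₀ a v) {t : ℝ}
    (ht : t ∈ Icc 0 S) : 0 ≤ F 0 (q₀ t) := by
  obtain ⟨w, hvw, hwe⟩ := h.exists_cap
  have h1 : Tendsto (fun z => F (ε z) (q z t)) 𝓤 (𝓝 (F 0 (q₀ t))) :=
    (h.chart.tendsto _ (h.limit_mem_ball t ht)).comp (h.tendsto_ε'.prodMk (h.tendsto_q t ht))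
  refine le_of_forall_pos_le_add fun η hη => ?_
  have h2 : -η ≤ F 0 (q₀ t) := by
    refine ge_of_tendsto h1 ?_
    filter_upwards [h.potential_le hvw, h.mem_ball,
      h.tendsto_ε.eventually (h.chart.outside w hwe η hη)] with z h3 h4 h5
    exact h5 _ (h4 t ht) (h3 t ht)
  linarith

theorem tendsto_F (h : CollisionFamily B V e x R F 𝓤 ε q p S C q₀ p₀ a v) {t : ℝ}
    (ht : t ∈ Icc 0 S) : Tendsto (fun z => F (ε z) (q z t)) 𝓤 (𝓝 (F 0 (q₀ t))) :=
  (h.chart.tendsto _ (h.limit_mem_ball t ht)).comp (h.tendsto_ε'.prodMk (h.tendsto_q t ht))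

/-- Near the time of the collision the trajectories are near the point of collision. -/
theorem window (h : CollisionFamily B V e x R F 𝓤 ε q p S C q₀ p₀ a v) {Φ : ℝ → Space d → Prop}
    (hΦ : ∀ᶠ y in 𝓝[Ici 0] (0 : ℝ) ×ˢ 𝓝 x, Φ y.1 y.2) :
    ∃ θ > 0, ∀ᶠ z in (𝓤 : Filter α), ∀ t ∈ Icc 0 S, |t - a| < θ → Φ (ε z) (q z t) := by
  obtain ⟨P, hP, P', hP', hPP⟩ := eventually_prod_iff.1 hΦ
  obtain ⟨s, hs, hsP⟩ := Metric.eventually_nhds_iff_ball.1 hP'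
  have haS : a ∈ Icc 0 S := ⟨h.time_mem.1.le, h.time_mem.2.le⟩
  have hC := h.nonneg_speed (haS.1.trans haS.2)
  refine ⟨s / (2 * (C + 1)), by positivity, ?_⟩
  have h1 := tendsto_iff_norm_sub_tendsto_zero.1 (h.hit ▸ h.tendsto_q a haS)
  filter_upwards [h.lipschitz, h.tendsto_ε'.eventually hP, h1.eventually (gt_mem_nhds (half_pos hs))]
    with z hz hzP hz1 t ht hta
  refine hPP hzP (hsP _ ?_)
  rw [mem_ball_iff_norm]
  have h2 := hz a haS t ht
  have h3 : C * |t - a| ≤ s / 2 := by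
    have h4 : C * |t - a| ≤ (C + 1) * (s / (2 * (C + 1))) := by
      gcongr
      linarith
    have h5 : (C + 1) * (s / (2 * (C + 1))) = s / 2 := by field_simp
    linarith
  have h6 := norm_add_le (q z t - q z a) (q z a - x)
  rw [sub_add_sub_cancel] at h6
  linarith

/-- The force, at points where the potential is bounded by an admissible energy. -/
theorem force (h : CollisionFamily B V e x R F 𝓤 ε q p S C q₀ p₀ a v) :
    ∀ᶠ z in (𝓤 : Filter α), ∀ t ∈ Icc 0 S, ∃ g : ℝ, 0 ≤ g ∧
      -gradient (fun y => (V (ε z) y).toReal) (q z t) = g • gradient (F (ε z)) (q z t) := by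
  obtain ⟨w, hvw, hwe⟩ := h.exists_cap
  filter_upwards [h.potential_le hvw, h.mem_ball, h.tendsto_ε.eventually (h.chart.force w hwe)]
    with z h1 h2 h3 t ht
  exact h3 _ (h2 t ht) (h1 t ht)

/-- The normal at the point of collision. -/
noncomputable def normal (F : ℝ → Space d → ℝ) (x : Space d) : Space d :=
  ‖gradient (F 0) x‖⁻¹ • gradient (F 0) x

theorem mem_ball_self (h : CollisionFamily B V e x R F 𝓤 ε q p S C q₀ p₀ a v) :
    x ∈ Metric.ball x R := Metric.mem_ball_self h.chart.pos

theorem norm_gradient_pos (h : CollisionFamily B V e x R F 𝓤 ε q p S C q₀ p₀ a v) :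
    0 < ‖gradient (F 0) x‖ := norm_pos_iff.2 (h.chart.gradient_ne x h.mem_ball_self)

theorem norm_smul_normal (h : CollisionFamily B V e x R F 𝓤 ε q p S C q₀ p₀ a v) :
    ‖gradient (F 0) x‖ • normal F x = gradient (F 0) x :=
  smul_inv_smul₀ h.norm_gradient_pos.ne' _

theorem isInwardNormal (h : CollisionFamily B V e x R F 𝓤 ε q p S C q₀ p₀ a v) :
    IsInwardNormal B.D x (normal F x) := h.chart.isInwardNormal h.mem_ball_self h.chart.zero

theorem norm_normal (h : CollisionFamily B V e x R F 𝓤 ε q p S C q₀ p₀ a v) :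
    ‖normal F x‖ = 1 := h.isInwardNormal.norm_eq_one

theorem window_gradient (h : CollisionFamily B V e x R F 𝓤 ε q p S C q₀ p₀ a v) {η : ℝ}
    (hη : 0 < η) : ∃ θ > 0, ∀ᶠ z in (𝓤 : Filter α), ∀ t ∈ Icc 0 S, |t - a| < θ →
      ‖gradient (F (ε z)) (q z t) - ‖gradient (F 0) x‖ • normal F x‖ < η := by
  refine h.window (Φ := fun s y => ‖gradient (F s) y - ‖gradient (F 0) x‖ • normal F x‖ < η) ?_
  rw [h.norm_smul_normal]
  exact (tendsto_iff_norm_sub_tendsto_zero.1 (h.chart.tendsto_gradient x h.mem_ball_self)).eventually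
    (gt_mem_nhds hη)

/-- Near the time of the collision the normal momentum is increasing, and the change of the
tangential momentum is small. -/
theorem window_momentum (h : CollisionFamily B V e x R F 𝓤 ε q p S C q₀ p₀ a v) {η : ℝ}
    (hη : 0 < η) : ∃ θ > 0, ∀ᶠ z in (𝓤 : Filter α), ∀ s ∈ Icc 0 S, ∀ t ∈ Icc 0 S, s ≤ t →
      |s - a| < θ → |t - a| < θ → inner ℝ (normal F x) (p z s) ≤ inner ℝ (normal F x) (p z t) ∧
        ‖tangential (normal F x) (p z t) - tangential (normal F x) (p z s)‖ ≤ η := by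
  set n := normal F x
  set m := ‖gradient (F 0) x‖
  have hm : 0 < m := h.norm_gradient_pos
  have hC := h.nonneg_speed (h.time_mem.1.trans h.time_mem.2).le
  set η' := min (m / 2) (η * m / (4 * (C + 1)))
  have hη' : 0 < η' := by positivity
  obtain ⟨θ, hθ, hwin⟩ := h.window_gradient hη'
  refine ⟨θ, hθ, ?_⟩
  filter_upwards [hwin, h.force, h.traj, h.speed] with z h1 h2 h3 h4 s hs t ht hst hsa hta
  have hsub : ∀ u ∈ Ico s t, u ∈ Icc 0 S := fun u hu =>
    ⟨hs.1.trans hu.1, hu.2.le.trans ht.2⟩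
  have key := norm_tangential_sub_le (p := p z)
    (p' := fun u => -gradient (fun y => (V (ε z) y).toReal) (q z u)) h.norm_normal hm hη'.le
    (min_le_left _ _) hst (h3.continuousOn_p.mono (Icc_subset_Icc hs.1 ht.2))
    (fun u hu => (h3.hasDerivWithinAt_Ici ⟨hs.1.trans hu.1, hu.2.trans_le ht.2⟩).2) fun u hu => by
      obtain ⟨g, hg, hg'⟩ := h2 u (hsub u hu)
      refine ⟨g, hg, _, (h1 u (hsub u hu) ?_).le, hg'⟩
      rw [abs_lt] at hsa hta ⊢
      exact ⟨by linarith [hu.1], by linarith [hu.2]⟩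
  refine ⟨key.1, key.2.trans ?_⟩
  have e1 := (abs_le.1 ((abs_inner_le_norm_of_unit h.norm_normal (p z t)).trans (h4 t ht))).2
  have e2 := (abs_le.1 ((abs_inner_le_norm_of_unit h.norm_normal (p z s)).trans (h4 s hs))).1
  have e3 : inner ℝ n (p z t) - inner ℝ n (p z s) ≤ 2 * (C + 1) := by linarith
  calc 2 * η' / m * (inner ℝ n (p z t) - inner ℝ n (p z s))
      ≤ 2 * η' / m * (2 * (C + 1)) := by gcongr
    _ ≤ 2 * (η * m / (4 * (C + 1))) / m * (2 * (C + 1)) := by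
        gcongr
        exact min_le_right _ _
    _ = η := by field_simp; ring

/-- Conservation of the tangential momentum in the limit. -/
theorem window_tangential (h : CollisionFamily B V e x R F 𝓤 ε q p S C q₀ p₀ a v) {η : ℝ}
    (hη : 0 < η) : ∃ θ > 0, ∀ᶠ z in (𝓤 : Filter α), ∀ t ∈ Icc 0 S, |t - a| < θ →
      ‖tangential (normal F x) (p z t) - tangential (normal F x) v‖ ≤ η := by
  obtain ⟨θ, hθ, hwin⟩ := h.window_momentum (half_pos hη)
  refine ⟨θ, hθ, ?_⟩
  set s := max 0 (a - θ / 2)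
  have hsa : s < a := max_lt h.time_mem.1 (by linarith)
  have hs0 : 0 ≤ s := le_max_left _ _
  have hsS : s ∈ Icc 0 S := ⟨hs0, hsa.le.trans h.time_mem.2.le⟩
  have hsθ : |s - a| < θ := by
    rw [abs_lt]
    exact ⟨by linarith [le_max_right 0 (a - θ / 2)], by linarith⟩
  have h1 : Tendsto (fun z => tangential (normal F x) (p z s)) 𝓤
      (𝓝 (tangential (normal F x) v)) := by
    have := h.tendsto_p s hsS
    rw [(h.before s ⟨hs0, hsa⟩).2.2] at this
    exact ((tangential (normal F x)).continuous.tendsto _).comp this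
  filter_upwards [hwin, (tendsto_iff_norm_sub_tendsto_zero.1 h1).eventually
    (gt_mem_nhds (half_pos hη))] with z hz hz1 t ht hta
  have h2 : ‖tangential (normal F x) (p z t) - tangential (normal F x) (p z s)‖ ≤ η / 2 := by
    rcases le_total s t with hst | hst
    · exact (hz s hsS t ht hst hsθ hta).2
    · rw [norm_sub_rev]
      exact (hz t ht s hsS hst hta hsθ).2
  have h3 := norm_add_le (tangential (normal F x) (p z t) - tangential (normal F x) (p z s))
    (tangential (normal F x) (p z s) - tangential (normal F x) v)
  rw [sub_add_sub_cancel] at h3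
  linarith

/-- The defining function along a trajectory. -/
theorem hasDerivWithinAt_F (h : CollisionFamily B V e x R F 𝓤 ε q p S C q₀ p₀ a v) :
    ∀ᶠ z in (𝓤 : Filter α), ContinuousOn (fun t => F (ε z) (q z t)) (Icc 0 S) ∧
      ∀ t ∈ Ico 0 S, HasDerivWithinAt (fun t => F (ε z) (q z t))
        (inner ℝ (gradient (F (ε z)) (q z t)) (p z t)) (Ici t) t := by
  filter_upwards [h.traj, h.mem_ball, h.tendsto_ε'.eventually h.chart.contDiffOn] with z h1 h2 h3
  have h4 : ∀ t ∈ Icc 0 S, HasFDerivAt (F (ε z)) (fderiv ℝ (F (ε z)) (q z t)) (q z t) :=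
    fun t ht => ((h3.contDiffAt (Metric.isOpen_ball.mem_nhds (h2 t ht))).differentiableAt
      (by norm_num)).hasFDerivAt
  refine ⟨fun t ht => ?_, fun t ht => ?_⟩
  · exact (h4 t ht).continuousAt.comp_continuousWithinAt (h1.continuousOn_q t ht)
  · rw [inner_gradient]
    exact (h4 t ⟨ht.1, ht.2.le⟩).comp_hasDerivWithinAt t (h1.hasDerivWithinAt_Ici ht).1

end CollisionFamily

end SteepBilliard

namespace SteepBilliard

variable {d r : ℕ} {ι : Type} {B : Table d r ι}

namespace CollisionFamily

variable {α : Type*} {V : ℝ → Space d → EReal} {e : EReal} {x : Space d} {R : ℝ}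
  {F : ℝ → Space d → ℝ} {𝓤 : Ultrafilter α} {ε : α → ℝ} {q p : α → ℝ → Space d} {S C : ℝ}
  {q₀ p₀ : ℝ → Space d} {a : ℝ} {v : Space d}

theorem mem_Icc (h : CollisionFamily B V e x R F 𝓤 ε q p S C q₀ p₀ a v) : a ∈ Icc 0 S :=
  ⟨h.time_mem.1.le, h.time_mem.2.le⟩

theorem tendsto_gradient_F (h : CollisionFamily B V e x R F 𝓤 ε q p S C q₀ p₀ a v) {t : ℝ}
    (ht : t ∈ Icc 0 S) : Tendsto (fun z => inner ℝ (gradient (F (ε z)) (q z t)) (p z t)) 𝓤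
      (𝓝 (inner ℝ (gradient (F 0) (q₀ t)) (p₀ t))) :=
  ((h.chart.tendsto_gradient _ (h.limit_mem_ball t ht)).comp
    (h.tendsto_ε'.prodMk (h.tendsto_q t ht))).inner (h.tendsto_p t ht)

/-! ### Tangencies -/

/-- At a tangency the momentum does not change: the tangential momentum is conserved, and by
conservation of energy no normal momentum can be created. -/
theorem window_momentum_of_tangent (h : CollisionFamily B V e x R F 𝓤 ε q p S C q₀ p₀ a v)
    (hv : inner ℝ (normal F x) v = 0) {η : ℝ} (hη : 0 < η) : ∃ θ > 0, ∀ᶠ z in (𝓤 : Filter α),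
      ∀ t ∈ Icc 0 S, |t - a| < θ → ‖p z t - v‖ < η := by
  set n := normal F x
  set η' := min 1 (η ^ 2 / (4 * (1 + ‖v‖)))
  have hη' : 0 < η' := by positivity
  obtain ⟨θ, hθ, hwin⟩ := h.window_tangential hη'
  refine ⟨θ, hθ, ?_⟩
  filter_upwards [hwin, h.norm_sq_le hη'] with z h1 h2 t ht hta
  have e1 := h1 t ht hta
  have e2 := h2 t ht
  have e3 := norm_sq_eq_tangential h.norm_normal (p z t)
  have e4 := norm_sq_eq_tangential h.norm_normal (p z t - v)
  rw [map_sub, inner_sub_right, hv, sub_zero] at e4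
  have e5 : tangential n v = v := by rw [tangential_apply, hv, zero_smul, sub_zero]
  change ‖tangential n (p z t) - tangential n v‖ ≤ η' at e1
  change ‖p z t - v‖ ^ 2 = ‖tangential n (p z t) - tangential n v‖ ^ 2 + inner ℝ n (p z t) ^ 2 at e4
  change ‖p z t‖ ^ 2 = ‖tangential n (p z t)‖ ^ 2 + inner ℝ n (p z t) ^ 2 at e3
  have e6 : ‖v‖ ≤ ‖tangential n (p z t)‖ + η' := by
    have := norm_sub_norm_le (tangential n v) (tangential n (p z t))
    rw [norm_sub_rev, e5] at this
    rw [e5] at e1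
    linarith
  have e7 : ‖v‖ ^ 2 - 2 * ‖v‖ * η' ≤ ‖tangential n (p z t)‖ ^ 2 := by
    have h3 := norm_nonneg v
    have h4 := norm_nonneg (tangential n (p z t))
    rcases le_total ‖v‖ ‖tangential n (p z t)‖ with h5 | h5
    · nlinarith
    · nlinarith
  have e8 : ‖tangential n (p z t) - tangential n v‖ ^ 2 ≤ η' := by
    have : η' ≤ 1 := min_le_left _ _
    nlinarith [norm_nonneg (tangential n (p z t) - tangential n v)]
  have e9 : 4 * (1 + ‖v‖) * η' ≤ η ^ 2 := by
    have : η' ≤ η ^ 2 / (4 * (1 + ‖v‖)) := min_le_right _ _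
    rw [le_div_iff₀ (by positivity)] at this
    linarith
  refine (sq_lt_sq₀ (norm_nonneg _) hη.le).1 ?_
  have : 0 ≤ ‖v‖ * η' := by positivity
  nlinarith

/-- At a tangency the second derivative of the defining functions in the direction of motion is
continuous along the family. -/
theorem window_hessian (h : CollisionFamily B V e x R F 𝓤 ε q p S C q₀ p₀ a v)
    (hv : inner ℝ (normal F x) v = 0) {c : ℝ} (hc : c < fderiv ℝ (fderiv ℝ (F 0)) x v v) :
    ∃ θ > 0, ∀ᶠ z in (𝓤 : Filter α), ∀ t ∈ Icc 0 S, |t - a| < θ →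
      c ≤ fderiv ℝ (fderiv ℝ (F (ε z))) (q z t) (p z t) (p z t) := by
  have h1 := (h.chart.tendsto_hessian x h.mem_ball_self v).eventually (lt_mem_nhds hc)
  obtain ⟨P, hP, P', hP', hPP⟩ := eventually_prod_iff.1 h1
  rw [nhds_prod_eq] at hP'
  obtain ⟨X, hX, Y, hY, hXY⟩ := eventually_prod_iff.1 hP'
  obtain ⟨s, hs, hsY⟩ := Metric.eventually_nhds_iff_ball.1 hY
  obtain ⟨θ₁, hθ₁, h2⟩ := h.window (Φ := fun _ y => X y) (hX.prod_inr _)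
  obtain ⟨θ₂, hθ₂, h3⟩ := h.window_momentum_of_tangent hv hs
  refine ⟨min θ₁ θ₂, lt_min hθ₁ hθ₂, ?_⟩
  filter_upwards [h2, h3, h.tendsto_ε'.eventually hP] with z h4 h5 h6 t ht hta
  refine (hPP h6 (hXY (h4 t ht (hta.trans_le (min_le_left _ _))) (hsY _ ?_))).le
  rw [mem_ball_iff_norm]
  exact h5 t ht (hta.trans_le (min_le_right _ _))

/-- Near a non-degenerate tangency the defining function is strongly convex along the
trajectories: the force only increases its second derivative. -/
theorem window_convex (h : CollisionFamily B V e x R F 𝓤 ε q p S C q₀ p₀ a v)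
    (hv : inner ℝ (normal F x) v = 0) {c : ℝ} (hc : c < fderiv ℝ (fderiv ℝ (F 0)) x v v) :
    ∃ θ > 0, ∀ᶠ z in (𝓤 : Filter α), ∀ s ∈ Icc 0 S, ∀ t ∈ Icc 0 S, s ≤ t → |s - a| < θ →
      |t - a| < θ → F (ε z) (q z s) + inner ℝ (gradient (F (ε z)) (q z s)) (p z s) * (t - s) +
        c / 2 * (t - s) ^ 2 ≤ F (ε z) (q z t) := by
  obtain ⟨θ, hθ, h1⟩ := h.window_hessian hv hc
  refine ⟨θ, hθ, ?_⟩
  filter_upwards [h1, h.hasDerivWithinAt_F, h.traj, h.force, h.mem_ball,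
    h.tendsto_ε'.eventually h.chart.contDiffOn] with z h1 h2 h3 h4 h5 h6 s hs t ht hst hsa hta
  have hcd : ∀ u ∈ Icc 0 S, ContDiffAt ℝ 2 (F (ε z)) (q z u) := fun u hu =>
    h6.contDiffAt (Metric.isOpen_ball.mem_nhds (h5 u hu))
  have hcd' : ∀ u ∈ Icc 0 S, DifferentiableAt ℝ (fderiv ℝ (F (ε z))) (q z u) := fun u hu =>
    ((hcd u hu).fderiv_right (m := 1) (by norm_num)).differentiableAt one_ne_zero
  have hwin : ∀ u ∈ Icc s t, |u - a| < θ := by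
    intro u hu
    rw [abs_lt] at hsa hta ⊢
    exact ⟨by linarith [hu.1], by linarith [hu.2]⟩
  have hsub : Icc s t ⊆ Icc 0 S := Icc_subset_Icc hs.1 ht.2
  have hY : ∀ u ∈ Icc s t, inner ℝ (gradient (F (ε z)) (q z s)) (p z s) + c * (u - s) ≤
      inner ℝ (gradient (F (ε z)) (q z u)) (p z u) := by
    intro u hu
    rw [inner_gradient, inner_gradient]
    have hsu : Icc s u ⊆ Icc 0 S := (Icc_subset_Icc_right hu.2).trans hsub
    refine add_mul_le_of_le_deriv (f := fun u => fderiv ℝ (F (ε z)) (q z u) (p z u))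
      (f' := fun u => fderiv ℝ (fderiv ℝ (F (ε z))) (q z u) (p z u) (p z u) +
        fderiv ℝ (F (ε z)) (q z u) (-gradient (fun x => (V (ε z) x).toReal) (q z u)))
      hu.1 ?_ (fun w hw => ?_) fun w hw => ?_
    · intro w hw
      exact ((hcd' w (hsu hw)).continuousAt.comp_continuousWithinAt
        ((h3.continuousOn_q w (hsu hw)).mono hsu)).clm_apply
        ((h3.continuousOn_p w (hsu hw)).mono hsu)
    · have hw' : w ∈ Ico 0 S := ⟨hs.1.trans hw.1, hw.2.trans_le (hu.2.trans ht.2)⟩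
      obtain ⟨h7, h8⟩ := h3.hasDerivWithinAt_Ici hw'
      exact ((hcd' w ⟨hw'.1, hw'.2.le⟩).hasFDerivAt.comp_hasDerivWithinAt w h7).clm_apply h8
    · have hw' : w ∈ Icc s t := ⟨hw.1, hw.2.le.trans hu.2⟩
      obtain ⟨g, hg, hg'⟩ := h4 w (hsub hw')
      have h7 : 0 ≤ fderiv ℝ (F (ε z)) (q z w) (-gradient (fun x => (V (ε z) x).toReal) (q z w)) := by
        rw [hg', ← inner_gradient, inner_smul_right, real_inner_self_eq_norm_sq]
        positivity
      linarith [h1 w (hsub hw') (hwin w hw')]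
  exact quadratic_le_of_le_deriv (f := fun u => F (ε z) (q z u)) hst (h2.1.mono hsub)
    (fun u hu => h2.2 u ⟨hs.1.trans hu.1, hu.2.trans_le ht.2⟩) fun u hu => hY u ⟨hu.1, hu.2.le⟩

/-- After a non-degenerate tangency the limit path is in the interior of the table. -/
theorem exists_pos_of_tangent (h : CollisionFamily B V e x R F 𝓤 ε q p S C q₀ p₀ a v)
    (hv : inner ℝ (normal F x) v = 0) (hc : 0 < fderiv ℝ (fderiv ℝ (F 0)) x v v) :
    ∃ θ > 0, ∀ t ∈ Icc 0 S, a < t → t < a + θ → 0 < F 0 (q₀ t) := by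
  set c := fderiv ℝ (fderiv ℝ (F 0)) x v v / 2
  have hc' : 0 < c := half_pos hc
  obtain ⟨θ, hθ, h1⟩ := h.window_convex hv (half_lt_self hc)
  refine ⟨θ, hθ, fun t ht hat hta => ?_⟩
  have h2 : ∀ᶠ s in 𝓝[<] a, F 0 (q₀ s) + inner ℝ (gradient (F 0) (q₀ s)) v * (t - s) +
      c / 2 * (t - s) ^ 2 ≤ F 0 (q₀ t) := by
    filter_upwards [Ioo_mem_nhdsLT (max_lt h.time_mem.1 (by linarith : a - θ < a))] with s hs
    have hs0 : 0 < s := (le_max_left _ _).trans_lt hs.1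
    have hsθ : a - θ < s := (le_max_right _ _).trans_lt hs.1
    have hsS : s ∈ Icc 0 S := ⟨hs0.le, hs.2.le.trans h.mem_Icc.2⟩
    have h3 := (h.before s ⟨hs0.le, hs.2⟩).2.2
    have h4 := h.tendsto_gradient_F hsS
    rw [h3] at h4
    refine le_of_tendsto_of_tendsto (((h.tendsto_F hsS).add (h4.mul_const (t - s))).add_const
      (c / 2 * (t - s) ^ 2)) (h.tendsto_F ht) ?_
    filter_upwards [h1] with z hz
    refine hz s hsS t ht (hs.2.le.trans hat.le) ?_ ?_
    · rw [abs_lt]; exact ⟨by linarith, by linarith [hs.2]⟩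
    · rw [abs_lt]; exact ⟨by linarith, by linarith⟩
  have hq : Tendsto q₀ (𝓝[<] a) (𝓝 x) := by
    have h3 := (h.continuousOn a h.mem_Icc).mono_left (nhdsWithin_le_of_mem (t := Iio a)
      (mem_of_superset (Ioo_mem_nhdsLT h.time_mem.1)
        fun s hs => ⟨le_of_lt hs.1, (le_of_lt hs.2).trans h.mem_Icc.2⟩))
    rwa [h.hit] at h3
  have hgr : Tendsto (fun y => gradient (F 0) y) (𝓝 x) (𝓝 (gradient (F 0) x)) :=
    (h.chart.tendsto_gradient x h.mem_ball_self).comp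
      ((tendsto_const_nhdsWithin (mem_Ici.2 le_rfl)).prodMk tendsto_id)
  have hF := (h.chart.continuousAt h.mem_ball_self).tendsto.comp hq
  rw [h.chart.zero] at hF
  have ht' : Tendsto (fun s => t - s) (𝓝[<] a) (𝓝 (t - a)) :=
    (tendsto_const_nhds.sub tendsto_id).mono_left nhdsWithin_le_nhds
  have hv' : inner ℝ (gradient (F 0) x) v = 0 := by
    rw [← h.norm_smul_normal, inner_smul_left, hv, mul_zero]
  have h5 := (hF.add (((hgr.comp hq).inner (tendsto_const_nhds (x := v))).mul ht')).add
    ((ht'.pow 2).const_mul (c / 2))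
  rw [hv', zero_mul, zero_add, zero_add] at h5
  have h6 : c / 2 * (t - a) ^ 2 ≤ F 0 (q₀ t) := le_of_tendsto h5 h2
  have : 0 < t - a := sub_pos.2 hat
  have : 0 < c / 2 * (t - a) ^ 2 := by positivity
  linarith

/-! ### Regular reflections -/

/-- The rate of change of the defining function is given by the normal momentum. -/
theorem window_rate (h : CollisionFamily B V e x R F 𝓤 ε q p S C q₀ p₀ a v) {κ : ℝ} (hκ : 0 < κ) :
    ∃ θ > 0, ∀ᶠ z in (𝓤 : Filter α), ∀ t ∈ Icc 0 S, |t - a| < θ →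
      |inner ℝ (gradient (F (ε z)) (q z t)) (p z t) -
        ‖gradient (F 0) x‖ * inner ℝ (normal F x) (p z t)| ≤ κ := by
  have hC := h.nonneg_speed (h.time_mem.1.trans h.time_mem.2).le
  obtain ⟨θ, hθ, h1⟩ := h.window_gradient (η := κ / (C + 1)) (by positivity)
  refine ⟨θ, hθ, ?_⟩
  filter_upwards [h1, h.speed] with z h1 h2 t ht hta
  rw [← real_inner_smul_left, ← inner_sub_left]
  refine (abs_real_inner_le_norm _ _).trans ?_
  calc _ ≤ κ / (C + 1) * (C + 1) := by
        gcongr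
        · exact (h1 t ht hta).le
        · linarith [h2 t ht]
    _ = κ := by field_simp

/-- While the potential energy is of the order of the normal kinetic energy, the normal momentum
grows quickly, since the potential is steep there. -/
theorem window_steep (h : CollisionFamily B V e x R F 𝓤 ε q p S C q₀ p₀ a v) {κ : ℝ}
    (hκ : 0 < κ) (hv : 3 * κ ≤ |inner ℝ (normal F x) v|) :
    ∃ θ > 0, ∀ s ∈ Icc 0 S, ∀ t ∈ Icc 0 S, s < t → |s - a| < θ → |t - a| < θ →
      ∀ᶠ z in (𝓤 : Filter α), -(2 * κ) ≤ inner ℝ (normal F x) (p z s) →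
        2 * κ ≤ inner ℝ (normal F x) (p z t) := by
  set n := normal F x
  have hm := h.norm_gradient_pos
  set m := ‖gradient (F 0) x‖
  obtain ⟨w, hw, hwe⟩ := h.exists_cap
  have hκ2 : 9 * κ ^ 2 ≤ inner ℝ n v ^ 2 := by
    have := pow_le_pow_left₀ (by positivity) hv 2
    rw [sq_abs] at this
    linarith
  have hv2 := norm_sq_eq_tangential h.norm_normal v
  change ‖v‖ ^ 2 = ‖tangential n v‖ ^ 2 + inner ℝ n v ^ 2 at hv2
  set η := min 1 (κ ^ 2 / (2 * ‖v‖ + 1))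
  have hη : 0 < η := by positivity
  obtain ⟨θ₁, hθ₁, h1⟩ := h.window_tangential hη
  obtain ⟨θ₂, hθ₂, h2⟩ := h.window_momentum one_pos
  obtain ⟨θ₃, hθ₃, h3⟩ := h.window_gradient (half_pos hm)
  refine ⟨min θ₁ (min θ₂ θ₃), by positivity, fun s hs t ht hst hsa hta => ?_⟩
  have hwin : ∀ u ∈ Icc s t, |u - a| < min θ₁ (min θ₂ θ₃) := by
    intro u hu
    rw [abs_lt] at hsa hta ⊢
    exact ⟨by linarith [hu.1], by linarith [hu.2]⟩
  have hsub : Icc s t ⊆ Icc 0 S := Icc_subset_Icc hs.1 ht.2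
  have hlow : κ ^ 2 < w := by
    nlinarith [sq_nonneg ‖tangential n v‖]
  have hts : 0 < t - s := sub_pos.2 hst
  filter_upwards [h1, h2, h3, h.traj, h.mem_ball, h.potential_le hw, h.energy, h.isC2,
    h.tendsto_energy'.eventually (lt_mem_nhds (by linarith [pow_pos hκ 2] :
      ‖v‖ ^ 2 / 2 - κ ^ 2 / 2 < ‖v‖ ^ 2 / 2)),
    h.tendsto_ε.eventually (h.chart.steep (κ ^ 2) w (8 * κ / (m * (t - s))) (by positivity) hlow hwe)]
    with z h1 h2 h3 h4 h5 h6 h7 h8 h9 h10 hps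
  by_contra! hpt
  -- as the normal momentum is increasing, it would be in `[-2κ, 2κ]` on the whole interval
  have hp : ∀ u ∈ Icc s t, inner ℝ n (p z u) ^ 2 ≤ (2 * κ) ^ 2 := by
    intro u hu
    have hθ2 : ∀ u ∈ Icc s t, |u - a| < θ₂ := fun u hu =>
      (hwin u hu).trans_le ((min_le_right _ _).trans (min_le_left _ _))
    have e1 := (h2 s hs u (hsub hu) hu.1 (hθ2 s ⟨le_rfl, hst.le⟩) (hθ2 u hu)).1
    have e2 := (h2 u (hsub hu) t ht hu.2 (hθ2 u hu) (hθ2 t ⟨hst.le, le_rfl⟩)).1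
    exact sq_le_sq' (hps.trans e1) (e2.trans hpt.le)
  -- then the missing normal kinetic energy, at least `(9 - 4) κ² / 2` in the limit, is potential
  have hpot : ∀ u ∈ Icc s t, ((κ ^ 2 : ℝ) : EReal) ≤ V (ε z) (q z u) := by
    intro u hu
    rw [← EReal.coe_toReal (h4.2 u (hsub hu)).1 (h8.ne_bot _), EReal.coe_le_coe_iff]
    have e1 := h7 u (hsub hu)
    have e2 := norm_sq_eq_tangential h.norm_normal (p z u)
    have e3 : ‖tangential n (p z u)‖ ≤ ‖tangential n v‖ + η := by
      have e4 := h1 u (hsub hu) ((hwin u hu).trans_le (min_le_left _ _))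
      linarith [norm_sub_norm_le (tangential n (p z u)) (tangential n v)]
    have e4 : ‖tangential n (p z u)‖ ^ 2 ≤ ‖tangential n v‖ ^ 2 + κ ^ 2 := by
      have e5 : η ≤ 1 := min_le_left _ _
      have e6 : η * (2 * ‖v‖ + 1) ≤ κ ^ 2 := by
        rw [← le_div_iff₀ (by positivity)]
        exact min_le_right _ _
      have e7 : ‖tangential n v‖ ≤ ‖v‖ := norm_tangential_le h.norm_normal v
      calc ‖tangential n (p z u)‖ ^ 2 ≤ (‖tangential n v‖ + η) ^ 2 := by gcongr
        _ ≤ _ := by nlinarith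
    have e5 := hp u hu
    change ‖p z u‖ ^ 2 = ‖tangential n (p z u)‖ ^ 2 + inner ℝ n (p z u) ^ 2 at e2
    nlinarith
  -- the force is so large that the normal momentum grows by `4κ`
  have hgrow := add_mul_le_of_le_deriv (f := fun u => inner ℝ n (p z u))
    (f' := fun u => inner ℝ n (-gradient (fun x => (V (ε z) x).toReal) (q z u)))
    (c := 4 * κ / (t - s)) hst.le
    ((innerSL ℝ n).continuous.comp_continuousOn (h4.continuousOn_p.mono hsub))
    (fun u hu => (innerSL ℝ n).hasFDerivAt.comp_hasDerivWithinAt u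
      (h4.hasDerivWithinAt_Ici ⟨hs.1.trans hu.1, hu.2.trans_le ht.2⟩).2) fun u hu => ?_
  · have : 4 * κ / (t - s) * (t - s) = 4 * κ := by field_simp
    simp only [this] at hgrow
    linarith
  · have hu' : u ∈ Icc s t := ⟨hu.1, hu.2.le⟩
    obtain ⟨g, hg, hg'⟩ := h10 _ (h5 u (hsub hu')) (hpot u hu') (h6 u (hsub hu'))
    rw [hg', inner_smul_right]
    have e1 := (h3 u (hsub hu')
      ((hwin u hu').trans_le ((min_le_right _ _).trans (min_le_right _ _)))).le
    have e2 : inner ℝ n (gradient (F (ε z)) (q z u)) =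
        m + inner ℝ n (gradient (F (ε z)) (q z u) - m • n) := by
      rw [inner_sub_right, inner_smul_right, real_inner_self_eq_norm_sq, h.norm_normal]
      ring
    have e3 := (abs_le.1 ((abs_inner_le_norm_of_unit h.norm_normal
      (gradient (F (ε z)) (q z u) - m • n)).trans e1)).1
    have e4 : m / 2 ≤ inner ℝ n (gradient (F (ε z)) (q z u)) := by linarith
    calc 4 * κ / (t - s) = 8 * κ / (m * (t - s)) * (m / 2) := by field_simp; ring
      _ ≤ g * (m / 2) := by gcongr
      _ ≤ _ := by
        gcongr
        exact le_trans (by positivity) hg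

/-- After a regular reflection the limit path is in the interior of the table. -/
theorem exists_pos_of_regular (h : CollisionFamily B V e x R F 𝓤 ε q p S C q₀ p₀ a v)
    (hv : inner ℝ (normal F x) v < 0) :
    ∃ θ > 0, ∀ t ∈ Icc 0 S, a < t → t < a + θ → 0 < F 0 (q₀ t) := by
  set n := normal F x
  have hm := h.norm_gradient_pos
  set m := ‖gradient (F 0) x‖
  obtain ⟨κ, hκ, hκv⟩ : ∃ κ > 0, 3 * κ ≤ |inner ℝ n v| :=
    ⟨|inner ℝ n v| / 3, by have := abs_pos.2 hv.ne; positivity, by linarith⟩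
  obtain ⟨θ₁, hθ₁, h1⟩ := h.window_rate (κ := m * κ / 2) (by positivity)
  obtain ⟨θ₂, hθ₂, h2⟩ := h.window_momentum one_pos
  obtain ⟨θ₃, hθ₃, h3⟩ := h.window_steep hκ hκv
  refine ⟨min θ₁ (min θ₂ θ₃), by positivity, ?_⟩
  have hlt : ∀ {t}, a ≤ t → t < a + min θ₁ (min θ₂ θ₃) → |t - a| < θ₁ ∧ |t - a| < θ₂ ∧ |t - a| < θ₃ := by
    intro t hat hta
    rw [abs_of_nonneg (sub_nonneg.2 hat), ← lt_min_iff, ← lt_min_iff]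
    linarith
  have hnp : ∀ t ∈ Icc 0 S, Tendsto (fun z => inner ℝ n (p z t)) 𝓤 (𝓝 (inner ℝ n (p₀ t))) :=
    fun t ht => (tendsto_const_nhds (x := n)).inner (h.tendsto_p t ht)
  -- otherwise the limit path would leave the table
  have hD1 : ∀ t ∈ Icc 0 S, a < t → t < a + min θ₁ (min θ₂ θ₃) → -κ ≤ inner ℝ n (p₀ t) := by
    intro t ht hat hta
    by_contra! hlt'
    have hts : 0 < t - a := sub_pos.2 hat
    have h4 : ∀ᶠ z in (𝓤 : Filter α),
        F (ε z) (q z t) ≤ F (ε z) (q z a) - m * κ / 2 * (t - a) := by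
      filter_upwards [h1, h2, h.hasDerivWithinAt_F, (hnp t ht).eventually (gt_mem_nhds hlt')]
        with z h1 h2 h3 h4
      have h5 := add_mul_le_of_le_deriv (f := fun u => -F (ε z) (q z u))
        (f' := fun u => -inner ℝ (gradient (F (ε z)) (q z u)) (p z u)) (c := m * κ / 2) hat.le
        (h3.1.neg.mono (Icc_subset_Icc h.mem_Icc.1 ht.2))
        (fun u hu => (h3.2 u ⟨h.mem_Icc.1.trans hu.1, hu.2.trans_le ht.2⟩).neg) fun u hu => ?_
      · linarith
      · have hu' : u ∈ Icc 0 S := ⟨h.mem_Icc.1.trans hu.1, hu.2.le.trans ht.2⟩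
        have hu1 := hlt hu.1 (hu.2.trans hta)
        have e1 := (abs_le.1 (h1 u hu' hu1.1)).2
        have e2 := (h2 u hu' t ht hu.2.le hu1.2.1 (hlt hat.le hta).2.1).1
        have e3 : m * inner ℝ n (p z u) ≤ m * (-κ) := by
          gcongr
          exact e2.trans h4.le
        linarith
    have h5 := le_of_tendsto_of_tendsto (h.tendsto_F ht)
      ((h.tendsto_F h.mem_Icc).sub_const (m * κ / 2 * (t - a))) h4
    rw [h.hit, h.chart.zero] at h5
    have h6 := h.limit_nonneg ht
    have : 0 < m * κ / 2 * (t - a) := by positivity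
    linarith
  -- the potential is steep: the normal momentum becomes positive at once
  have hD2 : ∀ t ∈ Icc 0 S, a < t → t < a + min θ₁ (min θ₂ θ₃) → 2 * κ ≤ inner ℝ n (p₀ t) := by
    intro t ht hat hta
    have hs : (a + t) / 2 ∈ Icc 0 S := ⟨by linarith [h.mem_Icc.1], by linarith [ht.2]⟩
    have h4 := hD1 _ hs (by linarith) (by linarith)
    refine ge_of_tendsto (hnp t ht) ?_
    filter_upwards [h3 _ hs t ht (by linarith) (hlt (by linarith) (by linarith)).2.2
      (hlt hat.le hta).2.2, (hnp _ hs).eventually (lt_mem_nhds (by linarith :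
        -(2 * κ) < inner ℝ n (p₀ ((a + t) / 2))))] with z h5 h6
    exact h5 h6.le
  intro t ht hat hta
  have hs : (a + t) / 2 ∈ Icc 0 S := ⟨by linarith [h.mem_Icc.1], by linarith [ht.2]⟩
  have hs' : (a + t) / 2 < a + min θ₁ (min θ₂ θ₃) := by linarith
  have hst : 0 < t - (a + t) / 2 := by linarith
  have h4 : ∀ᶠ z in (𝓤 : Filter α),
      F (ε z) (q z ((a + t) / 2)) + m * κ / 2 * (t - (a + t) / 2) ≤ F (ε z) (q z t) := by
    filter_upwards [h1, h2, h.hasDerivWithinAt_F, (hnp _ hs).eventually (lt_mem_nhds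
      (by linarith [hD2 _ hs (by linarith) hs'] : κ < inner ℝ n (p₀ ((a + t) / 2))))]
      with z h1 h2 h3 h4
    refine add_mul_le_of_le_deriv (f := fun u => F (ε z) (q z u)) (by linarith)
      (h3.1.mono (Icc_subset_Icc hs.1 ht.2))
      (fun u hu => h3.2 u ⟨hs.1.trans hu.1, hu.2.trans_le ht.2⟩) fun u hu => ?_
    have hu' : u ∈ Icc 0 S := ⟨hs.1.trans hu.1, hu.2.le.trans ht.2⟩
    have hu1 := hlt (by linarith [hu.1]) (hu.2.trans hta)
    have e1 := (abs_le.1 (h1 u hu' hu1.1)).1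
    have e2 := (h2 _ hs u hu' hu.1 (hlt (by linarith) hs').2.1 hu1.2.1).1
    have e3 : m * κ ≤ m * inner ℝ n (p z u) := by
      gcongr
      exact h4.le.trans e2
    linarith
  have h5 := le_of_tendsto_of_tendsto ((h.tendsto_F hs).add_const _) (h.tendsto_F ht) h4
  have h6 := h.limit_nonneg hs
  have : 0 < m * κ / 2 * (t - (a + t) / 2) := by positivity
  linarith

end CollisionFamily

end SteepBilliard

namespace SteepBilliard

variable {d r : ℕ} {ι : Type} {B : Table d r ι}

/-! ### The reflection law in the limit -/

/-- The limit path leaves an admissible collision with the momentum given by the reflection law. -/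
theorem CollisionFamily.exists_reflected {α : Type*} {V : ℝ → Space d → EReal} {e : EReal}
    {x : Space d} {R : ℝ} {F : ℝ → Space d → ℝ} {𝓤 : Ultrafilter α} {ε : α → ℝ}
    {q p : α → ℝ → Space d} {S C : ℝ} {q₀ p₀ : ℝ → Space d} {a : ℝ} {v w : Space d}
    (h : CollisionFamily B V e x R F 𝓤 ε q p S C q₀ p₀ a v) (hadm : IsAdmissibleCollision B.D x v)
    (hw : ReflectionLaw B.D x v w) :
    ∃ c ∈ Ioo a S, p₀ c = w ∧ q₀ c = x + (c - a) • w := by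
  set n := normal F x
  have hnv : inner ℝ v (gradient (F 0) x) = ‖gradient (F 0) x‖ * inner ℝ n v := by
    conv_lhs => rw [← h.norm_smul_normal, real_inner_smul_right, real_inner_comm]
  obtain ⟨θ, hθ, hpos⟩ : ∃ θ > 0, ∀ t ∈ Icc 0 S, a < t → t < a + θ → 0 < F 0 (q₀ t) := by
    rcases hadm with ⟨n', hn', hv⟩ | hv
    · rw [hn'.unique h.isInwardNormal, real_inner_comm] at hv
      exact h.exists_pos_of_regular hv
    · obtain ⟨h1, h2⟩ := hv.of_defining (h.chart.isDefiningFunction h.mem_ball_self h.chart.zero)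
      rw [hnv, mul_eq_zero, or_iff_right h.norm_gradient_pos.ne'] at h1
      exact h.exists_pos_of_tangent h1 h2
  set b := min (a + θ) S
  have hab : a < b := lt_min (by linarith) h.time_mem.2
  have hbS : ∀ t ∈ Ioo a b, t ∈ Icc 0 S := fun t ht =>
    ⟨h.time_mem.1.le.trans ht.1.le, ht.2.le.trans (min_le_right _ _)⟩
  have hin : ∀ t ∈ Ioo a b, q₀ t ∈ interior B.D := fun t ht =>
    h.chart.mem_interior (h.limit_mem_ball t (hbS t ht))
      (hpos t (hbS t ht) ht.1 (ht.2.trans_le (min_le_left _ _)))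
  have hfree : ∀ s ∈ Ioo a b, ∀ t ∈ Ioo a b, s ≤ t → p₀ t = p₀ s ∧ q₀ t = q₀ s + (t - s) • p₀ s :=
    fun s hs t ht hst => h.free h.condI (hbS s hs).1 (hbS t ht).2
      (fun u hu => hin u ⟨hs.1.trans_le hu.1, hu.2.trans_lt ht.2⟩) t ⟨hst, le_rfl⟩
  set c := (a + b) / 2
  have hc : c ∈ Ioo a b := ⟨by simp only [c]; linarith, by simp only [c]; linarith⟩
  have hp : ∀ t ∈ Ioo a b, p₀ t = p₀ c := by
    intro t ht
    rcases le_total c t with hct | hct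
    · exact (hfree c hc t ht hct).1
    · exact (hfree t ht c hc hct).1.symm
  have hq : ∀ t ∈ Ioo a b, q₀ t = x + (t - a) • p₀ c := by
    intro t ht
    have h1 : Tendsto (fun s => q₀ s + (t - s) • p₀ c) (𝓝[>] a) (𝓝 (x + (t - a) • p₀ c)) := by
      refine Tendsto.add ?_ ?_
      · have h3 := (h.continuousOn a h.mem_Icc).mono_left (nhdsWithin_le_of_mem (t := Ioi a)
          (mem_of_superset (Ioo_mem_nhdsGT hab) fun s hs => hbS s hs))
        rwa [h.hit] at h3
      · have : ContinuousAt (fun s => (t - s) • p₀ c) a := by fun_prop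
        exact this.tendsto.mono_left nhdsWithin_le_nhds
    refine tendsto_nhds_unique (tendsto_const_nhds.congr' ?_) h1
    filter_upwards [Ioo_mem_nhdsGT ht.1] with s hs
    have hs' : s ∈ Ioo a b := ⟨hs.1, hs.2.trans ht.2⟩
    rw [← hp s hs']
    exact (hfree s hs' t ht hs.2.le).2
  refine ⟨c, ⟨hc.1, hc.2.trans_le (min_le_right _ _)⟩, ?_⟩
  suffices hpc : p₀ c = w from ⟨hpc, hpc ▸ hq c hc⟩
  have hnorm : ‖p₀ c‖ = ‖v‖ := by
    rw [h.norm_eq h.condI (hbS c hc) (h.before 0 h.zero_mem).1 (hin c hc),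
      (h.before 0 h.zero_mem).2.2]
  have htan : tangential n (p₀ c) = tangential n v := by
    refine sub_eq_zero.1 (norm_le_zero_iff.1 (le_of_forall_pos_le_add fun η hη => ?_))
    rw [zero_add]
    obtain ⟨θ', hθ', h1⟩ := h.window_tangential hη
    obtain ⟨t, ht1, ht2⟩ := exists_between (lt_min hab (by linarith : a < a + θ'))
    have ht : t ∈ Ioo a b := ⟨ht1, ht2.trans_le (min_le_left _ _)⟩
    rw [← hp t ht]
    refine le_of_tendsto (((((tangential n).continuous.tendsto _).comp
      (h.tendsto_p t (hbS t ht))).sub_const _).norm) ?_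
    filter_upwards [h1] with z hz
    refine hz t (hbS t ht) ?_
    rw [abs_of_pos (sub_pos.2 ht1)]
    linarith [ht2.trans_le (min_le_right _ _)]
  -- the signs of the normal momenta, as the limit path is in the table before and afterwards
  have hdef := h.chart.isDefiningFunction h.mem_ball_self h.chart.zero
  have hsign : ∀ u : Space d, (∀ᶠ s in 𝓝[>] (0 : ℝ), x + s • u ∈ B.D) → 0 ≤ inner ℝ n u := by
    intro u hu
    have := hdef.inner_nonneg (by norm_num) hu
    rw [← h.norm_smul_normal, real_inner_smul_left] at this
    exact nonneg_of_mul_nonneg_right this h.norm_gradient_pos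
  have h1 : 0 ≤ inner ℝ n (p₀ c) := by
    refine hsign _ ?_
    filter_upwards [Ioo_mem_nhdsGT (sub_pos.2 hab)] with s hs
    have hs' : a + s ∈ Ioo a b := ⟨by linarith [hs.1], by linarith [hs.2]⟩
    have := interior_subset (hin _ hs')
    rwa [hq _ hs', add_sub_cancel_left] at this
  have h2 : 0 ≤ inner ℝ n (-v) := by
    refine hsign _ ?_
    filter_upwards [Ioo_mem_nhdsGT h.time_mem.1] with s hs
    obtain ⟨h3, h4, -⟩ := h.before (a - s) ⟨by linarith [hs.2], by linarith [hs.1]⟩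
    rw [h4] at h3
    have := interior_subset h3
    rwa [sub_sub_cancel_left, neg_smul, ← smul_neg] at this
  rw [inner_neg_right] at h2
  -- the kinetic energy determines the normal momentum up to its sign
  have h3 : inner ℝ n (p₀ c) = -inner ℝ n v := by
    have e1 := norm_sq_eq_tangential h.norm_normal (p₀ c)
    have e2 := norm_sq_eq_tangential h.norm_normal v
    change _ = ‖tangential n (p₀ c)‖ ^ 2 + inner ℝ n (p₀ c) ^ 2 at e1
    change _ = ‖tangential n v‖ ^ 2 + inner ℝ n v ^ 2 at e2
    rw [hnorm, htan] at e1
    exact (pow_left_inj₀ h1 h2 two_ne_zero).1 (by linarith [neg_sq (inner ℝ n v)])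
  rw [hw.eq_of_normal h.isInwardNormal]
  rw [tangential_apply, tangential_apply, h3] at htan
  change p₀ c = v - (2 * inner ℝ v n) • n
  rw [real_inner_comm, two_mul, add_smul, ← sub_sub, ← htan]
  simp

/-- Steep potentials reflect: through a collision the Hamiltonian flow converges to the motion
that satisfies the reflection law. -/
theorem IsBoundaryChart.flowLimit_hamiltonian {V : ℝ → Space d → EReal} {e : EReal} {x : Space d}
    {R : ℝ} {F : ℝ → Space d → ℝ} (hch : IsBoundaryChart B V e x R F)
    (hV : ∀ᶠ ε in 𝓝[>] 0, IsC2Potential (V ε)) (hI : ConditionI B V) {v w : Space d}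
    (hve : ((‖v‖ ^ 2 / 2 : ℝ) : EReal) < e) (hadm : IsAdmissibleCollision B.D x v)
    (hw : ReflectionLaw B.D x v w) {a b : ℝ} (ha : 0 < a) (hb : 0 < b)
    (hin : ∀ u ∈ Ioc 0 a, x - u • v ∈ interior B.D)
    (hout : ∀ u ∈ Ioc 0 b, x + u • w ∈ interior B.D) (hR : (‖v‖ + 1) * (2 * a + b) < R) :
    FlowLimit (𝓝[>] 0) (hamiltonianRel V) (a + b) (x - a • v, v) (x + b • w, w) := by
  intro N hN
  set C := ‖v‖ + 1
  set S := a + b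
  set ρ : Phase d := (x - a • v, v)
  have hC : 0 ≤ C := by positivity
  have hS : 0 < S := by positivity
  have haC : ‖a • v‖ ≤ C * a := by
    rw [norm_smul, Real.norm_of_nonneg ha.le, mul_comm]
    gcongr
    simp [C]
  have hρR : dist ρ.1 x + C * S < R := by
    rw [dist_eq_norm]
    simp only [ρ, sub_sub_cancel_left, norm_neg, S]
    linarith
  have hlim1 : Tendsto (fun z : ℝ × Phase d => z.1) (𝓝[>] 0 ×ˢ 𝓝 ρ) (𝓝[>] 0) := tendsto_fst
  have hlim2 : Tendsto (fun z : ℝ × Phase d => z.2) (𝓝[>] 0 ×ˢ 𝓝 ρ) (𝓝 ρ) := tendsto_snd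
  have hex : ∀ᶠ z : ℝ × Phase d in 𝓝[>] 0 ×ˢ 𝓝 ρ, ∃ g : (ℝ → Space d) × (ℝ → Space d),
      (g.1 0, g.2 0) = z.2 ∧ IsHamiltonianTrajectory (V z.1) S g.1 g.2 ∧
        (∀ t ∈ Icc 0 S, ‖g.1 t - g.1 0‖ ≤ C * t ∧ ‖g.2 t‖ ≤ C) ∧
        ∀ t ∈ Icc 0 S, g.1 t ∈ Metric.ball x R := by
    obtain ⟨K, hK, hKρ, hKD⟩ := exists_compact_subset isOpen_interior (hin a ⟨ha, le_rfl⟩)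
    have hc1 : ContinuousAt (fun z : Phase d => ‖z.2‖ ^ 2 / 2) ρ := by fun_prop
    have hc2 : ContinuousAt (fun z : Phase d => dist z.1 x + C * S) ρ := by fun_prop
    have hc3 : ContinuousAt (fun z : Phase d => z.1) ρ := by fun_prop
    filter_upwards [hlim1.eventually hV, hlim1.eventually (hch.lower (1 / 8) (by norm_num)),
      hlim1.eventually (hI.eventually_small hK hKD (by norm_num : (0 : ℝ) < 1 / 8)),
      hlim2.eventually (hc1.eventually (gt_mem_nhds (by linarith : _ < ‖v‖ ^ 2 / 2 + 1 / 8))),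
      hlim2.eventually (hc2.eventually (gt_mem_nhds hρR)),
      hlim2.eventually (hc3.eventually (isOpen_interior.mem_nhds hKρ))] with z h1 h2 h3 h4 h5 h6
    obtain ⟨h7, h8, -⟩ := h3 _ (interior_subset h6)
    obtain ⟨q, p, h9, h10, h11⟩ := exists_trajectory_of_lower h1 hC hS.le h2 h7 (by
      have := (abs_lt.1 h8).2
      have e1 : C ^ 2 / 2 = ‖v‖ ^ 2 / 2 + ‖v‖ + 1 / 2 := by simp only [C]; ring
      linarith [norm_nonneg v]) h5
    refine ⟨(q, p), h9, h10, h11, fun t ht => ?_⟩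
    rw [Metric.mem_ball]
    have e1 := dist_triangle (q t) (q 0) x
    rw [dist_eq_norm (q t) (q 0)] at e1
    have e2 : C * t ≤ C * S := by gcongr; exact ht.2
    have e3 := (h11 t ht).1
    have e4 : q 0 = z.2.1 := congrArg Prod.fst h9
    rw [e4] at e1 e3
    linarith
  -- choose a trajectory for each parameter and initial point, and pass to limits along ultrafilters
  obtain ⟨g, hg⟩ := hex.choice
  suffices hlim : Tendsto (fun z => ((g z).1 S, (g z).2 S)) (𝓝[>] 0 ×ˢ 𝓝 ρ)
      (𝓝 (x + b • w, w)) by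
    filter_upwards [hlim hN, hg] with z hz1 hz2
    exact ⟨_, hz1, (g z).1, (g z).2, hz2.2.1, hz2.1, rfl⟩
  rw [tendsto_iff_ultrafilter]
  intro 𝓤 h𝓤
  have hg𝓤 := h𝓤 hg
  have hlq : ∀ t : ℝ, ∃ l, t ∈ Icc 0 S → Tendsto (fun z => (g z).1 t) 𝓤 (𝓝 l) := by
    intro t
    by_cases ht : t ∈ Icc 0 S
    · obtain ⟨l, hl⟩ := exists_ultrafilter_limit (𝓤 := 𝓤) (f := fun z => (g z).1 t) (y := x) (C := R)
        (mem_of_superset hg𝓤 fun z hz => Metric.ball_subset_closedBall (hz.2.2.2 t ht))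
      exact ⟨l, fun _ => hl⟩
    · exact ⟨0, fun h => absurd h ht⟩
  have hlp : ∀ t : ℝ, ∃ l, t ∈ Icc 0 S → Tendsto (fun z => (g z).2 t) 𝓤 (𝓝 l) := by
    intro t
    by_cases ht : t ∈ Icc 0 S
    · obtain ⟨l, hl⟩ := exists_ultrafilter_limit (𝓤 := 𝓤) (f := fun z => (g z).2 t) (y := 0) (C := C)
        (mem_of_superset hg𝓤 fun z hz => mem_closedBall_zero_iff.2 (hz.2.2.1 t ht).2)
      exact ⟨l, fun _ => hl⟩
    · exact ⟨0, fun h => absurd h ht⟩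
  choose q₀ hq₀ using hlq
  choose p₀ hp₀ using hlp
  have hfam : LimitFamily V 𝓤 Prod.fst (fun z => (g z).1) (fun z => (g z).2) S C q₀ p₀ :=
    { tendsto_ε := hlim1.mono_left h𝓤
      isC2 := (hlim1.mono_left h𝓤).eventually hV
      traj := mem_of_superset hg𝓤 fun z hz => hz.2.1
      speed := mem_of_superset hg𝓤 fun z hz t ht => (hz.2.2.1 t ht).2
      tendsto_q := hq₀
      tendsto_p := hp₀ }
  have h0S : (0 : ℝ) ∈ Icc 0 S := ⟨le_rfl, hS.le⟩
  have hstart : Tendsto (fun z => ((g z).1 0, (g z).2 0)) 𝓤 (𝓝 ρ) :=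
    (hlim2.mono_left h𝓤).congr' (mem_of_superset hg𝓤 fun z hz => hz.1.symm)
  have hq0 : q₀ 0 = x - a • v := tendsto_nhds_unique (hq₀ 0 h0S)
    ((continuous_fst.tendsto ρ).comp hstart)
  have hp0 : p₀ 0 = v := tendsto_nhds_unique (hp₀ 0 h0S)
    ((continuous_snd.tendsto ρ).comp hstart)
  have haS : a < S := by simp only [S]; linarith
  have hline : ∀ t : ℝ, x - a • v + t • v = x - (a - t) • v := by
    intro t
    rw [sub_smul]
    abel
  have hbefore : ∀ t ∈ Ico 0 a, q₀ t ∈ interior B.D ∧ q₀ t = x + (t - a) • v ∧ p₀ t = v := by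
    intro t ht
    obtain ⟨h1, h2⟩ := hfam.eq_of_free_segment hI le_rfl (ht.2.trans haS).le (by
      intro u hu
      rw [hq0, hp0, hline]
      exact hin _ ⟨by linarith [hu.2, ht.2], by linarith [hu.1]⟩) t ⟨ht.1, le_rfl⟩
    rw [hq0, hp0, sub_zero, hline] at h2
    refine ⟨?_, ?_, h1.trans hp0⟩
    · rw [h2]
      exact hin _ ⟨by linarith [ht.2], by linarith [ht.1]⟩
    · rw [h2, ← neg_sub t a, neg_smul, sub_neg_eq_add]
  have hball : ∀ t ∈ Icc 0 S, q₀ t ∈ Metric.ball x R := by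
    intro t ht
    have h1 := hfam.limit_lipschitz h0S ht
    rw [sub_zero, abs_of_nonneg ht.1] at h1
    have h2 : C * t ≤ C * S := by gcongr; exact ht.2
    have h3 := dist_triangle (q₀ t) (q₀ 0) x
    rw [dist_eq_norm (q₀ t) (q₀ 0), hq0] at h3
    rw [hq0] at h1
    have h4 : dist (x - a • v) x + C * S < R := hρR
    rw [Metric.mem_ball]
    linarith
  have hhit : q₀ a = x := by
    have h1 := (hfam.continuousOn a ⟨ha.le, haS.le⟩).mono_left (nhdsWithin_le_of_mem (t := Iio a)
      (mem_of_superset (Ioo_mem_nhdsLT ha) fun s hs => ⟨le_of_lt hs.1, (le_of_lt hs.2).trans haS.le⟩))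
    have h2 : Tendsto (fun t : ℝ => x + (t - a) • v) (𝓝[<] a) (𝓝 x) := by
      have : ContinuousAt (fun t : ℝ => x + (t - a) • v) a := by fun_prop
      simpa using this.tendsto.mono_left (nhdsWithin_le_nhds (s := Iio a))
    refine tendsto_nhds_unique h1 (h2.congr' ?_)
    filter_upwards [Ioo_mem_nhdsLT ha] with t ht
    exact (hbefore t ⟨ht.1.le, ht.2⟩).2.1.symm
  have hcol : CollisionFamily B V e x R F 𝓤 Prod.fst (fun z => (g z).1) (fun z => (g z).2)
      S C q₀ p₀ a v :=
    { hfam with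
      chart := hch
      condI := hI
      time_mem := ⟨ha, haS⟩
      before := hbefore
      hit := hhit
      mem_ball := mem_of_superset hg𝓤 fun z hz => hz.2.2.2
      limit_mem_ball := hball
      energy_lt := hve }
  obtain ⟨c, hc, hpc, hqc⟩ := hcol.exists_reflected hadm hw
  have hline' : ∀ u : ℝ, x + (c - a) • w + u • w = x + (c - a + u) • w := by
    intro u
    rw [add_smul, add_assoc]
  obtain ⟨h1, h2⟩ := hfam.eq_of_free_segment hI (ha.le.trans hc.1.le) le_rfl (by
    intro u hu
    rw [hqc, hpc, hline']
    refine hout _ ⟨by linarith [hc.1, hu.1], ?_⟩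
    have := hu.2
    simp only [S] at this
    linarith) S ⟨hc.2.le, le_rfl⟩
  have h3 : q₀ S = x + b • w := by
    rw [h2, hqc, hpc, hline']
    congr 2
    simp only [S]
    ring
  have h4 := (hq₀ S ⟨hS.le, le_rfl⟩).prodMk_nhds (hp₀ S ⟨hS.le, le_rfl⟩)
  rw [h3, h1, hpc] at h4
  exact h4

end SteepBilliard

namespace SteepBilliard

variable {d r : ℕ} {ι : Type} {B : Table d r ι}

/-! ### Stability of billiard trajectories at a collision -/

/-- The reflection law at the point `y` of a level set of `f`. -/
noncomputable def reflect (f : Space d → ℝ) (y u : Space d) : Space d :=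
  u - (2 * inner ℝ u (‖gradient f y‖⁻¹ • gradient f y)) • ‖gradient f y‖⁻¹ • gradient f y

theorem continuousAt_reflect {f : Space d → ℝ} {x : Space d} (hf : ContinuousAt (gradient f) x)
    (hx : gradient f x ≠ 0) (v : Space d) :
    ContinuousAt (fun z : Space d × Space d => reflect f z.1 z.2) (x, v) := by
  have h1 : ContinuousAt (fun z : Space d × Space d => gradient f z.1) (x, v) :=
    ContinuousAt.comp (f := fun z : Space d × Space d => z.1) (g := gradient f) hf continuousAt_fst
  have h2 : ContinuousAt (fun z : Space d × Space d => ‖gradient f z.1‖⁻¹ • gradient f z.1) (x, v) :=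
    (h1.norm.inv₀ (norm_ne_zero_iff.2 hx)).smul h1
  exact continuousAt_snd.sub (((continuousAt_snd.inner (𝕜 := ℝ) h2).const_mul 2).smul h2)

theorem inner_gradient_reflect {f : Space d → ℝ} {y : Space d} (hy : gradient f y ≠ 0)
    (u : Space d) :
    inner ℝ (gradient f y) (reflect f y u) = -inner ℝ (gradient f y) u := by
  have h : ‖gradient f y‖ ≠ 0 := norm_ne_zero_iff.2 hy
  rw [reflect, inner_sub_right, inner_smul_right, inner_smul_right, inner_smul_right,
    real_inner_self_eq_norm_sq, real_inner_comm]
  field_simp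
  ring

theorem exists_ball_of_eventually {x v : Space d} {P : Space d → Space d → Prop}
    (hP : ∀ᶠ z in 𝓝 (x, v), P z.1 z.2) :
    ∃ s > 0, ∀ y ∈ Metric.ball x s, ∀ u ∈ Metric.ball v s, P y u := by
  obtain ⟨s, hs, h⟩ := Metric.eventually_nhds_iff_ball.1 hP
  refine ⟨s, hs, fun y hy u hu => h (y, u) ?_⟩
  rw [← ball_prod_same]
  exact ⟨hy, hu⟩

namespace IsBoundaryChart

variable {V : ℝ → Space d → EReal} {e : EReal} {x : Space d} {R : ℝ} {F : ℝ → Space d → ℝ}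

theorem continuousAt_gradient (h : IsBoundaryChart B V e x R F) {y : Space d}
    (hy : y ∈ Metric.ball x R) : ContinuousAt (gradient (F 0)) y :=
  (h.tendsto_gradient y hy).comp ((tendsto_const_nhdsWithin (mem_Ici.2 le_rfl)).prodMk tendsto_id)

theorem continuousAt_inner_gradient (h : IsBoundaryChart B V e x R F) {y : Space d}
    (hy : y ∈ Metric.ball x R) (u : Space d) : ContinuousAt
      (fun z : Space d × Space d => inner ℝ (gradient (F 0) z.1) z.2) (y, u) := by
  have h1 : ContinuousAt (fun z : Space d × Space d => gradient (F 0) z.1) (y, u) :=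
    ContinuousAt.comp (f := fun z : Space d × Space d => z.1) (g := gradient (F 0))
      (h.continuousAt_gradient hy) continuousAt_fst
  exact h1.inner (𝕜 := ℝ) continuousAt_snd

theorem continuousAt_hessian (h : IsBoundaryChart B V e x R F) {y : Space d}
    (hy : y ∈ Metric.ball x R) (v : Space d) : ContinuousAt
      (fun z : Space d × Space d => fderiv ℝ (fderiv ℝ (F 0)) z.1 z.2 z.2) (y, v) :=
  (h.tendsto_hessian y hy v).comp ((tendsto_const_nhdsWithin (mem_Ici.2 le_rfl)).prodMk tendsto_id)

theorem hasDerivAt_line (h : IsBoundaryChart B V e x R F) {y u : Space d} {t : ℝ}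
    (hy : y + t • u ∈ Metric.ball x R) :
    HasDerivAt (fun t : ℝ => F 0 (y + t • u)) (inner ℝ (gradient (F 0) (y + t • u)) u) t := by
  rw [inner_gradient]
  exact ((h.contDiffAt hy).differentiableAt (by norm_num)).hasFDerivAt.comp_hasDerivAt t
    (SteepBilliard.hasDerivAt_line y u t)

theorem hasDerivAt_gradient_line (h : IsBoundaryChart B V e x R F) {y u : Space d} {t : ℝ}
    (hy : y + t • u ∈ Metric.ball x R) :
    HasDerivAt (fun t : ℝ => inner ℝ (gradient (F 0) (y + t • u)) u)
      (fderiv ℝ (fderiv ℝ (F 0)) (y + t • u) u u) t := by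
  simp only [inner_gradient]
  have h1 := (((h.contDiffAt hy).fderiv_right (m := 1) (by norm_num)).differentiableAt
    one_ne_zero).hasFDerivAt.comp_hasDerivAt t (SteepBilliard.hasDerivAt_line y u t)
  simpa using h1.clm_apply (hasDerivAt_const t u)

theorem add_mul_le (h : IsBoundaryChart B V e x R F) {y u : Space d} {c L : ℝ} (hL : 0 ≤ L)
    (hc : ∀ t ∈ Icc 0 L, y + t • u ∈ Metric.ball x R ∧
      c ≤ inner ℝ (gradient (F 0) (y + t • u)) u) : F 0 y + c * L ≤ F 0 (y + L • u) := by
  have := add_mul_le_of_le_deriv (f := fun t : ℝ => F 0 (y + t • u)) hL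
    (fun t ht => (h.hasDerivAt_line (hc t ht).1).continuousAt.continuousWithinAt)
    (fun t ht => (h.hasDerivAt_line (hc t ⟨ht.1, ht.2.le⟩).1).hasDerivWithinAt)
    fun t ht => (hc t ⟨ht.1, ht.2.le⟩).2
  simpa using this

theorem quadratic_le (h : IsBoundaryChart B V e x R F) {y u : Space d} {c L : ℝ} (hL : 0 ≤ L)
    (hc : ∀ t ∈ Icc 0 L, y + t • u ∈ Metric.ball x R ∧
      c ≤ fderiv ℝ (fderiv ℝ (F 0)) (y + t • u) u u) :
    F 0 y + inner ℝ (gradient (F 0) y) u * L + c / 2 * L ^ 2 ≤ F 0 (y + L • u) := by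
  have := quadratic_le_of_le_deriv (f := fun t : ℝ => F 0 (y + t • u))
    (b := inner ℝ (gradient (F 0) y) u) (c := c) hL
    (fun t ht => (h.hasDerivAt_line (hc t ht).1).continuousAt.continuousWithinAt)
    (fun t ht => (h.hasDerivAt_line (hc t ⟨ht.1, ht.2.le⟩).1).hasDerivWithinAt) fun t ht => ?_
  · simpa using this
  · have hsub : Icc 0 t ⊆ Icc 0 L := Icc_subset_Icc_right ht.2.le
    have := add_mul_le_of_le_deriv (f := fun t : ℝ => inner ℝ (gradient (F 0) (y + t • u)) u) ht.1
      (fun s hs => (h.hasDerivAt_gradient_line (hc s (hsub hs)).1).continuousAt.continuousWithinAt)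
      (fun s hs => (h.hasDerivAt_gradient_line
        (hc s (hsub ⟨hs.1, hs.2.le⟩)).1).hasDerivWithinAt)
      fun s hs => (hc s (hsub ⟨hs.1, hs.2.le⟩)).2
    simpa using this

theorem reflectionLaw_reflect (h : IsBoundaryChart B V e x R F) {y : Space d}
    (hy : y ∈ Metric.ball x R) (hF : F 0 y = 0) (u : Space d) :
    ReflectionLaw B.D y u (reflect (F 0) y u) := ⟨_, h.isInwardNormal hy hF, rfl⟩

/-- Stability at a collision, if nearby collisions are admissible and their outgoing trajectories do
not return immediately (`hadm`), and if either the momentum does not change, or the trajectory would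
leave the table without the collision (`hcase`). -/
theorem flowLimit_admissible_of (h : IsBoundaryChart B V e x R F) {v w : Space d}
    (hw : ReflectionLaw B.D x v w) {s : ℝ} (hs : 0 < s) (hsR : s ≤ R)
    (hadm : ∀ y ∈ Metric.ball x s, ∀ u ∈ Metric.ball v s, F 0 y = 0 →
      inner ℝ (gradient (F 0) y) u ≤ 0 → IsAdmissibleCollision B.D y u ∧
        ∀ L > (0 : ℝ), (∀ t ∈ Icc 0 L, y + t • reflect (F 0) y u ∈ Metric.ball x s) →
          0 < F 0 (y + L • reflect (F 0) y u))
    (hcase : w = v ∨ ∀ t > (0 : ℝ), (∀ u ∈ Icc 0 t, x + u • v ∈ Metric.ball x s) → F 0 (x + t • v) < 0)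
    {a b : ℝ} (ha : 0 < a) (hb : 0 < b) (hin : ∀ u ∈ Ioc 0 a, x - u • v ∈ interior B.D)
    (hout : ∀ u ∈ Ioc 0 b, x + u • w ∈ interior B.D) (hab : (‖v‖ + 1) * (2 * a + b) < s) :
    FlowLimit (⊤ : Filter Unit) (fun _ => AdmissibleMapsTo B) (a + b) (x - a • v, v)
      (x + b • w, w) := by
  intro N hN
  obtain ⟨S, hS⟩ : ∃ S, S = a + b := ⟨_, rfl⟩
  obtain ⟨ρ, hρ⟩ : ∃ ρ : Phase d, ρ = (x - a • v, v) := ⟨_, rfl⟩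
  rw [← hS, ← hρ]
  have hxs : ∀ {y}, y ∈ Metric.ball x s → y ∈ Metric.ball x R := fun hy =>
    Metric.ball_subset_ball hsR hy
  have hxR : x ∈ Metric.ball x R := Metric.mem_ball_self h.pos
  suffices hev : ∀ᶠ z in 𝓝 ρ, ∃ σ' ∈ N, AdmissibleMapsTo B S z σ' from tendsto_snd.eventually hev
  have hline : ∀ t : ℝ, ρ.1 + t • ρ.2 = x + (t - a) • v := by
    intro t
    rw [hρ, sub_smul, add_sub, sub_add_eq_add_sub]
  have hball : dist ρ.1 x + S * ‖ρ.2‖ < s := by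
    rw [hρ, dist_eq_norm]
    simp only [sub_sub_cancel_left, norm_neg]
    rw [norm_smul, Real.norm_of_nonneg ha.le, hS]
    nlinarith [norm_nonneg v]
  have hballs : ∀ z : Phase d, dist z.1 x + S * ‖z.2‖ < s → ∀ t ∈ Icc 0 S,
      z.1 + t • z.2 ∈ Metric.ball x s := by
    intro z hz t ht
    rw [Metric.mem_ball]
    have h1 := dist_triangle (z.1 + t • z.2) z.1 x
    rw [dist_self_add_left, norm_smul, Real.norm_of_nonneg ht.1] at h1
    have h2 : t * ‖z.2‖ ≤ S * ‖z.2‖ := by gcongr; exact ht.2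
    linarith
  have hne : ∀ t ∈ Icc 0 S, t ≠ a → F 0 (ρ.1 + t • ρ.2) ≠ 0 := by
    intro t ht hta
    have hbt := hballs ρ hball t ht
    rcases lt_or_gt_of_ne hta with hlt | hgt
    · refine (h.pos_of_mem_interior (hxs hbt) ?_).ne'
      have := hin (a - t) ⟨by linarith, by linarith [ht.1]⟩
      rwa [hline, ← neg_sub, neg_smul, ← sub_eq_add_neg]
    · rcases hcase with rfl | hcase
      · refine (h.pos_of_mem_interior (hxs hbt) ?_).ne'
        rw [hline]
        exact hout _ ⟨by linarith, by linarith [ht.2]⟩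
      · rw [hline]
        refine (hcase _ (sub_pos.2 hgt) fun u hu => ?_).ne
        have := hballs ρ hball (a + u) ⟨by linarith [hu.1], by linarith [hu.2, ht.2]⟩
        rwa [hline, add_sub_cancel_left] at this
  -- the endpoint as a function of the collision time and the initial point
  set Ψ : ℝ × Phase d → Phase d := fun y =>
    (y.2.1 + y.1 • y.2.2 + (S - y.1) • reflect (F 0) (y.2.1 + y.1 • y.2.2) y.2.2,
      reflect (F 0) (y.2.1 + y.1 • y.2.2) y.2.2)
  have hrefl : reflect (F 0) x v = w :=
    (h.reflectionLaw_reflect hxR h.zero v).unique hw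
  have hρx : ρ.1 + a • ρ.2 = x := by rw [hline, sub_self, zero_smul, add_zero]
  have hρv : ρ.2 = v := by rw [hρ]
  have hΨ : ContinuousAt Ψ (a, ρ) := by
    have h1 : ContinuousAt (fun y : ℝ × Phase d => (y.2.1 + y.1 • y.2.2, y.2.2)) (a, ρ) := by fun_prop
    have h2 : ContinuousAt (fun y : ℝ × Phase d => reflect (F 0) (y.2.1 + y.1 • y.2.2) y.2.2)
        (a, ρ) := by
      refine ContinuousAt.comp (f := fun y : ℝ × Phase d => (y.2.1 + y.1 • y.2.2, y.2.2))
        (g := fun z : Space d × Space d => reflect (F 0) z.1 z.2) ?_ h1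
      change ContinuousAt _ (ρ.1 + a • ρ.2, ρ.2)
      rw [hρx, hρv]
      exact continuousAt_reflect (h.continuousAt_gradient hxR) (h.gradient_ne x hxR) v
    have h3 : ContinuousAt (fun y : ℝ × Phase d => y.2.1 + y.1 • y.2.2) (a, ρ) := by fun_prop
    have h4 : ContinuousAt (fun y : ℝ × Phase d => S - y.1) (a, ρ) := by fun_prop
    exact (h3.add (h4.smul h2)).prodMk h2
  have hΨ0 : Ψ (a, ρ) = (x + b • w, w) := by
    simp only [Ψ, hρx]
    rw [hρv, hrefl, hS, add_sub_cancel_left]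
  have hΨN := hΨ.eventually (hΨ0.symm ▸ hN)
  rw [nhds_prod_eq] at hΨN
  obtain ⟨A, hA, Z, hZ, hAZ⟩ := eventually_prod_iff.1 hΨN
  obtain ⟨A', hA'A, hA'o, haA'⟩ := mem_nhds_iff.1
    (Filter.inter_mem hA (Ioo_mem_nhds ha (by linarith : a < S)))
  -- collisions near the given trajectory take place at times near `a`
  have hcmp : IsCompact (Icc 0 S \ A') := isCompact_Icc.diff hA'o
  have hnez : ∀ᶠ z in 𝓝 ρ, ∀ t ∈ Icc 0 S \ A', F 0 (z.1 + t • z.2) ≠ 0 := by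
    refine hcmp.eventually_forall_of_forall_eventually fun t ht => ?_
    have h1 : ContinuousAt (fun y : Phase d × ℝ => F 0 (y.1.1 + y.2 • y.1.2)) (ρ, t) :=
      ContinuousAt.comp (f := fun y : Phase d × ℝ => y.1.1 + y.2 • y.1.2) (g := F 0)
        (h.continuousAt (hxs (hballs ρ hball t ht.1))) (by fun_prop)
    exact h1.eventually_ne (hne t ht.1 fun h => ht.2 (h ▸ haA'))
  have hinit : ρ.1 ∈ interior B.D := by rw [hρ]; exact hin a ⟨ha, le_rfl⟩
  have hfin : ∀ᶠ z in 𝓝 ρ, (z.1 + S • z.2, z.2) ∈ N ∨ F 0 (z.1 + S • z.2) < 0 := by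
    have hSa : S - a = b := by rw [hS, add_sub_cancel_left]
    have hSS : S ∈ Icc 0 S := ⟨by linarith, le_rfl⟩
    rcases hcase with rfl | hcase
    · have h1 : ContinuousAt (fun z : Phase d => (z.1 + S • z.2, z.2)) ρ := by fun_prop
      refine (h1.eventually ?_).mono fun z hz => Or.inl hz
      change N ∈ 𝓝 (ρ.1 + S • ρ.2, ρ.2)
      rwa [hline, hSa, hρv]
    · have h1 : ContinuousAt (fun z : Phase d => F 0 (z.1 + S • z.2)) ρ :=
        ContinuousAt.comp (f := fun z : Phase d => z.1 + S • z.2) (g := F 0)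
          (h.continuousAt (hxs (hballs ρ hball S hSS))) (by fun_prop)
      refine (h1.eventually (gt_mem_nhds ?_)).mono fun z hz => Or.inr hz
      change F 0 (ρ.1 + S • ρ.2) < 0
      rw [hline, hSa]
      refine hcase b hb fun u hu => ?_
      have := hballs ρ hball (a + u) ⟨by linarith [hu.1], by linarith [hu.2]⟩
      rwa [hline, add_sub_cancel_left] at this
  have hc1 : ContinuousAt (fun z : Phase d => dist z.1 x + S * ‖z.2‖) ρ := by fun_prop
  filter_upwards [hnez, hfin, hc1.eventually (gt_mem_nhds hball), hZ,
    continuousAt_fst.eventually (isOpen_interior.mem_nhds hinit),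
    continuousAt_snd.eventually (Metric.isOpen_ball.mem_nhds
      (by rw [hρv]; exact Metric.mem_ball_self hs : ρ.2 ∈ Metric.ball v s))] with z h1 h2 h3 h4 h5 h6
  have hz := hballs z h3
  have hcont : ContinuousOn (fun t : ℝ => F 0 (z.1 + t • z.2)) (Icc 0 S) := fun t ht =>
    (h.hasDerivAt_line (hxs (hz t ht))).continuousAt.continuousWithinAt
  by_cases hpos : ∀ t ∈ Icc 0 S, 0 < F 0 (z.1 + t • z.2)
  · refine ⟨_, h2.resolve_right (hpos S ⟨by linarith, le_rfl⟩).not_gt,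
      admissibleMapsTo_free (by linarith) fun u hu => ?_⟩
    exact h.mem_interior (hxs (hz u hu)) (hpos u hu)
  · push Not at hpos
    -- the time of the first collision
    have hK : IsCompact {t ∈ Icc 0 S | F 0 (z.1 + t • z.2) ≤ 0} :=
      isCompact_Icc.of_isClosed_subset (hcont.preimage_isClosed_of_isClosed isClosed_Icc isClosed_Iic)
        inter_subset_left
    obtain ⟨τ, hτ, hτmin⟩ := hK.exists_isLeast hpos
    have hbefore : ∀ u ∈ Ico 0 τ, 0 < F 0 (z.1 + u • z.2) := by
      intro u hu
      by_contra! hle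
      exact absurd (hτmin ⟨⟨hu.1, hu.2.le.trans hτ.1.2⟩, hle⟩) (not_le.2 hu.2)
    have h0S : (0 : ℝ) ∈ Icc 0 S := ⟨le_rfl, by linarith⟩
    have h0 : 0 < F 0 (z.1 + (0 : ℝ) • z.2) := by
      refine h.pos_of_mem_interior (hxs (hz 0 h0S)) ?_
      rwa [zero_smul, add_zero]
    have hτ0 : 0 < τ := hτ.1.1.lt_of_ne (by rintro rfl; exact absurd h0 (not_lt.2 hτ.2))
    have hτF : F 0 (z.1 + τ • z.2) = 0 := by
      refine le_antisymm hτ.2 ?_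
      have h7 := (hcont τ hτ.1).mono_left (nhdsWithin_le_of_mem (t := Iio τ)
        (mem_of_superset (Ioo_mem_nhdsLT hτ0) fun u hu => ⟨le_of_lt hu.1, (le_of_lt hu.2).trans hτ.1.2⟩))
      refine ge_of_tendsto h7 ?_
      filter_upwards [Ioo_mem_nhdsLT hτ0] with u hu using (hbefore u ⟨hu.1.le, hu.2⟩).le
    have hτA : τ ∈ A' := by
      by_contra hτA
      exact h1 τ ⟨hτ.1, hτA⟩ hτF
    have hτA2 := hA'A hτA
    have hyb := hz τ hτ.1
    have hG : inner ℝ (gradient (F 0) (z.1 + τ • z.2)) z.2 ≤ 0 := by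
      have h7 := (h.isDefiningFunction (hxs hyb) hτF).inner_nonneg (by norm_num) (w := -z.2) (by
        filter_upwards [Ioo_mem_nhdsGT hτ0] with u hu
        have h8 := hbefore (τ - u) ⟨by linarith [hu.2], by linarith [hu.1]⟩
        have h9 := hz (τ - u) ⟨by linarith [hu.2], by linarith [hu.1, hτ.1.2]⟩
        have h10 : z.1 + τ • z.2 + u • -z.2 = z.1 + (τ - u) • z.2 := by
          rw [sub_smul, smul_neg]; abel
        rw [h10]
        exact (h.mem_iff _ (hxs h9)).2 h8.le)
      rw [inner_neg_right] at h7
      linarith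
    obtain ⟨h7, h8⟩ := hadm _ hyb _ h6 hτF hG
    have hrl := h.reflectionLaw_reflect (hxs hyb) hτF z.2
    refine ⟨_, hAZ hτA2.1 h4, admissibleMapsTo_collision hτA2.2 rfl (h.mem_frontier (hxs hyb) hτF)
      (h.notMem_corner _ (hxs hyb)) hrl h7 (fun u hu => ?_) fun u hu => ?_⟩
    · exact h.mem_interior (hxs (hz u ⟨hu.1, hu.2.le.trans hτ.1.2⟩)) (hbefore u hu)
    · have h9 : ∀ t ∈ Icc 0 u, z.1 + τ • z.2 + t • reflect (F 0) (z.1 + τ • z.2) z.2 ∈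
          Metric.ball x s := by
        intro t ht
        have e1 := dist_triangle (z.1 + τ • z.2 + t • reflect (F 0) (z.1 + τ • z.2) z.2)
          (z.1 + τ • z.2) x
        have e2 := dist_triangle (z.1 + τ • z.2) z.1 x
        rw [dist_self_add_left, norm_smul, Real.norm_of_nonneg ht.1, hrl.norm_eq] at e1
        rw [dist_self_add_left, norm_smul, Real.norm_of_nonneg hτ0.le] at e2
        have e3 : t * ‖z.2‖ ≤ (S - τ) * ‖z.2‖ := by gcongr; exact ht.2.trans hu.2
        rw [Metric.mem_ball]
        linarith
      exact h.mem_interior (hxs (h9 u ⟨hu.1.le, le_rfl⟩)) (h8 u hu.1 h9)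

/-- Near a regular reflection the defining function is strictly monotone along incoming and along
outgoing trajectories. -/
theorem flowLimit_admissible_of_regular (h : IsBoundaryChart B V e x R F) {v w : Space d}
    (hadm : IsRegularReflection B.D x v) (hw : ReflectionLaw B.D x v w) :
    ∃ s > 0, ∀ a b : ℝ, 0 < a → 0 < b → (∀ u ∈ Ioc 0 a, x - u • v ∈ interior B.D) →
      (∀ u ∈ Ioc 0 b, x + u • w ∈ interior B.D) → (‖v‖ + 1) * (2 * a + b) < s →
      FlowLimit (⊤ : Filter Unit) (fun _ => AdmissibleMapsTo B) (a + b) (x - a • v, v)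
        (x + b • w, w) := by
  have hxR : x ∈ Metric.ball x R := Metric.mem_ball_self h.pos
  have hrefl : reflect (F 0) x v = w := (h.reflectionLaw_reflect hxR h.zero v).unique hw
  have hcr := continuousAt_reflect (h.continuousAt_gradient hxR) (h.gradient_ne x hxR) v
  have hcg := h.continuousAt_inner_gradient hxR
  obtain ⟨n, hn, hv⟩ := hadm
  have hg : inner ℝ (gradient (F 0) x) v < 0 := by
    rw [hn.unique (h.isInwardNormal hxR h.zero), inner_smul_right, real_inner_comm] at hv
    exact (pos_iff_neg_of_mul_neg hv).1
      (inv_pos.2 (norm_pos_iff.2 (h.gradient_ne x hxR)))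
  obtain ⟨g, hg0, hgv⟩ : ∃ g > 0, inner ℝ (gradient (F 0) x) v < -g :=
    ⟨-inner ℝ (gradient (F 0) x) v / 2, by linarith, by linarith⟩
  have hgw : g < inner ℝ (gradient (F 0) x) w := by
    rw [← hrefl, inner_gradient_reflect (h.gradient_ne x hxR)]
    linarith
  obtain ⟨s₁, hs₁, h1⟩ := exists_ball_of_eventually
    (P := fun y u => inner ℝ (gradient (F 0) y) u < -g) ((hcg v).eventually (gt_mem_nhds hgv))
  obtain ⟨s₂, hs₂, h2⟩ := exists_ball_of_eventually
    (P := fun y u => g < inner ℝ (gradient (F 0) y) u) ((hcg w).eventually (lt_mem_nhds hgw))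
  obtain ⟨s₃, hs₃, h3⟩ := exists_ball_of_eventually (P := fun y u =>
    reflect (F 0) y u ∈ Metric.ball w s₂) (hcr.eventually (by
      beta_reduce
      rw [hrefl]
      exact Metric.ball_mem_nhds w hs₂))
  set s := min (min s₁ s₂) (min s₃ R)
  have hss₁ : s ≤ s₁ := (min_le_left _ _).trans (min_le_left _ _)
  have hss₂ : s ≤ s₂ := (min_le_left _ _).trans (min_le_right _ _)
  have hss₃ : s ≤ s₃ := (min_le_right _ _).trans (min_le_left _ _)
  have hsR : s ≤ R := (min_le_right _ _).trans (min_le_right _ _)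
  have hs : 0 < s := lt_min (lt_min hs₁ hs₂) (lt_min hs₃ h.pos)
  have hb : ∀ {y : Space d} {t : ℝ} {z : Space d}, s ≤ t → z ∈ Metric.ball y s →
    z ∈ Metric.ball y t := fun hst hz => Metric.ball_subset_ball hst hz
  refine ⟨s, hs, fun a b ha hb' hin hout hab => h.flowLimit_admissible_of hw hs hsR ?_ (Or.inr ?_)
    ha hb' hin hout hab⟩
  · intro y hy u hu hF hG
    refine ⟨Or.inl ⟨_, h.isInwardNormal (hb hsR hy) hF, ?_⟩, fun L hL hL' => ?_⟩
    · rw [inner_smul_right, real_inner_comm]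
      refine mul_neg_of_pos_of_neg
        (inv_pos.2 (norm_pos_iff.2 (h.gradient_ne y (hb hsR hy)))) ?_
      have : inner ℝ (gradient (F 0) y) u < -g := h1 y (hb hss₁ hy) u (hb hss₁ hu)
      linarith
    · have h4 := h.add_mul_le (c := g) hL.le fun t ht =>
        ⟨hb hsR (hL' t ht), (h2 _ (hb hss₂ (hL' t ht)) _ (h3 y (hb hss₃ hy) u (hb hss₃ hu))).le⟩
      rw [hF] at h4
      have : 0 < g * L := by positivity
      linarith
  · intro t ht htb
    -- backwards along the line the defining function grows
    have h4 := h.add_mul_le (y := x + t • v) (u := -v) (c := g) ht.le fun u hu => by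
      have e1 : x + t • v + u • -v = x + (t - u) • v := by rw [sub_smul, smul_neg]; abel
      have e2 := htb (t - u) ⟨by linarith [hu.2], by linarith [hu.1]⟩
      rw [e1, inner_neg_right]
      have : inner ℝ (gradient (F 0) (x + (t - u) • v)) v < -g :=
        h1 _ (hb hss₁ e2) v (Metric.mem_ball_self hs₁)
      exact ⟨hb hsR e2, by linarith⟩
    rw [smul_neg, add_neg_cancel_right, h.zero] at h4
    have : 0 < g * t := by positivity
    linarith

/-- Near a non-degenerate tangency the defining function is strictly convex along incoming and
along outgoing trajectories; some of them miss the boundary. -/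
theorem flowLimit_admissible_of_tangency (h : IsBoundaryChart B V e x R F) {v w : Space d}
    (hv : IsNondegenerateTangency B.D x v) (hw : ReflectionLaw B.D x v w) :
    ∃ s > 0, ∀ a b : ℝ, 0 < a → 0 < b → (∀ u ∈ Ioc 0 a, x - u • v ∈ interior B.D) →
      (∀ u ∈ Ioc 0 b, x + u • w ∈ interior B.D) → (‖v‖ + 1) * (2 * a + b) < s →
      FlowLimit (⊤ : Filter Unit) (fun _ => AdmissibleMapsTo B) (a + b) (x - a • v, v)
        (x + b • w, w) := by
  have hxR : x ∈ Metric.ball x R := Metric.mem_ball_self h.pos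
  have hrefl : reflect (F 0) x v = w := (h.reflectionLaw_reflect hxR h.zero v).unique hw
  have hcr := continuousAt_reflect (h.continuousAt_gradient hxR) (h.gradient_ne x hxR) v
  obtain ⟨hv1, hv2⟩ := hv.of_defining (h.isDefiningFunction hxR h.zero)
  have hwv : w = v := by
    rw [← hrefl, reflect, inner_smul_right, hv1]
    simp
  obtain ⟨c, hc0, hc⟩ := exists_between hv2
  obtain ⟨s₁, hs₁, h1⟩ := exists_ball_of_eventually
    (P := fun y u => c < fderiv ℝ (fderiv ℝ (F 0)) y u u) ((h.continuousAt_hessian hxR v).eventually (lt_mem_nhds hc))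
  obtain ⟨s₃, hs₃, h3⟩ := exists_ball_of_eventually (P := fun y u =>
    reflect (F 0) y u ∈ Metric.ball v s₁) (hcr.eventually (by
      beta_reduce
      rw [hrefl, hwv]
      exact Metric.ball_mem_nhds v hs₁))
  set s := min s₁ (min s₃ R)
  have hss₁ : s ≤ s₁ := min_le_left _ _
  have hss₃ : s ≤ s₃ := (min_le_right _ _).trans (min_le_left _ _)
  have hsR : s ≤ R := (min_le_right _ _).trans (min_le_right _ _)
  have hs : 0 < s := lt_min hs₁ (lt_min hs₃ h.pos)
  have hb : ∀ {y : Space d} {t : ℝ} {z : Space d}, s ≤ t → z ∈ Metric.ball y s →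
    z ∈ Metric.ball y t := fun hst hz => Metric.ball_subset_ball hst hz
  refine ⟨s, hs, fun a b ha hb' hin hout hab => h.flowLimit_admissible_of hw hs hsR ?_
    (Or.inl hwv) ha hb' hin hout hab⟩
  intro y hy u hu hF hG
  have hdef := h.isDefiningFunction (hb hsR hy) hF
  refine ⟨?_, fun L hL hL' => ?_⟩
  · rcases hG.eq_or_lt with hG | hG
    · refine Or.inr ⟨_, hdef, by rw [real_inner_comm, hG], ?_⟩
      exact hc0.trans (h1 y (hb hss₁ hy) u (hb hss₁ hu))
    · refine Or.inl ⟨_, h.isInwardNormal (hb hsR hy) hF, ?_⟩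
      rw [inner_smul_right, real_inner_comm]
      exact mul_neg_of_pos_of_neg (inv_pos.2 (norm_pos_iff.2 hdef.gradient_ne)) hG
  · have h4 := h.quadratic_le (c := c) hL.le fun t ht =>
      ⟨hb hsR (hL' t ht), (h1 _ (hb hss₁ (hL' t ht)) _ (h3 y (hb hss₃ hy) u (hb hss₃ hu))).le⟩
    rw [hF, inner_gradient_reflect hdef.gradient_ne] at h4
    have h5 : 0 < c / 2 * L ^ 2 := by positivity
    have h6 : 0 ≤ -inner ℝ (gradient (F 0) y) u * L := mul_nonneg (by linarith) hL.le
    linarith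

/-- Billiard trajectories which are close to a regular reflection or a non-degenerate tangency are
admissible and depend continuously on the initial point. -/
theorem flowLimit_admissible (h : IsBoundaryChart B V e x R F) {v w : Space d}
    (hadm : IsAdmissibleCollision B.D x v) (hw : ReflectionLaw B.D x v w) :
    ∃ s > 0, ∀ a b : ℝ, 0 < a → 0 < b → (∀ u ∈ Ioc 0 a, x - u • v ∈ interior B.D) →
      (∀ u ∈ Ioc 0 b, x + u • w ∈ interior B.D) → (‖v‖ + 1) * (2 * a + b) < s →
      FlowLimit (⊤ : Filter Unit) (fun _ => AdmissibleMapsTo B) (a + b) (x - a • v, v)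
        (x + b • w, w) := by
  rcases hadm with hv | hv
  · exact h.flowLimit_admissible_of_regular hv hw
  · exact h.flowLimit_admissible_of_tangency hv hw

end IsBoundaryChart

end SteepBilliard

namespace SteepBilliard

variable {d r : ℕ} {ι : Type} {B : Table d r ι}

/-! ### Convergence along a billiard trajectory -/

/-- A family of flows which converges to the billiard flow along free flights, and locally across
each collision, converges along every admissible trajectory. -/
theorem IsAdmissibleTrajectory.flowTimeLimit {α : Type*} {l : Filter α}
    {R : α → ℝ → Phase d → Phase d → Prop} {S : ℝ} {q p : ℝ → Space d}
    (h : IsAdmissibleTrajectory B S q p)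
    (hR : ∀ a s t ρ σ τ, R a s ρ σ → R a t σ τ → R a (s + t) ρ τ)
    (hfree : ∀ (y v : Space d) (τ : ℝ), 0 ≤ τ → (∀ u ∈ Icc 0 τ, y + u • v ∈ interior B.D) →
      FlowTimeLimit l R τ (y, v) (y + τ • v, v))
    (hcoll : ∀ x ∈ frontier B.D, x ∉ B.corner → ∀ v w : Space d, ‖v‖ = ‖p 0‖ →
      IsAdmissibleCollision B.D x v → ReflectionLaw B.D x v w →
      ∃ s > 0, ∀ a b : ℝ, 0 < a → 0 < b → (∀ u ∈ Ioc 0 a, x - u • v ∈ interior B.D) →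
        (∀ u ∈ Ioc 0 b, x + u • w ∈ interior B.D) → (‖v‖ + 1) * (2 * a + b) < s →
        FlowLimit l R (a + b) (x - a • v, v) (x + b • w, w)) :
    FlowTimeLimit l R S (q 0, p 0) (q S, p S) := by
  have hB := h.toIsBilliardTrajectory
  have hstep : ∀ s t, s ≤ t → (∀ u ∈ Icc s t, q u ∈ interior B.D) → p t = p s →
      (∀ u ∈ Icc s t, q u = q s + (u - s) • p s) →
      FlowTimeLimit l R (t - s) (q s, p s) (q t, p t) := by
    intro s t hst hin hp hq
    have := hfree (q s) (p s) (t - s) (sub_nonneg.2 hst) fun u hu => by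
      have h1 := hq (s + u) ⟨by linarith [hu.1], by linarith [hu.2]⟩
      rw [add_sub_cancel_left] at h1
      rw [← h1]
      exact hin _ ⟨by linarith [hu.1], by linarith [hu.2]⟩
    rwa [← hq t ⟨hst, le_rfl⟩, ← congrArg (Prod.mk (q t)) hp] at this
  have hzero : FlowTimeLimit l R 0 (q 0, p 0) (q 0, p 0) := by
    have := hfree (q 0) (p 0) 0 le_rfl fun u hu => by
      rw [← (le_antisymm hu.1 hu.2 : (0 : ℝ) = u), zero_smul, add_zero]
      exact hB.start_inner
    rwa [zero_smul, add_zero] at this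
  have hM : ∀ t ∈ Icc 0 S, q t ∈ interior B.D →
      ‖p t‖ = ‖p 0‖ ∧ FlowLimit l R t (q 0, p 0) (q t, p t) := by
    refine h.induction (M := fun t => ‖p t‖ = ‖p 0‖ ∧ FlowLimit l R t (q 0, p 0) (q t, p t)) ?_ ?_ ?_
    · exact ⟨rfl, hzero.flowLimit le_rfl⟩
    · intro s t hs hst htS hin hp hq hM
      refine ⟨by rw [hp, hM.1], ?_⟩
      have := hM.2.trans hR ((hstep s t hst hin hp hq).flowLimit (sub_nonneg.2 hst))
      rwa [add_sub_cancel] at this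
    · intro t ht hf hc v w hw hadm hl hr
      obtain ⟨s₁, hs₁, hl⟩ := mem_nhdsGT_iff_exists_Ioo_subset.1 hl
      obtain ⟨s₂, hs₂, hr⟩ := mem_nhdsGT_iff_exists_Ioo_subset.1 hr
      have hs₁' : 0 < s₁ := hs₁
      have hs₂' : 0 < s₂ := hs₂
      -- the speed `‖v‖` is known only from the induction hypothesis at an earlier time
      by_cases hv : ‖v‖ = ‖p 0‖
      · obtain ⟨s, hs, hfl⟩ := hcoll (q t) hf hc v w hv hadm hw
        have hv1 : 0 < ‖v‖ + 1 := by positivity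
        refine ⟨min (min s₁ s₂) (s / (3 * (‖v‖ + 1))), by positivity, fun a ha b hb _ _ hM => ?_⟩
        have has₁ : a < s₁ := ha.2.trans_le ((min_le_left _ _).trans (min_le_left _ _))
        have hbs₂ : b < s₂ := hb.2.trans_le ((min_le_left _ _).trans (min_le_right _ _))
        have ha3 := ha.2.trans_le (min_le_right _ _)
        have hb3 := hb.2.trans_le (min_le_right _ _)
        rw [lt_div_iff₀ (by positivity)] at ha3 hb3
        have h1 := hfl a b ha.1 hb.1 (fun u hu => (hl ⟨hu.1, hu.2.trans_lt has₁⟩).1)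
          (fun u hu => (hr ⟨hu.1, hu.2.trans_lt hbs₂⟩).1) (by nlinarith)
        have h2 := (hr ⟨hb.1, hbs₂⟩).2
        rw [← (hl ⟨ha.1, has₁⟩).2, ← h2] at h1
        refine ⟨?_, ?_⟩
        · have h3 : p (t + b) = w := congrArg Prod.snd h2
          rw [h3, hw.norm_eq, hv]
        · have := hM.2.trans hR h1
          rwa [← add_assoc, sub_add_cancel] at this
      · refine ⟨s₁, hs₁', fun a ha b _ _ _ hM => absurd ?_ hv⟩
        have h1 : p (t - a) = v := congrArg Prod.snd (hl ⟨ha.1, ha.2⟩).2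
        rw [← hM.1, h1]
  rcases hB.nonneg.eq_or_lt with h0 | h0
  · rwa [← h0]
  · obtain ⟨s, hs, v, hv1, hv2, hv3⟩ := hB.exists_left ⟨h0, le_rfl⟩
    have hin : ∀ u ∈ Icc s S, q u ∈ interior B.D := fun u hu =>
      hu.2.eq_or_lt.elim (fun h => h ▸ hB.end_inner) fun h => (hv1 u ⟨hu.1, h⟩).1
    have hfl := hB.free_on_Icc hs.1 le_rfl hin
    have h1 := (hM s ⟨hs.1, hs.2.le⟩ (hin s ⟨le_rfl, hs.2.le⟩)).2.trans_time hR (sub_pos.2 hs.2)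
      (hstep s S hs.2.le hin (hfl S ⟨hs.2.le, le_rfl⟩).1 fun u hu => (hfl u hu).2)
    rwa [add_sub_cancel] at h1

/-- The billiard flow is continuous at admissible trajectories, and trajectories nearby are
admissible. -/
theorem AdmissibleMapsTo.flowTimeLimit_billiard (hr : 1 ≤ r) {V : ℝ → Space d → EReal}
    {E : ι → EReal} (hcond : ConditionsItoIV B V E) (hE : 0 < ⨅ i, E i) {t : ℝ} {ρ σ : Phase d}
    (h : AdmissibleMapsTo B t ρ σ) :
    FlowTimeLimit (⊤ : Filter Unit) (fun _ => AdmissibleMapsTo B) t ρ σ := by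
  obtain ⟨q, p, h, rfl, rfl⟩ := h
  refine h.flowTimeLimit (fun _ _ _ _ _ _ h h' => h.trans h')
    (fun y v τ hτ hin => flowTimeLimit_billiard_free hτ hin) fun x hx hxc v w _ hadm hw => ?_
  obtain ⟨R, F, hch⟩ := exists_isBoundaryChart hr hcond hE (fun i => iInf_le E i) hx hxc
  exact hch.flowLimit_admissible hadm hw

/-- The Hamiltonian flows converge to the billiard flow at admissible trajectories. -/
theorem AdmissibleMapsTo.flowTimeLimit_hamiltonian (hr : 1 ≤ r) {V : ℝ → Space d → EReal}
    (hV : IsSmoothPotential r V) {E : ι → EReal} (hcond : ConditionsItoIV B V E) {t : ℝ}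
    {ρ σ : Phase d} (hE : ((‖ρ.2‖ ^ 2 / 2 : ℝ) : EReal) < ⨅ i, E i)
    (h : AdmissibleMapsTo B t ρ σ) :
    FlowTimeLimit (𝓝[>] 0) (hamiltonianRel V) t ρ σ := by
  obtain ⟨q, p, h, rfl, rfl⟩ := h
  have hV' := hV.eventually_isC2Potential hr
  have h0 : (0 : EReal) < ⨅ i, E i :=
    lt_of_le_of_lt (by exact_mod_cast (by positivity : (0 : ℝ) ≤ ‖p 0‖ ^ 2 / 2)) hE
  refine h.flowTimeLimit (fun _ _ _ _ _ _ h h' => HamiltonianMapsTo.trans h h')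
    (fun y v τ hτ hin => flowTimeLimit_free hV' hcond.1 hτ hin) fun x hx hxc v w hv hadm hw => ?_
  obtain ⟨R, F, hch⟩ := exists_isBoundaryChart hr hcond h0 (fun i => iInf_le E i) hx hxc
  exact ⟨R, hch.pos, fun a b ha hb hin hout hR =>
    hch.flowLimit_hamiltonian hV' hcond.1 (by rw [hv]; exact hE) hadm hw ha hb hin hout hR⟩

theorem billiardFlow_eq {t : ℝ} {ρ σ : Phase d} (h : BilliardMapsTo B t ρ σ) :
    billiardFlow B t ρ = σ :=
  BilliardMapsTo.unique (Classical.epsilon_spec (p := BilliardMapsTo B t ρ) ⟨σ, h⟩) h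

theorem hamiltonianFlow_eq {V : Space d → EReal} (hV : IsC2Potential V) {t : ℝ} {ρ σ : Phase d}
    (h : HamiltonianMapsTo V t ρ σ) : hamiltonianFlow V t ρ = σ :=
  HamiltonianMapsTo.unique hV (Classical.epsilon_spec (p := HamiltonianMapsTo V t ρ) ⟨σ, h⟩) h

theorem _root_.IsCompact.eventually_forall_of_forall_eventually_prod {X Y : Type*}
    [TopologicalSpace X] {K : Set X} (hK : IsCompact K) {l : Filter Y} {P : Y → X → Prop}
    (h : ∀ x ∈ K, ∀ᶠ z in l ×ˢ 𝓝[K] x, P z.1 z.2) : ∀ᶠ y in l, ∀ x ∈ K, P y x := by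
  refine hK.induction_on (p := fun s => ∀ᶠ y in l, ∀ x ∈ s, P y x) (by simp)
    (fun s t hst ht => ht.mono fun y hy x hx => hy x (hst hx)) (fun s t hs ht => ?_) fun x hx => ?_
  · filter_upwards [hs, ht] with y h1 h2 x hx using hx.elim (h1 x) (h2 x)
  · obtain ⟨A, hA, A', hA', hAA⟩ := eventually_prod_iff.1 (h x hx)
    exact ⟨_, hA', hA.mono fun y hy x hx => hAA hy hx⟩

/-- Continuous convergence to the billiard flow is uniform on compact sets of initial points and
times. -/
theorem eventually_dist_lt (hr : 1 ≤ r) {V : ℝ → Space d → EReal} (hV : IsSmoothPotential r V)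
    {E : ι → EReal} (hcond : ConditionsItoIV B V E) {K : Set (Phase d × ℝ)} (hK : IsCompact K)
    (hK0 : ∀ z ∈ K, 0 ≤ z.2) (hKE : ∀ z ∈ K, ((‖z.1.2‖ ^ 2 / 2 : ℝ) : EReal) < ⨅ i, E i)
    (hKadm : ∀ z ∈ K, ∃ σ, AdmissibleMapsTo B z.2 z.1 σ) {η : ℝ} (hη : 0 < η) :
    ∀ᶠ ε in 𝓝[>] (0 : ℝ), ∀ z ∈ K, ∃ σ, HamiltonianMapsTo (V ε) z.2 z.1 σ ∧
      dist (billiardFlow B z.2 z.1) σ < η := by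
  refine hK.eventually_forall_of_forall_eventually_prod fun z hz => ?_
  obtain ⟨σ, hσ⟩ := hKadm z hz
  have hle : 𝓝[K] z ≤ 𝓝 z.1 ×ˢ 𝓝[Ici 0] z.2 := by
    have h1 : K ⊆ univ ×ˢ Ici 0 := fun y hy => ⟨mem_univ _, hK0 y hy⟩
    refine (nhdsWithin_mono z h1).trans ?_
    rw [← nhdsWithin_univ z.1, ← nhdsWithin_prod_eq]
  have h0 : (0 : EReal) < ⨅ i, E i :=
    lt_of_le_of_lt (by exact_mod_cast (by positivity : (0 : ℝ) ≤ ‖z.1.2‖ ^ 2 / 2)) (hKE z hz)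
  have h1 := hσ.flowTimeLimit_hamiltonian hr hV hcond (hKE z hz) _ (Metric.ball_mem_nhds σ (half_pos hη))
  have h2 := hσ.flowTimeLimit_billiard hr hcond h0 _ (Metric.ball_mem_nhds σ (half_pos hη))
  have h3 : Tendsto (fun y : ℝ × Phase d × ℝ => ((), y.2)) (𝓝[>] 0 ×ˢ 𝓝[K] z)
      ((⊤ : Filter Unit) ×ˢ (𝓝 z.1 ×ˢ 𝓝[Ici 0] z.2)) :=
    tendsto_top.prodMk (tendsto_snd.mono_right hle)
  filter_upwards [h1.filter_mono (prod_mono le_rfl hle), h3.eventually h2]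
    with y ⟨σ₁, hσ₁, hy₁⟩ ⟨σ₂, hσ₂, hy₂⟩
  refine ⟨σ₁, hy₁, ?_⟩
  rw [billiardFlow_eq hy₂.billiardMapsTo]
  have := dist_triangle_right σ₂ σ₁ σ
  rw [Metric.mem_ball] at hσ₁ hσ₂
  linarith

/-- A neighbourhood of `(ρ, T)` on which the billiard flow is given by admissible trajectories with
energy below that of the barriers. -/
theorem AdmissibleMapsTo.exists_radius (hr : 1 ≤ r) {V : ℝ → Space d → EReal} {E : ι → EReal}
    (hcond : ConditionsItoIV B V E) {T : ℝ} {ρ σ : Phase d}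
    (hE : ((‖ρ.2‖ ^ 2 / 2 : ℝ) : EReal) < ⨅ i, E i) (h : AdmissibleMapsTo B T ρ σ) :
    ∃ δ > 0, ∀ z ∈ Metric.closedBall ρ δ ×ˢ {t : ℝ | 0 ≤ t ∧ |t - T| ≤ δ},
      ((‖z.1.2‖ ^ 2 / 2 : ℝ) : EReal) < ⨅ i, E i ∧ ∃ σ, AdmissibleMapsTo B z.2 z.1 σ := by
  have h0 : (0 : EReal) < ⨅ i, E i :=
    lt_of_le_of_lt (by exact_mod_cast (by positivity : (0 : ℝ) ≤ ‖ρ.2‖ ^ 2 / 2)) hE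
  have h1 : ∀ᶠ z in 𝓝 ρ ×ˢ 𝓝[Ici 0] T, ∃ σ, AdmissibleMapsTo B z.2 z.1 σ := by
    have h2 := h.flowTimeLimit_billiard hr hcond h0 univ univ_mem
    have h3 : Tendsto (fun y : Phase d × ℝ => ((), y)) (𝓝 ρ ×ˢ 𝓝[Ici 0] T)
        ((⊤ : Filter Unit) ×ˢ (𝓝 ρ ×ˢ 𝓝[Ici 0] T)) := tendsto_top.prodMk tendsto_id
    exact (h3.eventually h2).mono fun y hy => hy.imp fun σ hσ => hσ.2
  have h2 : ∀ᶠ z : Phase d in 𝓝 ρ, ((‖z.2‖ ^ 2 / 2 : ℝ) : EReal) < ⨅ i, E i := by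
    have hc : ContinuousAt (fun z : Phase d => ((‖z.2‖ ^ 2 / 2 : ℝ) : EReal)) ρ :=
      (continuous_coe_real_ereal.comp (by fun_prop : Continuous
        fun z : Phase d => ‖z.2‖ ^ 2 / 2)).continuousAt
    exact hc.eventually (gt_mem_nhds hE)
  obtain ⟨A, hA, A', hA', hAA⟩ := eventually_prod_iff.1 h1
  obtain ⟨δ₁, hδ₁, h3⟩ := Metric.nhds_basis_closedBall.eventually_iff.1 (hA.and h2)
  obtain ⟨δ₂, hδ₂, h4⟩ := Metric.nhds_basis_closedBall.eventually_iff.1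
    (eventually_nhdsWithin_iff.1 hA')
  refine ⟨min δ₁ δ₂, lt_min hδ₁ hδ₂, fun z ⟨hz1, hz2, hz3⟩ => ?_⟩
  have h5 := h3 (Metric.closedBall_subset_closedBall (min_le_left _ _) hz1)
  exact ⟨h5.2, hAA h5.1 (h4 (hz3.trans (min_le_right _ _)) hz2)⟩

end SteepBilliard

theorem theorem1 {d r : ℕ} (hr : 1 ≤ r) {ι : Type} [Finite ι]
    (B : SteepBilliard.Table d r ι)
    (V : ℝ → SteepBilliard.Space d → EReal) (hV : SteepBilliard.IsSmoothPotential r V)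
    (E : ι → EReal) (hcond : SteepBilliard.ConditionsItoIV B V E)
    (Hstar : ℝ) (hH : (Hstar : EReal) < ⨅ i, E i)
    (ρ₀ : SteepBilliard.Phase d) (henergy : ‖ρ₀.2‖ ^ 2 / 2 = Hstar)
    (T : ℝ) (q p : ℝ → SteepBilliard.Space d)
    (htraj : SteepBilliard.IsBilliardTrajectory B T q p) (hstart : (q 0, p 0) = ρ₀)
    (hcoll : ∀ t ∈ Icc 0 T, q t ∈ frontier B.D → ∃ pin, Tendsto p (𝓝[<] t) (𝓝 pin) ∧
      (SteepBilliard.IsRegularReflection B.D (q t) pin ∨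
        SteepBilliard.IsNondegenerateTangency B.D (q t) pin)) :
    ∃ δ > 0, ∃ U : Set (SteepBilliard.Phase d × ℝ),
      U = Metric.ball ρ₀ δ ×ˢ {t : ℝ | 0 ≤ t ∧ |t - T| < δ} ∧
      (∀ z ∈ U, ∃! σ, SteepBilliard.BilliardMapsTo B z.2 z.1 σ) ∧
      (∀ᶠ ε in 𝓝[>] (0 : ℝ), ∀ z ∈ U, ∃! σ, SteepBilliard.HamiltonianMapsTo (V ε) z.2 z.1 σ) ∧
      TendstoUniformlyOn (fun ε z => SteepBilliard.hamiltonianFlow (V ε) z.2 z.1)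
        (fun z => SteepBilliard.billiardFlow B z.2 z.1) (𝓝[>] (0 : ℝ)) U := by
  open SteepBilliard in
  have hadm : AdmissibleMapsTo B T ρ₀ (q T, p T) :=
    ⟨q, p, { toIsBilliardTrajectory := htraj, admissible := hcoll }, hstart, rfl⟩
  subst henergy
  obtain ⟨δ, hδ, hK⟩ := hadm.exists_radius hr hcond hH
  set K := Metric.closedBall ρ₀ δ ×ˢ {t : ℝ | 0 ≤ t ∧ |t - T| ≤ δ}
  have hKc : IsCompact K := by
    refine (isCompact_closedBall ρ₀ δ).prod ?_
    exact (isCompact_closedBall T δ).inter_left isClosed_Ici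
  set U := Metric.ball ρ₀ δ ×ˢ {t : ℝ | 0 ≤ t ∧ |t - T| < δ}
  have hUK : U ⊆ K := prod_mono Metric.ball_subset_closedBall fun t ht => ⟨ht.1, ht.2.le⟩
  have hclose : ∀ η > 0, ∀ᶠ ε in 𝓝[>] (0 : ℝ), ∀ z ∈ U, ∃ σ,
      HamiltonianMapsTo (V ε) z.2 z.1 σ ∧ dist (billiardFlow B z.2 z.1) σ < η := by
    intro η hη
    filter_upwards [eventually_dist_lt hr hV hcond hKc (fun z hz => hz.2.1)
      (fun z hz => (hK z hz).1) (fun z hz => (hK z hz).2) hη] with ε hε z hz using hε z (hUK hz)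
  have hV' := hV.eventually_isC2Potential hr
  refine ⟨δ, hδ, U, rfl, fun z hz => ?_, ?_, Metric.tendstoUniformlyOn_iff.2 fun η hη => ?_⟩
  · obtain ⟨σ, hσ⟩ := (hK z (hUK hz)).2
    exact ⟨σ, hσ.billiardMapsTo, fun σ' hσ' => hσ'.unique hσ.billiardMapsTo⟩
  · filter_upwards [hclose 1 one_pos, hV'] with ε h1 h2 z hz
    obtain ⟨σ, hσ, -⟩ := h1 z hz
    exact ⟨σ, hσ, fun σ' hσ' => HamiltonianMapsTo.unique h2 hσ' hσ⟩
  · filter_upwards [hclose η hη, hV'] with ε h1 h2 z hz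
    obtain ⟨σ, hσ, h3⟩ := h1 z hz
    rwa [hamiltonianFlow_eq h2 hσ]
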